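/- Let $n\ge 0$ and let $(M;\leq_1,\dots,\leq_n)$ be a countably infinite structure in the language consisting of exactly $n$ binary relation symbols, each $\leq_i$ being a linear order on $M$; write $M_i=(M,\leq_i)$. **Definitions.** "Definable" means first-order definable in $M$, over the indicated set of parameters, or over arbitrary parameters if none are indicated. $M$ is *$\omega$-categorical* if for every $k$ only finitely many types over $\emptyset$ of $k$-tuples of $M$ exist, and *transitive* if any two elements of $M$ have the same type over $\emptyset$. The order $M_i$ has *topological rank 1* if there is no definable equivalence relation on $M$ with $\leq_i$-convex classes, infinitely many of which are infinite. Subsets $X\subseteq M$ carry an order induced from $\leq_i$ or from its reverse. A *cut* of an ordered set $X$ is an initial segment of $X$, neither empty nor all of $X$, without last element; $\overline X$ denotes the set of definable cuts of $X$, ordered by inclusion, and $x\in M_j$ is identified with the cut $\{y: y<_j x\}$ of $M_j$. A map $f\colon X\to\overline Y$ is $B$-definable if the relation "$y\in f(x)$" is. A $B$-definable $X$ is *weakly transitive over $B$* if it is densely ordered without first or last element and every nonempty $B$-definable subset of $X$ is dense in $X$. For such $X,Y$, $X$ is *intertwined* with $Y$ over $B$ if there is a $B$-definable non-decreasing map $X\to\overline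 Y$ (over $\emptyset$ if $B$ is not mentioned). $M_i$ and $M_j$ are *independent* if there are no set $B\subseteq M$ and infinite $B$-definable sets $X,Y\subseteq M$, ordered by $\leq_i$ and $\leq_j$ respectively and both weakly transitive over $B$, such that $X$ is intertwined over $B$ with $Y$ or with the reverse of $Y$. **Statement.** Assume that $M$ is $\omega$-categorical and transitive, that each $M_i$ has topological rank 1, and that no two of the orders $\leq_i$, $\leq_j$ ($i\ne j$) are equal or reverse of each other. Then for all $i\neq j$ exactly one of the following holds: 1. $\leq_i$ and $\leq_j$ are independent; 2. $\leq_i$ is intertwined with $\leq_j$, there is a unique $\emptyset$-definable increasing map $f_{ij}\colon M_i\to\overline{M_j}$, and $f_{ij}(x)<_j x$ for all $x\in M$; 3. $\leq_i$ is intertwined with $\leq_j$, there is a unique $\emptyset$-definable increasing map $f_{ij}\colon M_i\to\overline{M_j}$, and $f_{ij}(x)>_j x$ for all $x\in M$; 4. $\leq_i$ is intertwined with the reverse of $\leq_j$, there is a unique $\emptyset$-definable decreasing map $f_{ij}\colon M_i\to\overline{M_j}$, and $f_{ij}(x)<_j x$ for all $x\in M$; 5. $\leq_i$ is intertwined with the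 reverse of $\leq_j$, there is a unique $\emptyset$-definable decreasing map $f_{ij}\colon M_i\to\overline{M_j}$, and $f_{ij}(x)>_j x$ for all $x\in M$. (The unique map in 2–5 is strictly monotone, and is unique even among all $\emptyset$-definable weakly monotone maps of the same direction.) Furthermore, the data of which case holds for each pair $i\neq j$ determines $M$ up to isomorphism: if $(M;\leq_1,\dots,\leq_n)$ and $(N;\leq_1,\dots,\leq_n)$ both satisfy the assumptions above and for all $i\ne j$ the same case holds in $M$ and in $N$, then $M\cong N$. -/

import Mathlib

open scoped FirstOrder

namespace MultiOrder

/-! ### The language of `n` binary relations -/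

/-- The relation symbols `≤_i`, `i < n`, all binary. -/
inductive OrderSymbol (n : ℕ) : ℕ → Type
  | le (i : Fin n) : OrderSymbol n 2

/-- The relational language with `n` binary relation symbols and nothing else. -/
def lang (n : ℕ) : FirstOrder.Language.{0, 0} := ⟨fun _ => Empty, OrderSymbol n⟩

/-- The symbol `≤_i`. -/
def leSymbol {n : ℕ} (i : Fin n) : (lang n).Relations 2 := OrderSymbol.le i

/-- The interpretation of the symbol `≤_i` in a structure for `lang n`. -/
def leAt {n : ℕ} (M : Type*) [(lang n).Structure M] (i : Fin n) (a b : M) : Prop :=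
  FirstOrder.Language.Structure.RelMap (leSymbol i) ![a, b]

/-- The reverse of an order. -/
def rev {M : Type*} (r : M → M → Prop) (a b : M) : Prop := r b a

/-- The strict part of an order. -/
def lt {M : Type*} (r : M → M → Prop) (a b : M) : Prop := r a b ∧ a ≠ b

/-! ### Model-theoretic notions -/

/-- The complete type over `∅` of a tuple: the set of all formulas that it satisfies. -/
def tp (L : FirstOrder.Language) {M : Type*} [L.Structure M] {α : Type*} (a : α → M) :
    Set (L.Formula α) :=
  {φ | φ.Realize a}

/-- `ω`-categoricity of a countable structure: for every `k`, only finitely many types over `∅`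
of `k`-tuples. -/
def OmegaCategorical (L : FirstOrder.Language) (M : Type*) [L.Structure M] : Prop :=
  ∀ k : ℕ, (Set.range fun a : Fin k → M => tp L a).Finite

/-- Transitivity over `∅`: any two elements have the same type over `∅`. -/
def TransitiveStructure (L : FirstOrder.Language) (M : Type*) [L.Structure M] : Prop :=
  ∀ a b : M, tp L (fun _ : Fin 1 => a) = tp L (fun _ : Fin 1 => b)

/-! ### Orders inside a structure

An order inside `M` is given by its underlying set `V : Set M` together with a relation `r` on `M`,
of which only the restriction to `V` matters. -/

/-- `r` has topological rank 1: there is no equivalence relation on `M`, definable with parameters,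
with `r`-convex classes, infinitely many of which are infinite. -/
def TopologicalRankOne (L : FirstOrder.Language) {M : Type*} [L.Structure M] (r : M → M → Prop) : Prop :=
  ¬ ∃ E : Setoid M,
    (Set.univ : Set M).Definable₂ L {p : M × M | E p.1 p.2} ∧
    (∀ a b c : M, r a b → r b c → E a c → E a b) ∧
    {C ∈ E.classes | C.Infinite}.Infinite

/-- `(V, r)` is weakly transitive over `B`: it is a dense order without first or last element, and
every `B`-definable subset `D` of `V` is either empty or dense in `V`, i.e. (for such an order) `D`
meets each open interval with endpoints `a < b` in `V`. -/
def WeaklyTransitive (L : FirstOrder.Language) {M : Type*} [L.Structure M] (B : Set M)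
    (V : Set M) (r : M → M → Prop) : Prop :=
  (∀ a ∈ V, ∀ b ∈ V, lt r a b → ∃ c ∈ V, lt r a c ∧ lt r c b) ∧
  (∀ a ∈ V, ∃ b ∈ V, lt r b a) ∧
  (∀ a ∈ V, ∃ b ∈ V, lt r a b) ∧
  ∀ D : Set M, D ⊆ V → B.Definable₁ L D → D.Nonempty →
    ∀ a ∈ V, ∀ b ∈ V, lt r a b → ∃ d ∈ D, lt r a d ∧ lt r d b

/-- `C` is a definable cut of `(V, r)`: an initial segment, neither empty nor all of `V`, without
last element, and definable with parameters. -/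
structure IsDefinableCut (L : FirstOrder.Language) {M : Type*} [L.Structure M]
    (V : Set M) (r : M → M → Prop) (C : Set M) : Prop where
  subset : C ⊆ V
  initial : ∀ a ∈ C, ∀ b ∈ V, r b a → b ∈ C
  nonempty : C.Nonempty
  ne_all : C ≠ V
  no_last : ∀ a ∈ C, ∃ b ∈ C, lt r a b
  definable : (Set.univ : Set M).Definable₁ L C

/-- The definable completion of `(V, r)`: the set of its definable cuts, ordered by inclusion. -/
abbrev Completion (L : FirstOrder.Language) {M : Type*} [L.Structure M]
    (V : Set M) (r : M → M → Prop) : Type _ :=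
  {C : Set M // IsDefinableCut L V r C}

/-- A map `f` from `V` to the completion of `(W, s)` is `B`-definable if the binary relation
`y ∈ f x` is `B`-definable. -/
def IsDefinableMap {L : FirstOrder.Language} {M : Type*} [L.Structure M] (B : Set M)
    {V W : Set M} {s : M → M → Prop} (f : V → Completion L W s) : Prop :=
  B.Definable₂ L {p : M × M | ∃ h : p.1 ∈ V, p.2 ∈ (f ⟨p.1, h⟩ : Set M)}

/-- `f` is non-decreasing from `(V, r)` to the completion of `(W, s)`. -/
def Nondecreasing {L : FirstOrder.Language} {M : Type*} [L.Structure M] (r : M → M → Prop)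
    {V W : Set M} {s : M → M → Prop} (f : V → Completion L W s) : Prop :=
  ∀ a b : V, r a b → f a ≤ f b

/-- `f` is (strictly) increasing from `(V, r)` to the completion of `(W, s)`. -/
def Increasing {L : FirstOrder.Language} {M : Type*} [L.Structure M] (r : M → M → Prop)
    {V W : Set M} {s : M → M → Prop} (f : V → Completion L W s) : Prop :=
  ∀ a b : V, lt r a b → f a < f b

/-- `(V, r)` is intertwined with `(W, s)` over `B`: there is a `B`-definable non-decreasing map
from `V` to the completion of `W`. -/
def Intertwined (L : FirstOrder.Language) {M : Type*} [L.Structure M] (B : Set M)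
    (V : Set M) (r : M → M → Prop) (W : Set M) (s : M → M → Prop) : Prop :=
  ∃ f : V → Completion L W s, IsDefinableMap B f ∧ Nondecreasing r f

/-- Independence of two `∅`-definable orders `(V, r)` and `(W, s)`: there are no set of parameters
`B` and infinite `B`-definable `X ⊆ V`, `Y ⊆ W`, both weakly transitive over `B` for the induced
orders, such that `X` is intertwined over `B` with `Y` or with the reverse of `Y`. -/
def Independent (L : FirstOrder.Language) {M : Type*} [L.Structure M]
    (V : Set M) (r : M → M → Prop) (W : Set M) (s : M → M → Prop) : Prop :=
  ¬ ∃ B X Y : Set M, X ⊆ V ∧ Y ⊆ W ∧ X.Infinite ∧ Y.Infinite ∧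
    B.Definable₁ L X ∧ B.Definable₁ L Y ∧
    WeaklyTransitive L B X r ∧ WeaklyTransitive L B Y s ∧
    (Intertwined L B X r Y s ∨ Intertwined L B X r Y (rev s))

/-! ### Pairs of orders on a multi-order -/

/-- The underlying set of each of the orders `M_i = (M, ≤_i)`: all of `M`. -/
abbrev whole (M : Type*) : Set M := Set.univ

/-- The completion of `M_j = (M, ≤_j)`. -/
abbrev CompletionAt {n : ℕ} (M : Type*) [(lang n).Structure M] (j : Fin n) : Type _ :=
  Completion (lang n) (whole M) (leAt M j)

/-- The cut `{y | y <_j x}` with which a point `x` of `M_j` is identified. -/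
def pointCut {n : ℕ} (M : Type*) [(lang n).Structure M] (j : Fin n) (x : M) : Set M :=
  {y | lt (leAt M j) y x}

/-- `f` is the unique `∅`-definable increasing map from `M_i` to the completion of `M_j`
(`f` is strictly increasing, and unique even among non-decreasing maps). -/
def IsUniqueIncreasing {n : ℕ} (M : Type*) [(lang n).Structure M] (i j : Fin n)
    (f : whole M → CompletionAt M j) : Prop :=
  IsDefinableMap ∅ f ∧ Increasing (leAt M i) f ∧
    ∀ g : whole M → CompletionAt M j,
      IsDefinableMap ∅ g → Nondecreasing (leAt M i) g → g = f

/-- `f` is the unique `∅`-definable decreasing map from `M_i` to the completion of `M_j`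
(`f` is strictly decreasing, and unique even among non-increasing maps). -/
def IsUniqueDecreasing {n : ℕ} (M : Type*) [(lang n).Structure M] (i j : Fin n)
    (f : whole M → CompletionAt M j) : Prop :=
  IsDefinableMap ∅ f ∧ Increasing (rev (leAt M i)) f ∧
    ∀ g : whole M → CompletionAt M j,
      IsDefinableMap ∅ g → Nondecreasing (rev (leAt M i)) g → g = f

/-- The five possible relations between two of the orders. -/
inductive PairCase
  | independent
  | increasingBelow
  | increasingAbove
  | decreasingBelow
  | decreasingAbove

/-- The meaning of the five cases for the pair `≤_i`, `≤_j`. In the last four, `f` is the map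
`f_{ij}` from `M_i` to the completion of `M_j`, and the inclusions say that `f_{ij}(x) <_j x`, resp.
`f_{ij}(x) >_j x`, for all `x`. -/
def PairCase.Holds {n : ℕ} (M : Type*) [(lang n).Structure M] (i j : Fin n) : PairCase → Prop
  | .independent =>
      Independent (lang n) (whole M) (leAt M i) (whole M) (leAt M j)
  | .increasingBelow =>
      Intertwined (lang n) ∅ (whole M) (leAt M i) (whole M) (leAt M j) ∧
      ∃ f : whole M → CompletionAt M j, IsUniqueIncreasing M i j f ∧
        ∀ x : whole M, (f x : Set M) ⊂ pointCut M j x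
  | .increasingAbove =>
      Intertwined (lang n) ∅ (whole M) (leAt M i) (whole M) (leAt M j) ∧
      ∃ f : whole M → CompletionAt M j, IsUniqueIncreasing M i j f ∧
        ∀ x : whole M, pointCut M j x ⊂ (f x : Set M)
  | .decreasingBelow =>
      Intertwined (lang n) ∅ (whole M) (leAt M i) (whole M) (rev (leAt M j)) ∧
      ∃ f : whole M → CompletionAt M j, IsUniqueDecreasing M i j f ∧
        ∀ x : whole M, (f x : Set M) ⊂ pointCut M j x
  | .decreasingAbove =>
      Intertwined (lang n) ∅ (whole M) (leAt M i) (whole M) (rev (leAt M j)) ∧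
      ∃ f : whole M → CompletionAt M j, IsUniqueDecreasing M i j f ∧
        ∀ x : whole M, pointCut M j x ⊂ (f x : Set M)

/-- The structures under consideration: `(M; ≤_1, …, ≤_n)` countably infinite, `ω`-categorical,
transitive, each `≤_i` a linear order of topological rank 1, no two of them equal or reverse of each
other. -/
structure IsRankOneMultiOrder (n : ℕ) (M : Type*) [(lang n).Structure M] : Prop where
  countable : Countable M
  infinite : Infinite M
  omegaCategorical : OmegaCategorical (lang n) M
  transitive : TransitiveStructure (lang n) M
  linear : ∀ i : Fin n, IsLinearOrder M (leAt M i)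
  rankOne : ∀ i : Fin n, TopologicalRankOne (lang n) (leAt M i)
  ne : ∀ i j : Fin n, i ≠ j → leAt M i ≠ leAt M j
  ne_rev : ∀ i j : Fin n, i ≠ j → leAt M i ≠ rev (leAt M j)

end MultiOrder

set_option linter.unusedSectionVars false

namespace MultiOrder

/-! ### Oligomorphic groups acting on linear orders of topological rank 1 -/

/-! The proof replaces formulas by the automorphism group `G`. Call a subgroup open if it contains
the pointwise stabilizer of a finite set. By `ω`-categoricity, any two open subgroups have finitely
many double cosets, and definability over a finite set is invariance under its pointwise stabilizer.
Rank 1 says that a convex equivalence relation invariant under an open subgroup has finitely many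
infinite classes. In particular an open subgroup leaves only finitely many sets invariant, so every
construction of infinitely many distinct invariant sets is contradictory.

The core concerns monotone maps of one order into the completion of another. A "leaf" is a strictly
increasing map without jumps on a convex set, invariant under an open subgroup. Two leaves that are
comparable in one way at one point are comparable in that way wherever both are defined
(`DLeaf.subset_of_subset`), since otherwise descending along them yields infinitely many invariant
sets. Only finitely many values at a given point come from translates of a leaf, and the lowest
value at each point defines a `G`-equivariant map. Hence each leaf extends to an equivariant map
(`DLeaf.exists_normal`), and this map is unique (`IsNormal.unique`). An intertwining that needs
parameters therefore always comes from one over `∅` (`exists_tw_of_intertwined`), so independence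
means that there is no equivariant map in either direction of monotonicity. If there is one,
transitivity puts its value on the same side of the argument everywhere; it cannot agree with the
argument, since the two orders would then be equal or reverse (`twinBelow_or_above`). This gives the
five cases.

For the isomorphism, choose a representative of each class of orders intertwined up to reversal, and
map all members of the class, suitably reversed, into its completion by equivariant maps `V i`.
Their images are dense and disjoint, and pointwise comparison orders the maps of a class linearly,
in a way that the cases determine (`IsOrientationMaps.triOf_iff`). The remaining point is that every
box with correctly arranged sides contains an element (`IsOrientationMaps.box`). It rests on
`OpenRel.cutAt_eq`: the cuts of an invariant open monotone relation in several variables are trivial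
or depend on a single variable through an equivariant map. So a moving side of a box can only be
stopped by one opposite side in its own class, and correct arrangements never reach it. Boxes
provide the extension step of a back-and-forth between two structures with the same cases
(`ChainSystem.exists_equiv`). -/

/-- A group with a family of "open" subgroups, any two of which have finitely many double cosets. -/
class OligGroup (G : Type*) [Group G] where
  /-- The open subgroups. -/
  Op : Subgroup G → Prop
  top : Op ⊤
  inf : ∀ {H K : Subgroup G}, Op H → Op K → Op (H ⊓ K)
  conj : ∀ {H : Subgroup G} (g : G), Op H → ∃ K, Op K ∧ ∀ k ∈ K, g⁻¹ * k * g ∈ H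
  fin : ∀ {H K : Subgroup G}, Op H → Op K →
    ∃ S : Set G, S.Finite ∧ ∀ g : G, ∃ s ∈ S, ∃ h ∈ H, ∃ k ∈ K, g = h * s * k

open OligGroup

/-- A linear order of topological rank 1 on which an oligomorphic group acts transitively. -/
class Tame (G P : Type*) [Group G] [OligGroup G] [LinearOrder P] [MulAction G P] : Prop where
  smul_le : ∀ (g : G) {a b : P}, a ≤ b → g • a ≤ g • b
  trans : ∀ x y : P, ∃ g : G, g • x = y
  stab : ∀ x : P, Op (MulAction.stabilizer G x)
  infinite : Infinite P
  rankOne : ∀ H : Subgroup G, Op H → ∀ E : Setoid P,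
    (∀ h ∈ H, ∀ x y, E x y → E (h • x) (h • y)) →
    (∀ a b c, a ≤ b → b ≤ c → E a c → E a b) →
    {C ∈ E.classes | C.Infinite}.Finite

/-! ### Finiteness and homogeneity of the action. -/

section

variable {G : Type*} [Group G] [OligGroup G]

lemma finite_range_of_biinvariant {H K : Subgroup G} (hH : Op H) (hK : Op K) {α : Type*}
    (φ : G → α) (h : ∀ a ∈ H, ∀ b ∈ K, ∀ g, φ (a * g * b) = φ g) : (Set.range φ).Finite := by
  obtain ⟨S, hS, hc⟩ := OligGroup.fin hH hK
  refine (hS.image φ).subset ?_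
  rintro _ ⟨g, rfl⟩
  obtain ⟨s, hs, a, ha, b, hb, rfl⟩ := hc g
  exact ⟨s, hs, (h a ha b hb s).symm⟩

variable {P : Type*} [LinearOrder P] [MulAction G P] [Tame G P]

lemma smul_le_iff (g : G) {a b : P} : g • a ≤ g • b ↔ a ≤ b :=
  ⟨fun h => by simpa using Tame.smul_le g⁻¹ h, Tame.smul_le g⟩

lemma smul_lt_iff (g : G) {a b : P} : g • a < g • b ↔ a < b := by
  rw [← not_le, ← not_le, smul_le_iff]

lemma finite_range_of_invariant {H : Subgroup G} (hH : Op H) {α : Type*} (φ : P → α)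
    (h : ∀ a ∈ H, ∀ x, φ (a • x) = φ x) : (Set.range φ).Finite := by
  rcases isEmpty_or_nonempty P with hP | ⟨⟨x₀⟩⟩
  · rw [Set.range_eq_empty]; exact Set.finite_empty
  have := finite_range_of_biinvariant hH (Tame.stab (G := G) x₀) (fun g => φ (g • x₀)) (by
    intro a ha b hb g
    rw [mul_smul, mul_smul, MulAction.mem_stabilizer_iff.1 hb, h a ha])
  refine this.subset ?_
  rintro _ ⟨x, rfl⟩
  obtain ⟨g, rfl⟩ := Tame.trans (G := G) x₀ x
  exact ⟨g, rfl⟩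

/-- An open subgroup leaves only finitely many sets invariant. -/
lemma finite_invariant_sets {H : Subgroup G} (hH : Op H) :
    {S : Set P | ∀ h ∈ H, ∀ x ∈ S, h • x ∈ S}.Finite := by
  -- A point `x` is replaced by its trace, the family of invariant sets containing it. Traces are
  -- constant on `H`-orbits, so there are finitely many, and an invariant set is determined by the
  -- traces of its points.
  have hf := finite_range_of_invariant (P := P) hH
    (fun x => {S : Set P | (∀ h ∈ H, ∀ x ∈ S, h • x ∈ S) ∧ x ∈ S}) (by
      intro a ha x
      ext S
      refine and_congr_right fun hS => ⟨fun hx => ?_, hS a ha x⟩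
      simpa using hS a⁻¹ (H.inv_mem ha) _ hx)
  refine Set.Finite.of_finite_image (f := fun S => (fun x => {S : Set P |
    (∀ h ∈ H, ∀ x ∈ S, h • x ∈ S) ∧ x ∈ S}) '' S) (hf.finite_subsets.subset ?_) ?_
  · rintro _ ⟨S, -, rfl⟩
    exact Set.image_subset_range _ _
  · have key : ∀ S T : Set P, (∀ h ∈ H, ∀ x ∈ S, h • x ∈ S) → (∀ h ∈ H, ∀ x ∈ T, h • x ∈ T) →
        ((fun x => {S : Set P | (∀ h ∈ H, ∀ x ∈ S, h • x ∈ S) ∧ x ∈ S}) '' S) ⊆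
        ((fun x => {S : Set P | (∀ h ∈ H, ∀ x ∈ S, h • x ∈ S) ∧ x ∈ S}) '' T) → S ⊆ T := by
      intro S T hS hT h x hx
      obtain ⟨y, hy, hxy⟩ := h ⟨x, hx, rfl⟩
      have : T ∈ {S : Set P | (∀ h ∈ H, ∀ x ∈ S, h • x ∈ S) ∧ y ∈ S} := ⟨hT, hy⟩
      simp only at hxy
      rw [hxy] at this
      exact this.2
    intro S hS T hT h
    exact (key S T hS hT (le_of_eq h)).antisymm (key T S hT hS (le_of_eq h.symm))

/-- There is no infinite sequence of distinct sets invariant under an open subgroup. -/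
lemma not_injective_of_invariant {H : Subgroup G} (hH : Op H) (K : ℕ → Set P)
    (hK : ∀ k, ∀ h ∈ H, ∀ x ∈ K k, h • x ∈ K k) : ¬ Function.Injective K := fun hi =>
  (Set.infinite_range_of_injective hi) ((finite_invariant_sets hH).subset (by
    rintro _ ⟨k, rfl⟩; exact hK k))

variable (G) in
lemma eq_univ_of_invariant {S : Set P} (hS : ∀ g : G, ∀ x ∈ S, g • x ∈ S) (hne : S.Nonempty) :
    S = Set.univ := by
  obtain ⟨x, hx⟩ := hne
  refine Set.eq_univ_of_forall fun y => ?_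
  obtain ⟨g, rfl⟩ := Tame.trans (G := G) x y
  exact hS g x hx

lemma Tame.noMaxOrder (G P : Type*) [Group G] [OligGroup G] [LinearOrder P] [MulAction G P]
    [Tame G P] : NoMaxOrder P := by
  have := Tame.infinite (G := G) (P := P)
  obtain ⟨a, b, hab⟩ := exists_pair_lt P
  refine ⟨fun x => ?_⟩
  obtain ⟨g, rfl⟩ := Tame.trans (G := G) a x
  exact ⟨g • b, (smul_lt_iff g).2 hab⟩

lemma Tame.noMinOrder (G P : Type*) [Group G] [OligGroup G] [LinearOrder P] [MulAction G P]
    [Tame G P] : NoMinOrder P := by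
  have := Tame.infinite (G := G) (P := P)
  obtain ⟨a, b, hab⟩ := exists_pair_lt P
  refine ⟨fun x => ?_⟩
  obtain ⟨g, rfl⟩ := Tame.trans (G := G) b x
  exact ⟨g • a, (smul_lt_iff g).2 hab⟩

/-- By transitivity one covering pair would give every point a successor. The successor map is
equivariant, so all its iterates at `a` are fixed by the stabilizer of `a`, which is open and leaves
only finitely many singletons invariant. -/
lemma Tame.denselyOrdered (G P : Type*) [Group G] [OligGroup G] [LinearOrder P] [MulAction G P]
    [Tame G P] : DenselyOrdered P := by
  by_contra hd
  obtain ⟨a, b, hab⟩ : ∃ a b : P, a ⋖ b := by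
    by_contra! h
    refine hd ⟨fun a b hab => ?_⟩
    by_contra! hc
    exact h a b ⟨hab, fun c hac hcb => (hc c hac).not_gt hcb⟩
  have hs : ∀ x : P, ∃ y, x ⋖ y := fun x => by
    obtain ⟨g, rfl⟩ := Tame.trans (G := G) a x
    refine ⟨g • b, (smul_lt_iff g).2 hab.1, fun c h1 h2 => hab.2 (c := g⁻¹ • c) ?_ ?_⟩
    · rw [← smul_lt_iff g]; simpa using h1
    · rw [← smul_lt_iff g]; simpa using h2
  choose s hs using hs
  have hinv : ∀ (g : G) x, g • s x = s (g • x) := fun g x => by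
    have h1 : g • x ⋖ g • s x := ⟨(smul_lt_iff g).2 (hs x).1, fun c h1 h2 =>
      (hs x).2 (c := g⁻¹ • c) (by rw [← smul_lt_iff g]; simpa using h1)
        (by rw [← smul_lt_iff g]; simpa using h2)⟩
    exact h1.unique_right (hs _)
  have hmono : StrictMono fun k : ℕ => s^[k] a :=
    strictMono_nat_of_lt_succ fun k => by
      rw [Function.iterate_succ_apply']; exact (hs _).1
  refine not_injective_of_invariant (P := P) (Tame.stab (G := G) a) (fun k => {s^[k] a}) ?_ ?_
  · rintro k h hh x rfl
    simp only [Set.mem_singleton_iff]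
    induction k with
    | zero => exact hh
    | succ k ih => rw [Function.iterate_succ_apply', hinv, ih]
  · intro k l hkl
    exact hmono.injective (Set.singleton_injective hkl)

/-- A convex equivalence relation invariant under the whole group, all of whose classes are
infinite, is trivial. -/
lemma rel_of_infinite_classes (E : Setoid P) (hE : ∀ (g : G) x y, E x y → E (g • x) (g • y))
    (hc : ∀ a b c, a ≤ b → b ≤ c → E a c → E a b) (hinf : ∀ x, {y | E y x}.Infinite) (x y : P) :
    E x y := by
  have hfin := Tame.rankOne (G := G) ⊤ OligGroup.top E (fun h _ => hE h) hc
  have hfin' : E.classes.Finite := hfin.subset fun C hC => ⟨hC, by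
    obtain ⟨z, rfl⟩ := hC; exact hinf z⟩
  have : Finite (Quotient E) := by
    have := hfin'.to_subtype
    exact Finite.of_equiv _ (Setoid.quotientEquivClasses E).symm
  have : Nonempty (Quotient E) := ⟨⟦x⟧⟩
  obtain ⟨q, hq⟩ := Finite.exists_min (fun q : Quotient E => q.out)
  -- The lowest class. It exists because rank 1 leaves finitely many classes, and as an invariant
  -- nonempty set it is everything.
  let D : Set P := {z | ∀ w, z ≤ w ∨ E z w}
  have hD : D = Set.univ := by
    refine eq_univ_of_invariant G ?_ ⟨q.out, fun w => ?_⟩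
    · intro g z hz w
      rcases hz (g⁻¹ • w) with h | h
      · left; simpa using Tame.smul_le g h
      · right; simpa using hE g _ _ h
    · by_contra! h
      have hw := hq ⟦w⟧
      have h2 : E w (Quotient.mk E w).out := E.symm (Quotient.mk_out w)
      exact h.2 (E.symm (hc _ _ _ h.1.le hw h2))
  rcases le_total x y with h | h
  · rcases (hD ▸ Set.mem_univ y : y ∈ D) x with h' | h'
    · rw [le_antisymm h h']
    · exact E.symm h'
  · rcases (hD ▸ Set.mem_univ x : x ∈ D) y with h' | h'
    · rw [le_antisymm h h']
    · exact h'

end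

/-! ### Strictly increasing maps without jumps into the lower sets of an order -/

/-- `u` is strictly increasing and without jumps on the convex set `I`, with lower sets as values. -/
structure PreLeaf {P Q : Type*} [LinearOrder P] [LinearOrder Q] (I : Set P) (u : P → Set Q) :
    Prop where
  conn : I.OrdConnected
  lower : ∀ x ∈ I, IsLowerSet (u x)
  strict : ∀ x ∈ I, ∀ x' ∈ I, x < x' → u x ⊂ u x'
  nojump : ∀ x ∈ I, ∀ x' ∈ I, ∀ y y', y < y' → y ∉ u x → y' ∈ u x' → ∃ t ∈ I, y ∈ u t ∧ y' ∉ u t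

/-- `I` and `u` are invariant under `H`. -/
def InvOn {G P Q : Type*} [Group G] [MulAction G P] [MulAction G Q] (H : Subgroup G)
    (I : Set P) (u : P → Set Q) : Prop :=
  ∀ h ∈ H, ∀ x ∈ I, h • x ∈ I ∧ ∀ y, h • y ∈ u (h • x) ↔ y ∈ u x

section

variable {P Q : Type*} [LinearOrder P] [LinearOrder Q] {I : Set P} {u w : P → Set Q}

lemma PreLeaf.mono (hu : PreLeaf I u) {x x' : P} (hx : x ∈ I) (hx' : x' ∈ I) (h : x ≤ x') :
    u x ⊆ u x' := by
  rcases h.eq_or_lt with rfl | h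
  · exact subset_rfl
  · exact (hu.strict x hx x' hx' h).subset

lemma PreLeaf.lt_of_mem (hu : PreLeaf I u) {x x' : P} {y : Q} (hx : x ∈ I) (hx' : x' ∈ I)
    (h : y ∉ u x) (h' : y ∈ u x') : x < x' :=
  lt_of_not_ge fun hle => h (hu.mono hx' hx hle h')

lemma PreLeaf.lt_of_mem_value (hu : PreLeaf I u) {x : P} {y y' : Q} (hx : x ∈ I)
    (h : y ∈ u x) (h' : y' ∉ u x) : y < y' :=
  lt_of_not_ge fun hle => h' (hu.lower x hx hle h)

lemma PreLeaf.subset_of_not_subset (hu : PreLeaf I u) (hw : PreLeaf I w) {x x' : P} (hx : x ∈ I)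
    (hx' : x' ∈ I) (h : ¬ u x ⊆ w x') : w x' ⊆ u x :=
  ((hu.lower x hx).total (hw.lower x' hx')).resolve_left h

/-- Three points are what the descent below needs: applying the absence of jumps of the other map to
`y₁ < y₂` and to `y₂ < y₃` yields two of its values, hence two new arguments. -/
lemma PreLeaf.three_points [DenselyOrdered P] (hu : PreLeaf I u) {a b : P} (ha : a ∈ I)
    (hb : b ∈ I) (hab : a < b) : ∃ y₁ y₂ y₃, y₁ < y₂ ∧ y₂ < y₃ ∧ y₁ ∉ u a ∧ y₂ ∉ u a ∧ y₃ ∉ u a ∧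
      y₁ ∈ u b ∧ y₂ ∈ u b ∧ y₃ ∈ u b := by
  obtain ⟨c, hac, hcb⟩ := exists_between hab
  obtain ⟨d, hcd, hdb⟩ := exists_between hcb
  have hc : c ∈ I := hu.conn.out ha hb ⟨hac.le, hcb.le⟩
  have hd : d ∈ I := hu.conn.out hc hb ⟨hcd.le, hdb.le⟩
  obtain ⟨y₁, h1, h1'⟩ := Set.exists_of_ssubset (hu.strict a ha c hc hac)
  obtain ⟨y₂, h2, h2'⟩ := Set.exists_of_ssubset (hu.strict c hc d hd hcd)
  obtain ⟨y₃, h3, h3'⟩ := Set.exists_of_ssubset (hu.strict d hd b hb hdb)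
  have s1 := hu.mono ha hc hac.le
  have s2 := hu.mono hc hd hcd.le
  have s3 := hu.mono hd hb hdb.le
  exact ⟨y₁, y₂, y₃, hu.lt_of_mem_value hc h1 h2', hu.lt_of_mem_value hd h2 h3', h1',
    fun h => h2' (s1 h), fun h => h3' (s2 (s1 h)), s3 (s2 h1), s3 h2, h3⟩

/-! ### Comparison of two leaves on the same convex set. -/

/-- The sequence of lower parts of `I` below which `u` catches up with `w`. -/
def descent (I : Set P) (u w : P → Set Q) (z : P) : ℕ → Set P
  | 0 => {s | s ∈ I ∧ s ≤ z}
  | k + 1 => {s | s ∈ I ∧ u s ⊆ ⋃ t ∈ descent I u w z k, w t}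

lemma descent_subset (z : P) (k : ℕ) : descent I u w z k ⊆ I := by
  cases k <;> exact fun s hs => hs.1

variable {G : Type*} [Group G] [OligGroup G] [MulAction G P] [MulAction G Q]

variable [Tame G P]

lemma descent_invariant {H : Subgroup G} (iu : InvOn H I u) (iw : InvOn H I w) (z : P) (k : ℕ) :
    ∀ h ∈ H ⊓ MulAction.stabilizer G z, ∀ x ∈ descent I u w z k, h • x ∈ descent I u w z k := by
  induction k with
  | zero =>
    rintro h ⟨hh, hz⟩ x ⟨hx, hxz⟩
    refine ⟨(iu h hh x hx).1, ?_⟩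
    rw [← MulAction.mem_stabilizer_iff.1 hz]
    exact Tame.smul_le h hxz
  | succ k ih =>
    rintro h hh x ⟨hx, hxs⟩
    refine ⟨(iu h hh.1 x hx).1, fun y hy => ?_⟩
    have h1 : h⁻¹ • y ∈ u x := by
      rw [← (iu h hh.1 x hx).2, smul_inv_smul]; exact hy
    obtain ⟨t, ht, hyt⟩ := Set.mem_iUnion₂.1 (hxs h1)
    refine Set.mem_iUnion₂.2 ⟨h • t, ih h hh t ht, ?_⟩
    rw [← (iw h hh.1 t (descent_subset z k ht)).2, smul_inv_smul] at hyt
    exact hyt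

/-- Since `u` is above `w`, each step of the descent loses points; as long as no step is empty the
sets are all distinct. They are invariant under the open subgroup of `H` fixing `z`, so this cannot
go on forever. -/
lemma descent_eventually_empty {H : Subgroup G} (hH : Op H) (hu : PreLeaf I u) (hw : PreLeaf I w)
    (iu : InvOn H I u) (iw : InvOn H I w) {z z' : P} (hz : z ∈ I) (hz' : z' ∈ I) (hzz : z < z')
    (h : ¬ u z ⊆ w z') : ∃ m, descent I u w z m = ∅ := by
  by_contra! hne
  have := Tame.denselyOrdered G P
  set K := descent I u w z with hK
  have hKI : ∀ k, K k ⊆ I := descent_subset z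
  have hwu : w z' ⊆ u z := hu.subset_of_not_subset hw hz hz' h
  -- A point of the nonempty set `K (k + 1)` has a `u`-value missing `y₁`, while `u z` contains
  -- `y₃`; so `u` passes through both gaps `y₁ < y₂` and `y₂ < y₃`.
  have key : ∀ (k : ℕ) (y₁ y₂ y₃ : Q), y₁ < y₂ → y₂ < y₃ → y₁ ∉ ⋃ t ∈ K k, w t →
      y₃ ∈ u z → ∃ t ∈ I, ∃ t' ∈ I, t < t' ∧ y₁ ∈ u t ∧ y₂ ∉ u t ∧ y₂ ∈ u t' ∧ y₃ ∉ u t' := by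
    intro k y₁ y₂ y₃ h12 h23 h1 h3
    obtain ⟨t₀, ht₀⟩ := hne (k + 1)
    have hy1 : y₁ ∉ u t₀ := fun hy => h1 (ht₀.2 hy)
    have hy2 : y₂ ∉ u t₀ := fun hy => hy1 (hu.lower t₀ ht₀.1 h12.le hy)
    obtain ⟨t, ht, ha, hb⟩ := hu.nojump t₀ ht₀.1 z hz y₁ y₂ h12 hy1 (hu.lower z hz h23.le h3)
    obtain ⟨t', ht', ha', hb'⟩ := hu.nojump t₀ ht₀.1 z hz y₂ y₃ h23 hy2 h3
    exact ⟨t, ht, t', ht', hu.lt_of_mem ht ht' hb ha', ha, hb, ha', hb'⟩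
  have hle : ∀ k, K (k + 1) ⊆ K k := by
    intro k
    induction k with
    | zero =>
      rintro s ⟨hs, hsu⟩
      refine ⟨hs, le_of_not_gt fun hzs => h ?_⟩
      refine (hu.mono hz hs hzs.le).trans (hsu.trans ?_)
      exact Set.iUnion₂_subset fun t ht => hw.mono ht.1 hz' (ht.2.trans hzz.le)
    | succ k ih =>
      rintro s ⟨hs, hsu⟩
      exact ⟨hs, hsu.trans (Set.biUnion_mono ih fun _ _ => subset_rfl)⟩
  have hKz : ∀ k, K k ⊆ K 0 := fun k => by
    induction k with
    | zero => exact subset_rfl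
    | succ k ih => exact (hle k).trans ih
  have hlow : ∀ k, ∀ a ∈ K k, ∀ b ∈ I, b ≤ a → b ∈ K k := by
    intro k a ha b hb hba
    cases k with
    | zero => exact ⟨hb, hba.trans ha.2⟩
    | succ k => exact ⟨hb, (hu.mono hb ha.1 hba).trans ha.2⟩
  have hK0 : ⋃ t ∈ K 0, w t ⊆ w z := Set.iUnion₂_subset fun t ht => hw.mono ht.1 hz ht.2
  -- Strictness of the descent is proved with two lost points `a < b` instead of one, because the
  -- induction needs the gap between `w a` and `w b`: it lies above all `w`-values on `K (k + 1)`
  -- and below the union of those on `K k`, and two arguments whose `u`-values fall into it are the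
  -- ones lost at the next step.
  have two : ∀ k, ∃ a b, a < b ∧ a ∈ K k ∧ b ∈ K k ∧ a ∉ K (k + 1) ∧ b ∉ K (k + 1) := by
    intro k
    induction k with
    | zero =>
      obtain ⟨y₁, y₂, y₃, h12, h23, n1, n2, n3, m1, m2, m3⟩ := hw.three_points hz hz' hzz
      obtain ⟨t, ht, t', ht', htt, a1, a2, a3, a4⟩ :=
        key 0 y₁ y₂ y₃ h12 h23 (fun hy => n1 (hK0 hy)) (hwu m3)
      have htz : t' < z := hu.lt_of_mem ht' hz a4 (hwu m3)
      exact ⟨t, t', htt, ⟨ht, (htt.trans htz).le⟩, ⟨ht', htz.le⟩,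
        fun h' => n1 (hK0 (h'.2 a1)), fun h' => n2 (hK0 (h'.2 a3))⟩
    | succ k ih =>
      obtain ⟨a, b, hab, ha, hb, ha', hb'⟩ := ih
      obtain ⟨y₁, y₂, y₃, h12, h23, n1, n2, n3, m1, m2, m3⟩ :=
        hw.three_points (hKI k ha) (hKI k hb) hab
      have hKa : ⋃ t ∈ K (k + 1), w t ⊆ w a := Set.iUnion₂_subset fun t ht =>
        hw.mono ht.1 (hKI k ha) (le_of_not_gt fun hat => ha' (hlow _ _ ht _ (hKI k ha) hat.le))
      have hbK : w b ⊆ ⋃ t ∈ K k, w t := fun y hy => Set.mem_iUnion₂.2 ⟨b, hb, hy⟩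
      have hbz : w b ⊆ u z := (hw.mono (hKI k hb) hz' ((hKz k hb).2.trans hzz.le)).trans hwu
      obtain ⟨t, ht, t', ht', htt, a1, a2, a3, a4⟩ :=
        key (k + 1) y₁ y₂ y₃ h12 h23 (fun hy => n1 (hKa hy)) (hbz m3)
      have ht'K : t' ∈ K (k + 1) := ⟨ht', fun y hy => hbK (hw.lower b (hKI k hb)
        (hu.lt_of_mem_value ht' hy a4).le m3)⟩
      exact ⟨t, t', htt, hlow _ _ ht'K _ ht htt.le, ht'K,
        fun h' => n1 (hKa (h'.2 a1)), fun h' => n2 (hKa (h'.2 a3))⟩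
  have hanti : StrictAnti K := strictAnti_nat_of_succ_lt fun k => by
    obtain ⟨a, b, -, ha, -, ha', -⟩ := two k
    exact ⟨hle k, fun h' => ha' (h' ha)⟩
  exact not_injective_of_invariant (OligGroup.inf hH (Tame.stab z)) K
    (descent_invariant iu iw z) hanti.injective

/-- If `u` is above `w` somewhere, there is a bound on the number of times that `u` catches up with
`w` when descending. -/
lemma PreLeaf.bounded_chains {H : Subgroup G} (hH : Op H) (hu : PreLeaf I u) (hw : PreLeaf I w)
    (iu : InvOn H I u) (iw : InvOn H I w) {z z' : P} (hz : z ∈ I) (hz' : z' ∈ I) (hzz : z < z')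
    (h : ¬ u z ⊆ w z') :
    ∃ m, ∀ x : ℕ → P, x 0 ≤ z → (∀ k, x k ∈ I) → ¬ ∀ k < m, u (x (k + 1)) ⊆ w (x k) := by
  obtain ⟨m, hm⟩ := descent_eventually_empty hH hu hw iu iw hz hz' hzz h
  refine ⟨m, fun x hx0 hxI hx => ?_⟩
  have : ∀ k ≤ m, x k ∈ descent I u w z k := by
    intro k hk
    induction k with
    | zero => exact ⟨hxI 0, hx0⟩
    | succ k ih =>
      exact ⟨hxI _, (hx k (by omega)).trans fun y hy => Set.mem_iUnion₂.2 ⟨_, ih (by omega), hy⟩⟩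
  exact (hm ▸ this m le_rfl : x m ∈ (∅ : Set P))

/-- Below `z`, an inclusion `u t ⊆ w t` would make the constant sequence `t` a chain of unlimited
length. Between `z` and `z'` monotonicity suffices. -/
lemma PreLeaf.not_subset_of_le {H : Subgroup G} (hH : Op H) (hu : PreLeaf I u) (hw : PreLeaf I w)
    (iu : InvOn H I u) (iw : InvOn H I w) {z z' : P} (hz : z ∈ I) (hz' : z' ∈ I) (hzz : z < z')
    (h : ¬ u z ⊆ w z') {t : P} (ht : t ∈ I) (htz : t ≤ z') : ¬ u t ⊆ w t := by
  rcases le_or_gt z t with hzt | hzt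
  · exact fun h' => h ((hu.mono hz ht hzt).trans (h'.trans (hw.mono ht hz' htz)))
  obtain ⟨m, hm⟩ := hu.bounded_chains hH hw iu iw hz hz' hzz h
  exact fun h' => hm (fun _ => t) hzt.le (fun _ => ht) fun _ _ => h'

open OrderDual in
/-- The complementary map between the dual orders. -/
lemma PreLeaf.dual (hu : PreLeaf I u) :
    PreLeaf (P := Pᵒᵈ) (Q := Qᵒᵈ) (ofDual ⁻¹' I) fun x => ofDual ⁻¹' (u (ofDual x))ᶜ where
  conn := hu.conn.dual
  lower x hx y y' hyy hy hy' := hy (hu.lower _ hx (a := ofDual y') (b := ofDual y) hyy hy')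
  strict x hx x' hx' hxx := by
    have h1 := hu.strict _ hx' _ hx hxx
    exact ⟨fun y hy hy' => hy (h1.1 hy'), fun h2 => h1.2 fun y hy => by
      by_contra hy'
      exact h2 (a := toDual y) hy' hy⟩
  nojump x hx x' hx' y y' hyy hy hy' := by
    obtain ⟨t, ht, h1, h2⟩ := hu.nojump _ hx' _ hx (ofDual y') (ofDual y) hyy hy' (not_not.1 hy)
    exact ⟨toDual t, ht, h2, fun h3 => h3 h1⟩

open OrderDual in
instance Tame.dual : Tame G Pᵒᵈ where
  smul_le g a b hab := Tame.smul_le (G := G) (P := P) g (a := ofDual b) (b := ofDual a) hab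
  trans x y := Tame.trans (G := G) (P := P) (ofDual x) (ofDual y)
  stab x := Tame.stab (G := G) (P := P) (ofDual x)
  infinite := Tame.infinite (G := G) (P := P)
  rankOne H hH E hE hc := Tame.rankOne (G := G) (P := P) H hH E hE fun a b c hab hbc hac =>
    E.trans hac (hc c b a hbc hab (E.symm hac))

open OrderDual in
/-- If `u` is above `w` somewhere on `I`, it is above `w` on all of `I`. -/
lemma PreLeaf.not_subset {H : Subgroup G} (hH : Op H) (hu : PreLeaf I u) (hw : PreLeaf I w)
    (iu : InvOn H I u) (iw : InvOn H I w) {z z' : P} (hz : z ∈ I) (hz' : z' ∈ I) (hzz : z < z')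
    (h : ¬ u z ⊆ w z') {t : P} (ht : t ∈ I) : ¬ u t ⊆ w t := by
  rcases le_total t z' with htz | htz
  · exact hu.not_subset_of_le hH hw iu iw hz hz' hzz h ht htz
  -- Complements in the dual orders exchange the roles of `u` and `w`; the part above `z'` thus
  -- follows from the part below.
  have dualInv : ∀ {v : P → Set Q}, InvOn H I v →
      InvOn (P := Pᵒᵈ) (Q := Qᵒᵈ) H (ofDual ⁻¹' I) fun x => ofDual ⁻¹' (v (ofDual x))ᶜ :=
    fun hv g hg x hx => ⟨(hv g hg _ hx).1, fun y => not_congr ((hv g hg _ hx).2 (ofDual y))⟩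
  have := hw.dual.not_subset_of_le hH hu.dual (dualInv iw) (dualInv iu) (z := toDual z')
    (z' := toDual z) hz' hz hzz (fun h' => h fun y hy => by
      by_contra hy'
      exact h' (a := toDual y) hy' hy) (t := toDual t) ht (htz.trans' hzz.le : z ≤ t)
  exact fun h' => this fun y hy hy' => hy (h' hy')

/-- A strictly increasing map without jumps on a nonempty convex set without greatest or least
element, the values of which are lower sets without greatest element. -/
structure Leaf (I : Set P) (u : P → Set Q) : Prop extends PreLeaf I u where
  noLast : ∀ x ∈ I, ∀ y ∈ u x, ∃ y' ∈ u x, y < y'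
  nonempty : I.Nonempty
  noMax : ∀ x ∈ I, ∃ x' ∈ I, x < x'
  noMin : ∀ x ∈ I, ∃ x' ∈ I, x' < x

omit [OligGroup G] [MulAction G P] [MulAction G Q] [Tame G P] in
-- Here the absence of greatest elements is used: `u x` contains some `y < y₁` with `y` outside `w
-- x`, and `w` has a value separating `y` from `y₁`. The result is the room between `z` and `z'`
-- that the comparison arguments require.
lemma Leaf.exists_gt_not_subset (hu : Leaf I u) (hw : Leaf I w) {x : P} (hx : x ∈ I)
    (h : ¬ u x ⊆ w x) : ∃ x' ∈ I, x < x' ∧ ¬ u x ⊆ w x' := by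
  obtain ⟨y, hy, hy'⟩ := Set.not_subset.1 h
  obtain ⟨y₁, hy₁, hyy⟩ := hu.noLast x hx y hy
  obtain ⟨x₁, hx₁, hxx⟩ := hw.noMax x hx
  by_cases h1 : y₁ ∈ w x₁
  · obtain ⟨t, ht, ha, hb⟩ := hw.nojump x hx x₁ hx₁ y y₁ hyy hy' h1
    exact ⟨t, ht, hw.lt_of_mem hx ht hy' ha, fun h' => hb (h' hy₁)⟩
  · exact ⟨x₁, hx₁, hxx, fun h' => h1 (h' hy₁)⟩

/-- Two leaves on `I` that agree at one point agree. -/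
lemma Leaf.subset_of_subset {H : Subgroup G} (hH : Op H) (hu : Leaf I u) (hw : Leaf I w)
    (iu : InvOn H I u) (iw : InvOn H I w) {x t : P} (hx : x ∈ I) (ht : t ∈ I) (h : u x ⊆ w x) :
    u t ⊆ w t := by
  by_contra h'
  obtain ⟨t', ht', htt, h1⟩ := hu.exists_gt_not_subset hw ht h'
  exact hu.not_subset hH hw.toPreLeaf iu iw ht ht' htt h1 hx h

end

/-! ### Translates of a leaf -/

lemma infinite_of_noLast {Q : Type*} [LinearOrder Q] {S : Set Q} (hne : S.Nonempty)
    (h : ∀ y ∈ S, ∃ y' ∈ S, y < y') : S.Infinite := fun hfin => by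
  obtain ⟨y, hy, hmax⟩ := Set.exists_max_image S id hfin hne
  obtain ⟨y', hy', hlt⟩ := h y hy
  exact (hmax y' hy').not_gt hlt

lemma exists_bound_of_finite_range {X : Type*} (φ : X → ℕ) (h : (Set.range φ).Finite) :
    ∃ N, ∀ x, φ x ≤ N := by
  obtain ⟨N, hN⟩ := h.bddAbove
  exact ⟨N, fun x => hN ⟨x, rfl⟩⟩

section

variable {G P Q : Type*} [Group G] [MulAction G P] [MulAction G Q]

/-- The translate of a set. -/
def trI (g : G) (I : Set P) : Set P := {x | g⁻¹ • x ∈ I}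

/-- The translate of a map. -/
def tr (g : G) (u : P → Set Q) (x : P) : Set Q := {y | g⁻¹ • y ∈ u (g⁻¹ • x)}

lemma mem_trI {g : G} {I : Set P} {x : P} : x ∈ trI g I ↔ g⁻¹ • x ∈ I := Iff.rfl

lemma mem_tr {g : G} {u : P → Set Q} {x : P} {y : Q} : y ∈ tr g u x ↔ g⁻¹ • y ∈ u (g⁻¹ • x) :=
  Iff.rfl

lemma mem_trI_mul {a g : G} {I : Set P} {x : P} : x ∈ trI (a * g) I ↔ a⁻¹ • x ∈ trI g I := by
  simp [mem_trI, mul_smul]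

lemma mem_tr_mul {a g : G} {u : P → Set Q} {x : P} {y : Q} :
    y ∈ tr (a * g) u x ↔ a⁻¹ • y ∈ tr g u (a⁻¹ • x) := by
  simp [mem_tr, mul_smul]

lemma tr_one (u : P → Set Q) : tr (1 : G) u = u := by ext; simp [mem_tr]

variable {H : Subgroup G} {I : Set P} {u : P → Set Q}

lemma InvOn.trI_mul (iu : InvOn H I u) {g b : G} (hb : b ∈ H) : trI (g * b) I = trI g I := by
  ext x
  simp only [mem_trI, mul_inv_rev, mul_smul]
  exact ⟨fun h => by simpa using (iu b hb _ h).1, fun h => (iu b⁻¹ (H.inv_mem hb) _ h).1⟩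

lemma InvOn.tr_mul (iu : InvOn H I u) {g b : G} (hb : b ∈ H) {x : P} (hx : x ∈ trI g I) :
    tr (g * b) u x = tr g u x := by
  ext y
  simp only [mem_tr, mul_inv_rev, mul_smul]
  exact (iu b⁻¹ (H.inv_mem hb) _ hx).2 _

lemma tr_subset_tr_smul {g g' : G} (a : G) {x x' : P} :
    tr (a * g) u x ⊆ tr (a * g') u x' ↔ tr g u (a⁻¹ • x) ⊆ tr g' u (a⁻¹ • x') := by
  constructor
  · intro h y hy
    have := h (a := a • y) (by rw [mem_tr_mul, inv_smul_smul]; exact hy)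
    rwa [mem_tr_mul, inv_smul_smul] at this
  · intro h y hy
    rw [mem_tr_mul] at hy ⊢
    exact h hy

end

section

variable {G P Q : Type*} [Group G] [OligGroup G] [LinearOrder P] [LinearOrder Q]
  [MulAction G P] [MulAction G Q]

variable (G) in
/-- A leaf invariant under an open subgroup. -/
structure DLeaf (I : Set P) (u : P → Set Q) : Prop extends Leaf I u where
  inv : ∃ H : Subgroup G, Op H ∧ InvOn H I u

variable {I J : Set P} {u w : P → Set Q}

lemma Leaf.restrict (hu : Leaf I u) (hJ : J ⊆ I) (hc : J.OrdConnected) (hne : J.Nonempty)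
    (h1 : ∀ x ∈ J, ∃ x' ∈ J, x < x') (h2 : ∀ x ∈ J, ∃ x' ∈ J, x' < x) : Leaf J u where
  conn := hc
  lower x hx := hu.lower x (hJ hx)
  strict x hx x' hx' := hu.strict x (hJ hx) x' (hJ hx')
  nojump x hx x' hx' y y' hyy hy hy' := by
    obtain ⟨t, ht, ha, hb⟩ := hu.nojump x (hJ hx) x' (hJ hx') y y' hyy hy hy'
    exact ⟨t, hc.out hx hx' ⟨(hu.lt_of_mem (hJ hx) ht hy ha).le,
      (hu.lt_of_mem ht (hJ hx') hb hy').le⟩, ha, hb⟩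
  noLast x hx := hu.noLast x (hJ hx)
  nonempty := hne
  noMax := h1
  noMin := h2

lemma Leaf.inter (hu : Leaf I u) (hw : Leaf J w) (hne : (I ∩ J).Nonempty) : Leaf (I ∩ J) u := by
  refine hu.restrict Set.inter_subset_left (hu.conn.inter hw.conn) hne ?_ ?_
  · rintro x ⟨hx, hx'⟩
    obtain ⟨a, ha, hxa⟩ := hu.noMax x hx
    obtain ⟨b, hb, hxb⟩ := hw.noMax x hx'
    exact ⟨min a b, ⟨hu.conn.out hx ha ⟨(lt_min hxa hxb).le, min_le_left _ _⟩,
      hw.conn.out hx' hb ⟨(lt_min hxa hxb).le, min_le_right _ _⟩⟩, lt_min hxa hxb⟩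
  · rintro x ⟨hx, hx'⟩
    obtain ⟨a, ha, hxa⟩ := hu.noMin x hx
    obtain ⟨b, hb, hxb⟩ := hw.noMin x hx'
    exact ⟨max a b, ⟨hu.conn.out ha hx ⟨le_max_left _ _, (max_lt hxa hxb).le⟩,
      hw.conn.out hb hx' ⟨le_max_right _ _, (max_lt hxa hxb).le⟩⟩, max_lt hxa hxb⟩

lemma InvOn.inter {H K : Subgroup G} (iu : InvOn H I u) (iw : InvOn K J w) :
    InvOn (H ⊓ K) (I ∩ J) u := fun h hh x hx =>
  ⟨⟨(iu h hh.1 x hx.1).1, (iw h hh.2 x hx.2).1⟩, (iu h hh.1 x hx.1).2⟩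

variable [Tame G P]

lemma DLeaf.subset_of_subset (hu : DLeaf G I u) (hw : DLeaf G J w) {x t : P} (hx : x ∈ I)
    (hx' : x ∈ J) (ht : t ∈ I) (ht' : t ∈ J) (h : u x ⊆ w x) : u t ⊆ w t := by
  obtain ⟨H, hH, iu⟩ := hu.inv
  obtain ⟨K, hK, iw⟩ := hw.inv
  have l2 := hw.toLeaf.inter hu.toLeaf ⟨x, hx', hx⟩
  have i2 := iw.inter iu
  rw [Set.inter_comm, inf_comm] at i2
  rw [Set.inter_comm] at l2
  exact (hu.toLeaf.inter hw.toLeaf ⟨x, hx, hx'⟩).subset_of_subset (OligGroup.inf hH hK) l2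
    (iu.inter iw) i2 ⟨hx, hx'⟩ ⟨ht, ht'⟩ h

variable [Tame G Q]

lemma DLeaf.translate (hu : DLeaf G I u) (g : G) : DLeaf G (trI g I) (tr g u) where
  conn := ⟨fun x hx y hy z hz => hu.conn.out hx hy ⟨Tame.smul_le _ hz.1, Tame.smul_le _ hz.2⟩⟩
  lower x hx y y' hyy hy := hu.lower _ hx (Tame.smul_le g⁻¹ hyy) hy
  strict x hx x' hx' hxx := by
    have h := hu.strict _ hx _ hx' ((smul_lt_iff g⁻¹).2 hxx)
    refine ⟨fun y hy => h.1 hy, fun h' => h.2 fun y hy => ?_⟩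
    have := h' (a := g • y) (by rw [mem_tr, inv_smul_smul]; exact hy)
    rwa [mem_tr, inv_smul_smul] at this
  nojump x hx x' hx' y y' hyy hy hy' := by
    obtain ⟨t, ht, ha, hb⟩ := hu.nojump _ hx _ hx' _ _ ((smul_lt_iff g⁻¹).2 hyy) hy hy'
    refine ⟨g • t, ?_, ?_, ?_⟩
    · rwa [mem_trI, inv_smul_smul]
    · rwa [mem_tr, inv_smul_smul]
    · rwa [mem_tr, inv_smul_smul]
  noLast x hx y hy := by
    obtain ⟨y', hy', hlt⟩ := hu.noLast _ hx _ hy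
    refine ⟨g • y', by rwa [mem_tr, inv_smul_smul], ?_⟩
    rw [← smul_lt_iff g⁻¹, inv_smul_smul]; exact hlt
  nonempty := by
    obtain ⟨x, hx⟩ := hu.nonempty
    exact ⟨g • x, by rwa [mem_trI, inv_smul_smul]⟩
  noMax x hx := by
    obtain ⟨x', hx', hlt⟩ := hu.noMax _ hx
    refine ⟨g • x', by rwa [mem_trI, inv_smul_smul], ?_⟩
    rw [← smul_lt_iff g⁻¹, inv_smul_smul]; exact hlt
  noMin x hx := by
    obtain ⟨x', hx', hlt⟩ := hu.noMin _ hx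
    refine ⟨g • x', by rwa [mem_trI, inv_smul_smul], ?_⟩
    rw [← smul_lt_iff g⁻¹, inv_smul_smul]; exact hlt
  inv := by
    obtain ⟨H, hH, iu⟩ := hu.inv
    obtain ⟨K, hK, h⟩ := OligGroup.conj g hH
    refine ⟨K, hK, fun k hk x hx => ?_⟩
    have := iu _ (h k hk) _ hx
    simp only [mem_trI, mem_tr]
    rw [mul_smul, smul_inv_smul, mul_smul] at this
    refine ⟨this.1, fun y => ?_⟩
    rw [← this.2, mul_smul, smul_inv_smul, mul_smul]

/-! ### Chains between translates, and finiteness of the translates over an interval. -/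

/-- A chain of length `m` from `x₀` along which `u` catches up with its translate by `g`. -/
def HasChain (I : Set P) (u : P → Set Q) (g : G) (m : ℕ) (x₀ : P) : Prop :=
  ∃ x : ℕ → P, x 0 = x₀ ∧ (∀ k, x k ∈ I ∧ x k ∈ trI g I) ∧ ¬ u x₀ ⊆ tr g u x₀ ∧
    ∀ k < m, u (x (k + 1)) ⊆ tr g u (x k)

lemma HasChain.of_le {g : G} {m m' : ℕ} {x₀ : P} (h : HasChain I u g m x₀) (hm : m' ≤ m) :
    HasChain I u g m' x₀ := by
  obtain ⟨x, h1, h2, h3, h4⟩ := h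
  exact ⟨x, h1, h2, h3, fun k hk => h4 k (hk.trans_le hm)⟩

lemma hasChain_smul {H : Subgroup G} (iu : InvOn H I u) {a b g : G} (ha : a ∈ H) (hb : b ∈ H)
    {m : ℕ} {x₀ : P} (h : HasChain I u g m x₀) : HasChain I u (a * g * b) m (a • x₀) := by
  obtain ⟨x, h1, h2, h3, h4⟩ := h
  have hI : ∀ k, a • x k ∈ trI (a * g) I := fun k => by
    rw [mem_trI_mul, inv_smul_smul]; exact (h2 k).2
  have hsub : ∀ k l, u (a • x k) ⊆ tr (a * g * b) u (a • x l) ↔ u (x k) ⊆ tr g u (x l) := by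
    intro k l
    rw [iu.tr_mul hb (hI l)]
    have e2 : u (a • x k) = tr (a * 1) u (a • x k) := by
      ext y
      rw [mem_tr_mul, inv_smul_smul, tr_one, ← (iu a ha _ (h2 k).1).2, smul_inv_smul]
    rw [e2, tr_subset_tr_smul, inv_smul_smul, inv_smul_smul, tr_one]
  refine ⟨fun k => a • x k, by simp [h1], fun k => ⟨(iu a ha _ (h2 k).1).1, ?_⟩, ?_,
    fun k hk => (hsub _ _).2 (h4 k hk)⟩
  · rw [iu.trI_mul hb]; exact hI k
  · rw [← h1, hsub 0 0, h1]; exact h3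

/-- Chains between two translates of a leaf have bounded length. -/
lemma DLeaf.exists_chain_bound (hu : DLeaf G I u) : ∃ N, ∀ g g' : G, ∀ x : ℕ → P,
    (∀ k, x k ∈ trI g I ∧ x k ∈ trI g' I) → ¬ tr g u (x 0) ⊆ tr g' u (x 0) →
    ¬ ∀ k < N, tr g u (x (k + 1)) ⊆ tr g' u (x k) := by
  obtain ⟨H, hH, iu⟩ := hu.inv
  -- The bound is made uniform in stages: for fixed `g` and `x₀` it comes from the comparison of two
  -- leaves.
  have h1 : ∀ (g : G) (x₀ : P), ∃ m, ¬ HasChain I u g m x₀ := by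
    intro g x₀
    by_contra! hall
    obtain ⟨x, e, hx, hn, -⟩ := hall 0
    have hx0 := e ▸ hx 0
    obtain ⟨K, hK, iw⟩ := (hu.translate g).inv
    have l1 := hu.toLeaf.inter (hu.translate g).toLeaf ⟨x₀, hx0⟩
    have l2 := (hu.translate g).toLeaf.inter hu.toLeaf ⟨x₀, hx0.symm⟩
    have i1 := iu.inter iw
    have i2 := iw.inter iu
    rw [Set.inter_comm] at l2
    rw [Set.inter_comm, inf_comm] at i2
    obtain ⟨z', hz', hlt, hnz⟩ := l1.exists_gt_not_subset l2 hx0 hn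
    obtain ⟨m, hm⟩ := l1.bounded_chains (OligGroup.inf hH hK) l2.toPreLeaf i1 i2 hx0 hz' hlt hnz
    obtain ⟨x, e, hx, -, hc⟩ := hall m
    exact hm x e.le hx hc
  -- For fixed `g` the least bound depends only on the orbit of `x₀` under an open subgroup fixing
  -- both leaves.
  have h2 : ∀ g : G, ∃ m, ∀ x₀, ¬ HasChain I u g m x₀ := by
    intro g
    obtain ⟨K, hK, hconj⟩ := OligGroup.conj g hH
    have hfin := finite_range_of_invariant (OligGroup.inf hH hK)
      (fun x₀ : P => sInf {m | ¬ HasChain I u g m x₀}) (by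
        rintro a ⟨ha, ha'⟩ x
        have key : ∀ a ∈ H ⊓ K, ∀ x m, HasChain I u g m x → HasChain I u g m (a • x) := by
          rintro a ⟨ha, ha'⟩ x m h
          have := hasChain_smul iu ha (H.inv_mem (hconj a ha')) h
          convert this using 1
          group
        have : ∀ m, HasChain I u g m (a • x) ↔ HasChain I u g m x := fun m =>
          ⟨fun h => by simpa using key a⁻¹ ((H ⊓ K).inv_mem ⟨ha, ha'⟩) _ m h, key a ⟨ha, ha'⟩ x m⟩
        simp only [this])
    obtain ⟨N, hN⟩ := exists_bound_of_finite_range _ hfin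
    exact ⟨N, fun x₀ h => (Nat.sInf_mem (h1 g x₀)) (h.of_le (hN x₀))⟩
  -- The bound for all `x₀` depends only on the double coset of `g`; an arbitrary pair of translates
  -- is reduced to this case by applying `g⁻¹`.
  have hfin := finite_range_of_biinvariant hH hH
    (fun g : G => sInf {m | ∀ x₀, ¬ HasChain I u g m x₀}) (by
      intro a ha b hb g
      have : ∀ m, (∀ x₀, ¬ HasChain I u (a * g * b) m x₀) ↔ ∀ x₀, ¬ HasChain I u g m x₀ := by
        refine fun m => ⟨fun h x₀ hx => h _ (hasChain_smul iu ha hb hx), fun h x₀ hx => ?_⟩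
        refine h (a⁻¹ • x₀) ?_
        have := hasChain_smul iu (H.inv_mem ha) (H.inv_mem hb) hx
        convert this using 1
        group
      simp only [this])
  obtain ⟨N, hN⟩ := exists_bound_of_finite_range _ hfin
  refine ⟨N, fun g g' x hx hn hc => ?_⟩
  refine Nat.sInf_mem (h2 (g⁻¹ * g')) (g⁻¹ • x 0) ?_
  refine HasChain.of_le (m := N) ⟨fun k => g⁻¹ • x k, rfl, fun k => ⟨(hx k).1, ?_⟩, ?_,
    fun k hk => ?_⟩ (hN _)
  · rw [mem_trI_mul, inv_inv, smul_inv_smul]; exact (hx k).2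
  · intro h
    refine hn ?_
    have := (tr_subset_tr_smul (u := u) (g := 1) (g' := g⁻¹ * g') g (x := x 0) (x' := x 0)).2
      (by rwa [tr_one])
    simpa using this
  · have := (tr_subset_tr_smul (u := u) (g := g) (g' := g') g⁻¹ (x := g⁻¹ • x (k + 1))
      (x' := g⁻¹ • x k)).2 (by simpa using hc k hk)
    simpa [tr_one] using this

/-- Only finitely many translates of a leaf are defined on a given interval. -/
lemma DLeaf.finite_values_on_interval (hu : DLeaf G I u) {x x' : P} (hxx : x < x') :
    {v | ∃ g : G, x ∈ trI g I ∧ x' ∈ trI g I ∧ tr g u x = v}.Finite := by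
  have := Tame.denselyOrdered G P
  obtain ⟨N, hN⟩ := hu.exists_chain_bound
  obtain ⟨z, hz, hzI⟩ : ∃ z : ℕ → P, StrictMono z ∧ ∀ k, x < z k ∧ z k < x' := by
    have : Nonempty (Set.Ioo x x') := (Set.nonempty_Ioo.2 hxx).to_subtype
    obtain ⟨f, hf⟩ := Nat.exists_strictMono (Set.Ioo x x')
    exact ⟨fun k => f k, hf, fun k => (f k).2⟩
  set A : Set G := {g | x ∈ trI g I ∧ x' ∈ trI g I} with hA
  have hdom : ∀ g ∈ A, ∀ k, z k ∈ trI g I := fun g hg k =>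
    (hu.translate g).conn.out hg.1 hg.2 ⟨(hzI k).1.le, (hzI k).2.le⟩
  have hcomp : ∀ g ∈ A, ∀ g' ∈ A, tr g u x ⊆ tr g' u x → ∀ k, tr g u (z k) ⊆ tr g' u (z k) :=
    fun g hg g' hg' h k => (hu.translate g).subset_of_subset (hu.translate g') hg.1 hg'.1
      (hdom g hg k) (hdom g' hg' k) h
  have hcomp' : ∀ g ∈ A, ∀ g' ∈ A, ∀ k, tr g u (z k) ⊆ tr g' u (z k) → tr g u x ⊆ tr g' u x :=
    fun g hg g' hg' k h => (hu.translate g).subset_of_subset (hu.translate g')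
      (hdom g hg k) (hdom g' hg' k) hg.1 hg'.1 h
  have htot : ∀ g ∈ A, ∀ g' ∈ A, tr g u x ⊆ tr g' u x ∨ tr g' u x ⊆ tr g u x :=
    fun g hg g' hg' => ((hu.translate g).lower x hg.1).total ((hu.translate g').lower x hg'.1)
  -- Every translate above `g` has left the value of `g` at `z (k + 1)` behind already at `z k`. The
  -- differences between the values at `z (k + 1)` and `z k` are then disjoint for distinct
  -- translates with this property.
  let gap (k : ℕ) (g : G) : Prop := ∀ g' ∈ A, ¬ tr g' u x ⊆ tr g u x →
    ¬ tr g' u (z k) ⊆ tr g u (z (k + 1))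
  have hgap : ∀ g ∈ A, ∃ k ≤ N, gap k g := by
    intro g hg
    by_contra! hno
    simp only [gap] at hno
    push Not at hno
    -- If `g` has no gap at any stage, each stage has a witness above `g`. Keeping the lower of the
    -- old and the new witness gives a single `g'` serving all stages.
    have : ∀ n ≤ N, ∃ g' ∈ A, ¬ tr g' u x ⊆ tr g u x ∧
        ∀ k ≤ n, tr g' u (z k) ⊆ tr g u (z (k + 1)) := by
      intro n
      induction n with
      | zero =>
        intro _
        obtain ⟨g', h1, h2, h3⟩ := hno 0 (by omega)
        exact ⟨g', h1, h2, fun k hk => by obtain rfl : k = 0 := by omega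
                                          exact h3⟩
      | succ n ih =>
        intro hn
        obtain ⟨g', h1, h2, h3⟩ := ih (by omega)
        obtain ⟨g'', h1', h2', h3'⟩ := hno (n + 1) hn
        rcases htot g' h1 g'' h1' with h | h
        · refine ⟨g', h1, h2, fun k hk => ?_⟩
          rcases Nat.lt_or_eq_of_le hk with hk | rfl
          · exact h3 k (by omega)
          · exact (hcomp g' h1 g'' h1' h _).trans h3'
        · refine ⟨g'', h1', h2', fun k hk => ?_⟩
          rcases Nat.lt_or_eq_of_le hk with hk | rfl
          · exact (hcomp g'' h1' g' h1 h _).trans (h3 k (by omega))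
          · exact h3'
    obtain ⟨g', h1, h2, h3⟩ := this N le_rfl
    -- The chain descends, so the sequence `z` is read backwards. For `j > N` truncated subtraction
    -- gives `z 0`, which is still in both domains.
    refine hN g' g (fun j => z (N - j)) (fun k => ⟨hdom g' h1 _, hdom g hg _⟩)
      (fun h => h2 (hcomp' g' h1 g hg _ h)) fun k hk => ?_
    have := h3 (N - (k + 1)) (by omega)
    rwa [show N - (k + 1) + 1 = N - k by omega] at this
  have hk : ∀ k, {v | ∃ g ∈ A, gap k g ∧ tr g u x = v}.Finite := by
    intro k
    let D (g : G) : Set Q := tr g u (z (k + 1)) \ tr g u (z k)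
    have hD : ∀ g ∈ A, ∀ g' ∈ A, gap k g → gap k g' → ∀ y ∈ D g, y ∈ D g' →
        tr g u x = tr g' u x := by
      have key : ∀ g ∈ A, ∀ g' ∈ A, gap k g → ∀ y ∈ D g, y ∈ D g' → tr g' u x ⊆ tr g u x := by
        intro g hg g' hg' h y hy hy'
        by_contra hn
        exact hy'.2 (((hu.translate g').lower _ (hdom g' hg' _)).total
          ((hu.translate g).lower _ (hdom g hg _)) |>.resolve_left (h g' hg' hn) hy.1)
      intro g hg g' hg' h h' y hy hy'
      exact (key g' hg' g hg h' y hy' hy).antisymm (key g hg g' hg' h y hy hy')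
    have hDe : ∀ g ∈ A, ∀ g' ∈ A, tr g u x = tr g' u x → D g = D g' := by
      intro g hg g' hg' h
      have e : ∀ j, tr g u (z j) = tr g' u (z j) := fun j =>
        (hcomp g hg g' hg' h.le j).antisymm (hcomp g' hg' g hg h.ge j)
      simp only [D, e]
    have hDinf : ∀ g ∈ A, (D g).Infinite := by
      intro g hg
      refine infinite_of_noLast ?_ ?_
      · obtain ⟨y, h1, h2⟩ := Set.exists_of_ssubset ((hu.translate g).strict _ (hdom g hg k) _
          (hdom g hg (k + 1)) (hz (Nat.lt_succ_self k)))
        exact ⟨y, h1, h2⟩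
      · rintro y ⟨h1, h2⟩
        obtain ⟨y', hy', hlt⟩ := (hu.translate g).noLast _ (hdom g hg (k + 1)) y h1
        exact ⟨y', ⟨hy', fun h => h2 ((hu.translate g).lower _ (hdom g hg k) hlt.le h)⟩, hlt⟩
    -- The sets `D g` are pairwise disjoint or equal, infinite and convex; they become infinite
    -- classes of a convex equivalence relation invariant under the stabilizer of four points, so
    -- rank 1 leaves finitely many.
    let E : Setoid Q :=
      { r := fun y y' => y = y' ∨ ∃ g ∈ A, gap k g ∧ y ∈ D g ∧ y' ∈ D g
        iseqv := by
          refine ⟨fun y => Or.inl rfl, ?_, ?_⟩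
          · rintro y y' (rfl | ⟨g, h1, h2, h3, h4⟩)
            · exact Or.inl rfl
            · exact Or.inr ⟨g, h1, h2, h4, h3⟩
          · rintro y y' y'' (rfl | ⟨g, h1, h2, h3, h4⟩) h
            · exact h
            · rcases h with rfl | ⟨g', h1', h2', h3', h4'⟩
              · exact Or.inr ⟨g, h1, h2, h3, h4⟩
              · refine Or.inr ⟨g, h1, h2, h3, ?_⟩
                rwa [hDe g h1 g' h1' (hD g h1 g' h1' h2 h2' y' h4 h3')] }
    have hE : ∀ y y', E y y' ↔ y = y' ∨ ∃ g ∈ A, gap k g ∧ y ∈ D g ∧ y' ∈ D g := fun _ _ => Iff.rfl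
    let K : Subgroup G := (MulAction.stabilizer G x ⊓ MulAction.stabilizer G x') ⊓
      (MulAction.stabilizer G (z k) ⊓ MulAction.stabilizer G (z (k + 1)))
    have hK : Op K := OligGroup.inf (OligGroup.inf (Tame.stab _) (Tame.stab _))
      (OligGroup.inf (Tame.stab _) (Tame.stab _))
    have hrank := Tame.rankOne K hK E (by
      rintro h hh y y' (rfl | ⟨g, h1, h2, h3, h4⟩)
      · exact Or.inl rfl
      have fx : h⁻¹ • x = x := MulAction.mem_stabilizer_iff.1 (inv_mem hh.1.1)
      have fx' : h⁻¹ • x' = x' := MulAction.mem_stabilizer_iff.1 (inv_mem hh.1.2)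
      have fz : h⁻¹ • z k = z k := MulAction.mem_stabilizer_iff.1 (inv_mem hh.2.1)
      have fz' : h⁻¹ • z (k + 1) = z (k + 1) := MulAction.mem_stabilizer_iff.1 (inv_mem hh.2.2)
      have hAi : ∀ g', h * g' ∈ A ↔ g' ∈ A := fun g' => by
        simp only [hA, Set.mem_ofPred_eq, mem_trI_mul, fx, fx']
      have hDi : ∀ y, h • y ∈ D (h * g) ↔ y ∈ D g := fun y => by
        simp only [D, Set.mem_sdiff, mem_tr_mul, fz, fz', inv_smul_smul]
      refine Or.inr ⟨h * g, (hAi g).2 h1, ?_, (hDi y).2 h3, (hDi y').2 h4⟩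
      intro g' hg' hn hs
      obtain ⟨g', rfl⟩ : ∃ g'', g' = h * g'' := ⟨h⁻¹ * g', by group⟩
      rw [tr_subset_tr_smul, fx] at hn
      rw [tr_subset_tr_smul, fz, fz'] at hs
      exact h2 g' ((hAi g').1 hg') hn hs) (by
      rintro a b c hab hbc (rfl | ⟨g, h1, h2, h3, h4⟩)
      · exact Or.inl (le_antisymm hab hbc)
      · exact Or.inr ⟨g, h1, h2, h3, (hu.translate g).lower _ (hdom g h1 _) hbc h4.1,
          fun hb => h3.2 ((hu.translate g).lower _ (hdom g h1 _) hab hb)⟩)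
    -- A value is recovered from its class because all `g` with the same `D g` have the same value
    -- at `x`; the union has only one distinct member.
    refine (hrank.image fun C => ⋃ g ∈ {g | g ∈ A ∧ gap k g ∧ D g = C}, tr g u x).subset ?_
    rintro _ ⟨g, hg, hgk, rfl⟩
    obtain ⟨y, hy⟩ := (hDinf g hg).nonempty
    have hcl : D g = {y' | E y' y} := by
      ext y'
      rw [Set.mem_ofPred_eq, hE]
      constructor
      · exact fun h => Or.inr ⟨g, hg, hgk, h, hy⟩
      · rintro (rfl | ⟨g', h1, h2, h3, h4⟩)
        · exact hy
        · rwa [hDe g hg g' h1 (hD g hg g' h1 hgk h2 y hy h4)]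
    refine ⟨D g, ⟨hcl ▸ E.mem_classes y, hDinf g hg⟩, ?_⟩
    refine subset_antisymm (Set.iUnion₂_subset ?_) fun t ht =>
      Set.mem_iUnion₂.2 ⟨g, ⟨hg, hgk, rfl⟩, ht⟩
    rintro g' ⟨h1, h2, h3⟩
    exact (hD g hg g' h1 hgk h2 y hy (h3 ▸ hy)).ge
  refine ((Set.finite_Iic N).biUnion fun k _ => hk k).subset ?_
  rintro _ ⟨g, h1, h2, rfl⟩
  obtain ⟨k, hkN, hkg⟩ := hgap g ⟨h1, h2⟩
  exact Set.mem_iUnion₂.2 ⟨k, hkN, g, ⟨h1, h2⟩, hkg, rfl⟩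

end

/-! ### Equivariant maps between orders -/

/-- `f` is an equivariant non-decreasing map from `P` to the proper nonempty lower sets of `Q`. -/
structure IsTwinMap (G : Type*) {P Q : Type*} [LinearOrder P] [LinearOrder Q] [Group G]
    [MulAction G P] [MulAction G Q] (f : P → Set Q) : Prop where
  mono : ∀ x y, x ≤ y → f x ⊆ f y
  lower : ∀ x, IsLowerSet (f x)
  nonempty : ∀ x, (f x).Nonempty
  ne_univ : ∀ x, f x ≠ Set.univ
  smul_mem : ∀ (g : G) x y, g • y ∈ f (g • x) ↔ y ∈ f x

/-- An equivariant map the values of which have no greatest element. -/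
structure IsNormal (G : Type*) {P Q : Type*} [LinearOrder P] [LinearOrder Q] [Group G]
    [MulAction G P] [MulAction G Q] (f : P → Set Q) : Prop extends IsTwinMap G f where
  noLast : ∀ x, ∀ y ∈ f x, ∃ y' ∈ f x, y < y'

/-- There is an equivariant non-decreasing map from `P` to the completion of `Q`. -/
def Twin (G P Q : Type*) [LinearOrder P] [LinearOrder Q] [Group G]
    [MulAction G P] [MulAction G Q] : Prop := ∃ f : P → Set Q, IsTwinMap G f

lemma sInter_mem_of_chain {α : Type*} {S : Set (Set α)} (hS : S.Finite) (hne : S.Nonempty)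
    (h : ∀ s ∈ S, ∀ t ∈ S, s ⊆ t ∨ t ⊆ s) : ⋂₀ S ∈ S := by
  obtain ⟨m, hm⟩ := hS.exists_minimal hne
  have : ⋂₀ S = m := by
    refine subset_antisymm (Set.sInter_subset_of_mem hm.1) (Set.subset_sInter fun t ht => ?_)
    rcases h m hm.1 t ht with h | h
    · exact h
    · exact hm.2 ht h
  rw [this]
  exact hm.1

section

variable {G P Q : Type*} [Group G] [OligGroup G] [LinearOrder P] [LinearOrder Q]
  [MulAction G P] [MulAction G Q] [Tame G P] [Tame G Q]

section
variable {f f' : P → Set Q}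

lemma IsTwinMap.eq_univ_of_invariant (hf : IsTwinMap G f) {x : P} (h : ∀ z, f z = f x) : False := by
  refine hf.ne_univ x (MultiOrder.eq_univ_of_invariant G (fun g y hy => ?_) (hf.nonempty x))
  rw [← h (g • x)]
  exact (hf.smul_mem g x y).2 hy

/-- If two values agreed, the kernel would be an invariant convex equivalence relation with infinite
classes by density and transitivity. It would be trivial, and the constant value would be an
invariant proper nonempty set. -/
lemma IsTwinMap.strict (hf : IsTwinMap G f) {x y : P} (hxy : x < y) : f x ⊂ f y := by
  have := Tame.denselyOrdered G P
  refine (hf.mono x y hxy.le).ssubset_of_ne fun hxy' => ?_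
  let E : Setoid P := Setoid.ker f
  have hE : ∀ a b, E a b ↔ f a = f b := fun _ _ => Iff.rfl
  refine hf.eq_univ_of_invariant (x := x) fun z => ?_
  have hsm : ∀ (g : G) a b, f a = f b → f (g • a) = f (g • b) := by
    intro g a b h
    ext t
    rw [← smul_inv_smul g t, hf.smul_mem, hf.smul_mem, h]
  have hconv : ∀ a b c, a ≤ b → b ≤ c → E a c → E a b := fun a b c hab hbc h =>
    (hf.mono a b hab).antisymm ((hf.mono b c hbc).trans (le_of_eq ((hE a c).1 h).symm))
  refine rel_of_infinite_classes (G := G) E hsm hconv ?_ z x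
  intro a
  obtain ⟨g, rfl⟩ := Tame.trans (G := G) x a
  refine (Set.Ioo_infinite ((smul_lt_iff g).2 hxy)).mono fun b hb => ?_
  exact E.symm (hconv _ _ _ hb.1.le hb.2.le (hsm g _ _ hxy'))

/-- The same argument on the target: points not separated by any value form the classes of an
invariant convex equivalence relation, and a jump would make all of them infinite. -/
lemma IsTwinMap.nojump (hf : IsTwinMap G f) {x : P} {y y' : Q} (hyy : y < y') (hy : y ∉ f x) :
    ∃ t, y ∈ f t ∧ y' ∉ f t := by
  have := Tame.denselyOrdered G Q
  by_contra! hno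
  let E : Setoid Q := ⟨fun a b => ∀ t, a ∈ f t ↔ b ∈ f t, fun _ _ => Iff.rfl,
    fun h t => (h t).symm, fun h h' t => (h t).trans (h' t)⟩
  have hyE : E y y' := fun t => ⟨hno t, hf.lower t hyy.le⟩
  have hsm : ∀ (g : G) a b, E a b → E (g • a) (g • b) := by
    intro g a b h t
    rw [← smul_inv_smul g t, hf.smul_mem, hf.smul_mem, h]
  have hconv : ∀ a b c, a ≤ b → b ≤ c → E a c → E a b := fun a b c hab hbc h t =>
    ⟨fun ha => hf.lower t hbc ((h t).1 ha), fun hb => hf.lower t hab hb⟩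
  obtain ⟨y₀, hy₀⟩ := hf.nonempty x
  refine hy ((rel_of_infinite_classes (G := G) E hsm hconv ?_ y y₀ x).2 hy₀)
  intro a
  obtain ⟨g, rfl⟩ := Tame.trans (G := G) y a
  refine (Set.Ioo_infinite ((smul_lt_iff g).2 hyy)).mono fun b hb => ?_
  exact E.symm (hconv _ _ _ hb.1.le hb.2.le (hsm g _ _ hyE))

lemma IsTwinMap.exists_notMem (hf : IsTwinMap G f) (y : Q) : ∃ t, y ∉ f t := by
  by_contra! h
  obtain ⟨x⟩ : Nonempty P := (Tame.infinite (G := G) (P := P)).nonempty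
  have : {y | ∀ t, y ∈ f t} = Set.univ := by
    refine MultiOrder.eq_univ_of_invariant G (fun g y hy t => ?_) ⟨y, h⟩
    rw [← smul_inv_smul g t, hf.smul_mem]; exact hy _
  exact hf.ne_univ x (Set.eq_univ_of_forall fun y => Set.eq_univ_iff_forall.1 this y x)

lemma IsTwinMap.exists_mem (hf : IsTwinMap G f) (y : Q) : ∃ t, y ∈ f t := by
  obtain ⟨x⟩ : Nonempty P := (Tame.infinite (G := G) (P := P)).nonempty
  have : {y | ∃ t, y ∈ f t} = Set.univ := by
    refine MultiOrder.eq_univ_of_invariant G ?_ ?_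
    · rintro g y ⟨t, ht⟩
      exact ⟨g • t, (hf.smul_mem g t y).2 ht⟩
    · obtain ⟨y, hy⟩ := hf.nonempty x
      exact ⟨y, x, hy⟩
  exact Set.eq_univ_iff_forall.1 this y

lemma IsNormal.dleaf (hf : IsNormal G f) : DLeaf G Set.univ f where
  conn := Set.ordConnected_univ
  lower x _ := hf.lower x
  strict _ _ _ _ h := hf.strict h
  nojump _ _ _ _ _ _ hyy hy _ := by
    obtain ⟨t, ht⟩ := hf.nojump hyy hy
    exact ⟨t, trivial, ht⟩
  noLast x _ := hf.noLast x
  nonempty := by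
    have : Nonempty P := (Tame.infinite (G := G) (P := P)).nonempty
    exact Set.univ_nonempty
  noMax x _ := by
    have := Tame.noMaxOrder G P
    obtain ⟨y, hy⟩ := exists_gt x
    exact ⟨y, trivial, hy⟩
  noMin x _ := by
    have := Tame.noMinOrder G P
    obtain ⟨y, hy⟩ := exists_lt x
    exact ⟨y, trivial, hy⟩
  inv := ⟨⊤, OligGroup.top, fun g _ x _ => ⟨trivial, hf.smul_mem g x⟩⟩

/-- There is at most one normal equivariant map. -/
lemma IsNormal.unique (hf : IsNormal G f) (hf' : IsNormal G f') : f = f' := by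
  have key : ∀ f f' : P → Set Q, IsNormal G f → IsNormal G f' → ∀ x, f x ⊆ f' x := by
    intro f f' hf hf' x
    by_contra h
    obtain ⟨x', -, hlt, hx'⟩ := hf.dleaf.toLeaf.exists_gt_not_subset hf'.dleaf.toLeaf trivial h
    obtain ⟨m, hm⟩ := hf.dleaf.toLeaf.bounded_chains (OligGroup.top (G := G))
      hf'.dleaf.toPreLeaf (fun g _ x _ => ⟨trivial, hf.smul_mem g x⟩)
      (fun g _ x _ => ⟨trivial, hf'.smul_mem g x⟩) (Set.mem_univ x) (Set.mem_univ x') hlt hx'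
    -- The values of `f` go below every value of `f'`, so `f` can catch up with `f'` arbitrarily
    -- often, against the bound `m`.
    have : ∀ a, ∃ b, f b ⊆ f' a := fun a => by
      obtain ⟨y, hy⟩ := hf'.nonempty a
      obtain ⟨b, hb⟩ := hf.exists_notMem y
      exact ⟨b, ((hf.lower b).total (hf'.lower a)).resolve_right fun h => hb (h hy)⟩
    choose s hs using this
    refine hm (fun k => s^[k] x) le_rfl (fun _ => trivial) fun k _ => ?_
    rw [Function.iterate_succ_apply']
    exact hs _
  funext x
  exact (key f f' hf hf' x).antisymm (key f' f hf' hf x)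

/-- A greatest element, if present, is deleted from each value; density of `Q` ensures that no new
one appears. -/
lemma IsTwinMap.exists_normal (hf : IsTwinMap G f) : ∃ f' : P → Set Q, IsNormal G f' := by
  have := Tame.denselyOrdered G Q
  have := Tame.noMinOrder G Q
  refine ⟨fun x => {y | ∃ y' ∈ f x, y < y'}, ⟨⟨?_, ?_, ?_, ?_, ?_⟩, ?_⟩⟩
  · rintro x x' h y ⟨y', h1, h2⟩
    exact ⟨y', hf.mono x x' h h1, h2⟩
  · rintro x a b hab ⟨y', h1, h2⟩
    exact ⟨y', h1, hab.trans_lt h2⟩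
  · intro x
    obtain ⟨y, hy⟩ := hf.nonempty x
    obtain ⟨y', hy'⟩ := exists_lt y
    exact ⟨y', y, hy, hy'⟩
  · intro x h
    refine hf.ne_univ x (Set.eq_univ_of_forall fun y => ?_)
    obtain ⟨y', h1, h2⟩ := (h ▸ Set.mem_univ y : y ∈ {y | ∃ y' ∈ f x, y < y'})
    exact hf.lower x h2.le h1
  · intro g x y
    constructor
    · rintro ⟨y', h1, h2⟩
      refine ⟨g⁻¹ • y', ?_, ?_⟩
      · rw [← hf.smul_mem g, smul_inv_smul]; exact h1
      · rw [← smul_lt_iff g, smul_inv_smul]; exact h2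
    · rintro ⟨y', h1, h2⟩
      exact ⟨g • y', (hf.smul_mem g x y').2 h1, (smul_lt_iff g).2 h2⟩
  · rintro x y ⟨y', h1, h2⟩
    obtain ⟨c, hc, hc'⟩ := exists_between h2
    exact ⟨c, ⟨y', h1, hc'⟩, hc⟩

end

/-! ### From leaves to equivariant maps -/

variable {I : Set P} {u : P → Set Q}

variable (G) in
/-- The values at `x` of the translates of `u`. -/
def trValues (I : Set P) (u : P → Set Q) (x : P) : Set (Set Q) :=
  {v | ∃ g : G, x ∈ trI g I ∧ tr g u x = v}

lemma DLeaf.exists_trI (hu : DLeaf G I u) (x : P) : ∃ g : G, x ∈ trI g I := by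
  obtain ⟨x₀, hx₀⟩ := hu.nonempty
  obtain ⟨g, hg⟩ := Tame.trans (G := G) x x₀
  exact ⟨g⁻¹, by rw [mem_trI, inv_inv, hg]; exact hx₀⟩

lemma smul_mem_tr {a g : G} {x : P} {y : Q} : a • y ∈ tr (a * g) u (a • x) ↔ y ∈ tr g u x := by
  rw [mem_tr_mul, inv_smul_smul, inv_smul_smul]

lemma smul_mem_trI {a g : G} {x : P} : a • x ∈ trI (a * g) I ↔ x ∈ trI g I := by
  rw [mem_trI_mul, inv_smul_smul]

lemma trValues_smul (a : G) (x : P) :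
    trValues G I u (a • x) = (fun v => {y | a⁻¹ • y ∈ v}) '' trValues G I u x := by
  ext v
  constructor
  · rintro ⟨g, h1, rfl⟩
    obtain ⟨g, rfl⟩ : ∃ g', g = a * g' := ⟨a⁻¹ * g, by group⟩
    refine ⟨_, ⟨g, smul_mem_trI.1 h1, rfl⟩, ?_⟩
    ext y
    rw [← smul_inv_smul a y, smul_mem_tr, smul_inv_smul]
    rfl
  · rintro ⟨_, ⟨g, h1, rfl⟩, rfl⟩
    refine ⟨a * g, smul_mem_trI.2 h1, ?_⟩
    ext y
    rw [← smul_inv_smul a y, smul_mem_tr, smul_inv_smul]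
    rfl

/-- Over each interval to the right of `x` there are finitely many values, and their number is
bounded independently of the interval because it depends only on the orbit of the right end point.
Any finite number of translates through `x` live on a common such interval, so the bound holds at
`x` itself. -/
lemma DLeaf.finite_trValues (hu : DLeaf G I u) (x : P) : (trValues G I u x).Finite := by
  by_contra hinf
  let V (x' : P) : Set (Set Q) := {v | ∃ g : G, x ∈ trI g I ∧ x' ∈ trI g I ∧ tr g u x = v}
  have hVs : ∀ a ∈ MulAction.stabilizer G x, ∀ x',
      V (a • x') = (fun v => {y | a⁻¹ • y ∈ v}) '' V x' := by
    intro a ha x'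
    have hx : x = a • x := (MulAction.mem_stabilizer_iff.1 ha).symm
    ext v
    constructor
    · rintro ⟨g, h1, h2, rfl⟩
      obtain ⟨g, rfl⟩ : ∃ g', g = a * g' := ⟨a⁻¹ * g, by group⟩
      rw [hx] at h1
      refine ⟨_, ⟨g, smul_mem_trI.1 h1, smul_mem_trI.1 h2, rfl⟩, ?_⟩
      ext y
      conv_rhs => rw [hx, ← smul_inv_smul a y, smul_mem_tr]
      rfl
    · rintro ⟨_, ⟨g, h1, h2, rfl⟩, rfl⟩
      refine ⟨a * g, ?_, smul_mem_trI.2 h2, ?_⟩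
      · rw [hx]; exact smul_mem_trI.2 h1
      ext y
      conv_lhs => rw [hx, ← smul_inv_smul a y, smul_mem_tr]
      rfl
  have hinj : ∀ a : G, Function.Injective fun v : Set Q => {y | a⁻¹ • y ∈ v} := by
    intro a v v' h
    ext y
    have := Set.ext_iff.1 h (a • y)
    simpa using this
  -- `ncard` is 0 on infinite sets, which is harmless: the bound is used only for `x' > x`, where `V
  -- x'` is finite.
  obtain ⟨N, hN⟩ := exists_bound_of_finite_range (fun x' => (V x').ncard)
    (finite_range_of_invariant (G := G) (Tame.stab x) _ fun a ha x' => by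
      rw [hVs a ha, Set.ncard_image_of_injective _ (hinj a)])
  obtain ⟨t, ht, hcard⟩ := Set.Infinite.exists_subset_card_eq hinf (N + 1)
  have : ∀ v ∈ t, ∃ x', x < x' ∧ v ∈ V x' := by
    intro v hv
    obtain ⟨g, h1, rfl⟩ := ht hv
    obtain ⟨x', hx', hlt⟩ := (hu.translate g).noMax x h1
    exact ⟨x', hlt, g, h1, hx', rfl⟩
  have hP : Nonempty P := ⟨x⟩
  choose! b hb hbV using this
  obtain ⟨v₀, hv₀, hmin⟩ := t.exists_min_image b (Finset.card_pos.1 (by omega))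
  have hsub : (t : Set (Set Q)) ⊆ V (b v₀) := by
    intro v hv
    obtain ⟨g, h1, h2, h3⟩ := hbV v hv
    exact ⟨g, h1, (hu.translate g).conn.out h1 h2 ⟨(hb v₀ hv₀).le, hmin v hv⟩, h3⟩
  have h1 := Set.ncard_le_ncard hsub (hu.finite_values_on_interval (hb v₀ hv₀))
  rw [Set.ncard_coe_finset, hcard] at h1
  exact absurd (h1.trans (hN _)) (by omega)

/-- A leaf extends to a normal equivariant map. -/
theorem DLeaf.exists_normal (hu : DLeaf G I u) :
    ∃ f : P → Set Q, IsNormal G f ∧ ∀ x ∈ I, f x = u x := by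
  have := Tame.denselyOrdered G P
  have := Tame.noMinOrder G P
  have := Tame.noMaxOrder G P
  -- The lowest value at `x`. Its definition is equivariant, and it is attained because the values
  -- form a finite chain.
  let v (x : P) : Set Q := ⋂₀ trValues G I u x
  have hne : ∀ x, (trValues G I u x).Nonempty := fun x => by
    obtain ⟨g, hg⟩ := hu.exists_trI x
    exact ⟨_, g, hg, rfl⟩
  have hv : ∀ x, v x ∈ trValues G I u x := fun x => by
    refine sInter_mem_of_chain (hu.finite_trValues x) (hne x) ?_
    rintro _ ⟨g, hg, rfl⟩ _ ⟨g', hg', rfl⟩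
    exact ((hu.translate g).lower x hg).total ((hu.translate g').lower x hg')
  have hsm : ∀ (a : G) x y, a • y ∈ v (a • x) ↔ y ∈ v x := by
    intro a x y
    simp only [v, trValues_smul, Set.sInter_image, Set.mem_iInter, Set.mem_ofPred_eq, inv_smul_smul,
      Set.mem_sInter]
  have hcard : ∀ x x', (trValues G I u x).ncard = (trValues G I u x').ncard := by
    intro x x'
    obtain ⟨a, rfl⟩ := Tame.trans (G := G) x x'
    rw [trValues_smul, Set.ncard_image_of_injective]
    intro v v' h
    ext y
    have := Set.ext_iff.1 h (a • y)
    simpa using this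
  -- Near `x` the lowest map coincides with a single translate of `u`.
  have hloc : ∀ x, ∃ a b, a < x ∧ x < b ∧ ∃ g : G, ∀ t, a ≤ t → t ≤ b →
      t ∈ trI g I ∧ v t = tr g u t := by
    intro x
    have : ∀ w ∈ trValues G I u x, ∃ (g : G) (a b : P), a < x ∧ x < b ∧ x ∈ trI g I ∧
        a ∈ trI g I ∧ b ∈ trI g I ∧ tr g u x = w := by
      rintro _ ⟨g, hg, rfl⟩
      obtain ⟨b, hb, hxb⟩ := (hu.translate g).noMax x hg
      obtain ⟨a, ha, hax⟩ := (hu.translate g).noMin x hg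
      exact ⟨g, a, b, hax, hxb, hg, ha, hb, rfl⟩
    have hP : Nonempty P := ⟨x⟩
    choose! g a b ha hb hg hga hgb hgw using this
    obtain ⟨w₁, hw₁, hmin⟩ := Set.exists_min_image _ b (hu.finite_trValues x) (hne x)
    obtain ⟨w₂, hw₂, hmax⟩ := Set.exists_max_image _ a (hu.finite_trValues x) (hne x)
    have hdom : ∀ w ∈ trValues G I u x, ∀ t, a w₂ ≤ t → t ≤ b w₁ → t ∈ trI (g w) I :=
      fun w hw t h1 h2 => (hu.translate (g w)).conn.out (hga w hw) (hgb w hw)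
        ⟨(hmax w hw).trans h1, h2.trans (hmin w hw)⟩
    refine ⟨a w₂, b w₁, ha _ hw₂, hb _ hw₁, g (v x), fun t h1 h2 => ⟨hdom _ (hv x) t h1 h2, ?_⟩⟩
    have hmono : ∀ w ∈ trValues G I u x, ∀ w' ∈ trValues G I u x,
        (w ⊆ w' ↔ tr (g w) u t ⊆ tr (g w') u t) := by
      intro w hw w' hw'
      have := fun {p q : P} (h1 : p ∈ trI (g w) I) (h2 : p ∈ trI (g w') I) h3 h4 h5 =>
        (hu.translate (g w)).subset_of_subset (hu.translate (g w')) h1 h2 (t := q) h3 h4 h5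
      conv_lhs => rw [← hgw w hw, ← hgw w' hw']
      exact ⟨this (hg w hw) (hg w' hw') (hdom w hw t h1 h2) (hdom w' hw' t h1 h2),
        this (hdom w hw t h1 h2) (hdom w' hw' t h1 h2) (hg w hw) (hg w' hw')⟩
    -- The translates through `x` stay distinct at `t`, and by transitivity all points have the same
    -- number of values; so no further translates appear at `t`.
    have himg : (fun w => tr (g w) u t) '' trValues G I u x = trValues G I u t := by
      refine Set.eq_of_subset_of_ncard_le ?_ ?_ (hu.finite_trValues t)
      · rintro _ ⟨w, hw, rfl⟩
        exact ⟨g w, hdom w hw t h1 h2, rfl⟩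
      · rw [Set.InjOn.ncard_image, hcard t x]
        intro w hw w' hw' h
        exact ((hmono w hw w' hw').2 h.le).antisymm ((hmono w' hw' w hw).2 h.ge)
    refine subset_antisymm (Set.sInter_subset_of_mem ⟨_, hdom _ (hv x) t h1 h2, rfl⟩)
      (Set.subset_sInter ?_)
    rw [← himg]
    rintro _ ⟨w, hw, rfl⟩
    exact (hmono _ (hv x) w hw).1 (Set.sInter_subset_of_mem hw)
  -- Two points are related if `v` is strictly increasing between them. Local agreement with a leaf
  -- makes the classes infinite, so there is one class and `v` is strictly increasing globally.
  let E : Setoid P :=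
    { r := fun x y => ∀ s t, min x y ≤ s → s < t → t ≤ max x y → v s ⊂ v t
      iseqv := by
        refine ⟨fun x s t h1 h2 h3 => ?_, fun {x y} h => ?_, fun {x y z} h h' => ?_⟩
        · rw [min_self] at h1; rw [max_self] at h3
          exact absurd h2 (h3.trans h1).not_gt
        · rwa [min_comm, max_comm]
        · intro s t h1 h2 h3
          by_cases hty : t ≤ y
          · by_cases hc : min x y ≤ s
            · exact h s t hc h2 (hty.trans (le_max_right _ _))
            · refine h' s t ?_ h2 (hty.trans (le_max_left _ _))
              rw [min_le_iff] at h1 hc ⊢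
              push Not at hc
              exact Or.inr (h1.resolve_left hc.1.not_ge)
          by_cases hys : y ≤ s
          · by_cases hc : t ≤ max x y
            · exact h s t ((min_le_right _ _).trans hys) h2 hc
            · refine h' s t ((min_le_left _ _).trans hys) h2 ?_
              rw [le_max_iff] at h3 hc ⊢
              push Not at hc
              exact Or.inr (h3.resolve_left hc.1.not_ge)
          push Not at hty hys
          refine lt_trans (b := v y) ?_ ?_
          · by_cases hc : min x y ≤ s
            · exact h s y hc hys (le_max_right _ _)
            · refine h' s y ?_ hys (le_max_left _ _)
              rw [min_le_iff] at h1 hc ⊢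
              push Not at hc
              exact Or.inr (h1.resolve_left hc.1.not_ge)
          · by_cases hc : t ≤ max x y
            · exact h y t (min_le_right _ _) hty hc
            · refine h' y t (min_le_left _ _) hty ?_
              rw [le_max_iff] at h3 hc ⊢
              push Not at hc
              exact Or.inr (h3.resolve_left hc.1.not_ge) }
  have hE : ∀ x y, E x y ↔ ∀ s t, min x y ≤ s → s < t → t ≤ max x y → v s ⊂ v t :=
    fun _ _ => Iff.rfl
  have hall : ∀ x y, E x y := by
    refine rel_of_infinite_classes (G := G) E ?_ ?_ ?_
    · intro a x y h s t h1 h2 h3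
      have hs : ∀ p q, v p ⊂ v q → v (a • p) ⊂ v (a • q) := by
        intro p q hpq
        refine ⟨fun z hz => ?_, fun hz => hpq.2 fun z hz' => ?_⟩
        · rw [← smul_inv_smul a z, hsm] at hz ⊢
          exact hpq.1 hz
        · have := hz ((hsm a q z).2 hz')
          rwa [hsm] at this
      have := hs (a⁻¹ • s) (a⁻¹ • t) (h _ _ ?_ ((smul_lt_iff _).2 h2) ?_)
      · rwa [smul_inv_smul, smul_inv_smul] at this
      · rw [min_le_iff] at h1 ⊢
        rwa [← smul_le_iff a, ← smul_le_iff a (a := y), smul_inv_smul]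
      · rw [le_max_iff] at h3 ⊢
        rwa [← smul_le_iff a, ← smul_le_iff a (b := y), smul_inv_smul]
    · intro a b c hab hbc h s t h1 h2 h3
      rw [min_eq_left hab] at h1
      rw [max_eq_right hab] at h3
      exact h s t (by rwa [min_eq_left (hab.trans hbc)]) h2
        (by rw [max_eq_right (hab.trans hbc)]; exact h3.trans hbc)
    · intro x
      obtain ⟨a, b, hax, hxb, g, hg⟩ := hloc x
      refine (Set.Ioo_infinite hxb).mono fun y hy s t h1 h2 h3 => ?_
      rw [min_eq_right hy.1.le] at h1
      rw [max_eq_left hy.1.le] at h3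
      have hs := hg s (hax.le.trans h1) (h2.le.trans (h3.trans hy.2.le))
      have ht := hg t (hax.le.trans (h1.trans h2.le)) (h3.trans hy.2.le)
      rw [hs.2, ht.2]
      exact (hu.translate g).strict s hs.1 t ht.1 h2
  have hmono : ∀ x y, x ≤ y → v x ⊆ v y := fun x y hxy => by
    rcases hxy.eq_or_lt with rfl | hxy
    · exact subset_rfl
    · exact (hall x y x y (min_le_left _ _) hxy (le_max_right _ _)).1
  have hnormal : IsNormal G v := by
    refine ⟨⟨hmono, fun x => ?_, fun x => ?_, fun x h => ?_, hsm⟩, fun x => ?_⟩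
    · obtain ⟨g, hg, e⟩ := hv x
      rw [← e]; exact (hu.translate g).lower x hg
    · obtain ⟨x', hx'⟩ := exists_lt x
      obtain ⟨y, hy, -⟩ := Set.exists_of_ssubset
        (hall x' x x' x (min_le_left _ _) hx' (le_max_right _ _))
      exact ⟨y, hy⟩
    · obtain ⟨x', hx'⟩ := exists_gt x
      obtain ⟨y, -, hy⟩ := Set.exists_of_ssubset
        (hall x x' x x' (min_le_left _ _) hx' (le_max_right _ _))
      exact hy (h ▸ Set.mem_univ y)
    · obtain ⟨g, hg, e⟩ := hv x
      rw [← e]; exact (hu.translate g).noLast x hg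
  -- `v` meets the translate by `g` at `x`, hence also at `g • x`; moving back by `g⁻¹` gives the
  -- value of `u` at `x`.
  refine ⟨v, hnormal, fun x hx => ?_⟩
  obtain ⟨g, hg, e⟩ := hv x
  have hgx : g • x ∈ trI g I := by rwa [mem_trI, inv_smul_smul]
  have h1 := hnormal.dleaf.subset_of_subset (hu.translate g) (Set.mem_univ x) hg
    (Set.mem_univ (g • x)) hgx e.ge
  have h2 := (hu.translate g).subset_of_subset hnormal.dleaf hg (Set.mem_univ x) hgx
    (Set.mem_univ (g • x)) e.le
  have h3 := h1.antisymm h2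
  ext y
  rw [← hsm g, h3, mem_tr, inv_smul_smul, inv_smul_smul]

lemma DLeaf.twin (hu : DLeaf G I u) : Twin G P Q := by
  obtain ⟨f, hf, -⟩ := hu.exists_normal
  exact ⟨f, hf.toIsTwinMap⟩

end

/-! ### Invariant monotone maps -/

section

variable {P : Type*} [LinearOrder P]

/-- Given finitely many convex sets, any infinite set contains two points `x < x'` such that each of
the sets contains either both of them or nothing in between. -/
lemma exists_pair_same_side {C : Set (Set P)} (hC : C.Finite) (hc : ∀ S ∈ C, S.OrdConnected)
    {X : Set P} (hX : X.Infinite) : ∃ x ∈ X, ∃ x' ∈ X, x < x' ∧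
      ∀ S ∈ C, (x ∈ S ∧ x' ∈ S) ∨ ∀ t, x ≤ t → t ≤ x' → t ∉ S := by
  -- The signature of a point: the sets containing it, and those having an element to its left. An
  -- infinite set contains two points with equal signature, and convexity does the rest.
  let σ (x : P) : Set (Set P) × Set (Set P) := ({S ∈ C | x ∈ S}, {S ∈ C | ∃ s ∈ S, s < x})
  have hσ : Set.MapsTo σ X ({T | T ⊆ C} ×ˢ {T | T ⊆ C}) := fun x _ =>
    ⟨Set.sep_subset _ _, Set.sep_subset _ _⟩
  obtain ⟨a, ha, b, hb, hab, hs⟩ :=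
    hX.exists_ne_map_eq_of_mapsTo hσ (hC.finite_subsets.prod hC.finite_subsets)
  have key : ∀ a b, a < b → σ a = σ b → ∀ S ∈ C, (a ∈ S ∧ b ∈ S) ∨ ∀ t, a ≤ t → t ≤ b → t ∉ S := by
    intro a b hab hs S hS
    have h1 : a ∈ S ↔ b ∈ S := by
      have := Set.ext_iff.1 (Prod.ext_iff.1 hs).1 S
      simpa [σ, hS] using this
    have h2 : (∃ s ∈ S, s < a) ↔ ∃ s ∈ S, s < b := by
      have := Set.ext_iff.1 (Prod.ext_iff.1 hs).2 S
      simpa [σ, hS] using this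
    by_cases ha : a ∈ S
    · exact Or.inl ⟨ha, h1.1 ha⟩
    refine Or.inr fun t hat htb ht => ?_
    rcases htb.eq_or_lt with rfl | htb
    · exact ha (h1.2 ht)
    obtain ⟨s, hs, hsa⟩ := h2.2 ⟨t, ht, htb⟩
    exact ha ((hc S hS).out hs ht ⟨hsa.le, hat⟩)
  rcases lt_or_gt_of_ne hab with h | h
  · exact ⟨a, ha, b, hb, h, key a b h hs⟩
  · exact ⟨b, hb, a, ha, h, key b a h hs.symm⟩

/-- Given finitely many convex sets, an interval to the left of a point is contained in or disjoint
from each of them. -/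
lemma exists_left_interval [NoMinOrder P] {C : Set (Set P)} (hC : C.Finite)
    (hc : ∀ S ∈ C, S.OrdConnected) (p : P) :
    ∃ q < p, ∀ S ∈ C, Set.Ioo q p ⊆ S ∨ ∀ t ∈ Set.Ioo q p, t ∉ S := by
  induction C, hC using Set.Finite.induction_on with
  | empty =>
    obtain ⟨q, hq⟩ := exists_lt p
    exact ⟨q, hq, by simp⟩
  | @insert S C _ _ ih =>
    obtain ⟨q, hq, h⟩ := ih fun T hT => hc T (Set.mem_insert_of_mem _ hT)
    obtain ⟨q', hq', h'⟩ : ∃ q' < p, Set.Ioo q' p ⊆ S ∨ ∀ t ∈ Set.Ioo q' p, t ∉ S := by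
      by_cases hno : ∃ q' < p, ∀ t ∈ Set.Ioo q' p, t ∉ S
      · obtain ⟨q', hq', h⟩ := hno
        exact ⟨q', hq', Or.inr h⟩
      push Not at hno
      obtain ⟨c, hc1, hc2⟩ := hno q hq
      refine ⟨c, hc1.2, Or.inl fun t ht => ?_⟩
      obtain ⟨c', hc1', hc2'⟩ := hno t ht.2
      exact (hc S (Set.mem_insert _ _)).out hc2 hc2' ⟨ht.1.le, hc1'.1.le⟩
    refine ⟨max q q', max_lt hq hq', ?_⟩
    have hs1 : Set.Ioo (max q q') p ⊆ Set.Ioo q p := Set.Ioo_subset_Ioo_left (le_max_left _ _)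
    have hs2 : Set.Ioo (max q q') p ⊆ Set.Ioo q' p := Set.Ioo_subset_Ioo_left (le_max_right _ _)
    intro T hT
    rcases Set.mem_insert_iff.1 hT with rfl | hT
    · exact h'.imp hs2.trans fun h t ht => h t (hs2 ht)
    · exact (h T hT).imp hs1.trans fun h t ht => h t (hs1 ht)

end

/-- A non-decreasing map, invariant under `H`, to the lower sets without greatest element. -/
structure MonoMap {G P Q : Type*} [LinearOrder P] [LinearOrder Q] [Group G]
    [MulAction G P] [MulAction G Q] (H : Subgroup G) (F : P → Set Q) : Prop where
  mono : ∀ x y, x ≤ y → F x ⊆ F y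
  lower : ∀ x, IsLowerSet (F x)
  noLast : ∀ x, ∀ y ∈ F x, ∃ y' ∈ F x, y < y'
  smul_mem : ∀ g ∈ H, ∀ x y, g • y ∈ F (g • x) ↔ y ∈ F x

section

variable {G P Q : Type*} [Group G] [OligGroup G] [LinearOrder P] [LinearOrder Q]
  [MulAction G P] [MulAction G Q] [Tame G P] [Tame G Q] {H : Subgroup G} {F : P → Set Q}

/-- There are finitely many convex sets such that on each interval contained in none of them but
contained in or disjoint from each of them the map is a leaf. -/
lemma MonoMap.exists_finite (hH : Op H) (hF : MonoMap H F) :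
    ∃ C : Set (Set P), C.Finite ∧ (∀ S ∈ C, S.OrdConnected) ∧
      ∀ a b, a < b → (∀ S ∈ C, Set.Ioo a b ⊆ S ∨ ∀ t ∈ Set.Ioo a b, t ∉ S) →
        (∃ S ∈ C, Set.Ioo a b ⊆ S ∧ ∀ s ∈ S, ∀ t ∈ S, F s = F t) ∨ DLeaf G (Set.Ioo a b) F := by
  have := Tame.denselyOrdered G P
  have := Tame.denselyOrdered G Q
  let E : Setoid P := Setoid.ker F
  have hE : ∀ x y, E x y ↔ F x = F y := fun _ _ => Iff.rfl
  have hEc : ∀ a b c, a ≤ b → b ≤ c → E a c → E a b := fun a b c hab hbc h =>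
    (hF.mono a b hab).antisymm ((hF.mono b c hbc).trans (le_of_eq ((hE a c).1 h).symm))
  have h1 := Tame.rankOne H hH E (by
    intro h hh x y hxy
    rw [hE] at hxy ⊢
    ext t
    rw [← smul_inv_smul h t, hF.smul_mem h hh, hF.smul_mem h hh, hxy]) hEc
  let E' : Setoid Q := ⟨fun a b => ∀ t, a ∈ F t ↔ b ∈ F t, fun _ _ => Iff.rfl,
    fun h t => (h t).symm, fun h h' t => (h t).trans (h' t)⟩
  have hEc' : ∀ a b c, a ≤ b → b ≤ c → E' a c → E' a b := fun a b c hab hbc h t =>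
    ⟨fun ha => hF.lower t hbc ((h t).1 ha), fun hb => hF.lower t hab hb⟩
  have h2 := Tame.rankOne H hH E' (by
    intro h hh x y hxy t
    rw [← smul_inv_smul h t, hF.smul_mem h hh, hF.smul_mem h hh, hxy]) hEc'
  -- An infinite class `D` of points not separated by `F` is a jump, and the boundary of `U D` is
  -- the place where it occurs. An interval that is cut by no `U D` and no infinite constancy class
  -- carries neither a jump nor a partial constancy.
  let U (D : Set Q) : Set P := {t | D ⊆ F t}
  refine ⟨{C ∈ E.classes | C.Infinite} ∪ U '' {C ∈ E'.classes | C.Infinite},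
    h1.union (h2.image _), ?_, ?_⟩
  · rintro S (⟨⟨z, rfl⟩, -⟩ | ⟨D, -, rfl⟩)
    · refine ⟨fun x hx y hy t ht => ?_⟩
      have hxy : E x y := E.trans hx (E.symm hy)
      exact E.trans (E.symm (hEc x t y ht.1 ht.2 hxy)) hx
    · exact ⟨fun x hx y hy t ht => (show D ⊆ F x from hx).trans (hF.mono _ _ ht.1)⟩
  · intro a b hab hS
    by_cases hcase : ∃ S ∈ {C ∈ E.classes | C.Infinite}, Set.Ioo a b ⊆ S
    · obtain ⟨S, hS1, hS2⟩ := hcase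
      refine Or.inl ⟨S, Or.inl hS1, hS2, ?_⟩
      obtain ⟨⟨z, rfl⟩, -⟩ := hS1
      intro s hs t ht
      exact ((hE _ _).1 hs).trans ((hE _ _).1 ht).symm
    right
    push Not at hcase
    have hstrict : ∀ x ∈ Set.Ioo a b, ∀ x' ∈ Set.Ioo a b, x < x' → F x ⊂ F x' := by
      intro x hx x' hx' hlt
      refine (hF.mono x x' hlt.le).ssubset_of_ne fun heq => ?_
      have hcl : {t | E t x} ∈ {C ∈ E.classes | C.Infinite} := by
        refine ⟨E.mem_classes x, (Set.Ioo_infinite hlt).mono fun t ht => ?_⟩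
        exact E.symm (hEc x t x' ht.1.le ht.2.le heq)
      rcases hS _ (Or.inl hcl) with h | h
      · exact hcase _ hcl h
      · exact h x hx (E.refl x)
    refine ⟨⟨⟨Set.ordConnected_Ioo, fun x _ => hF.lower x, hstrict, ?_⟩, fun x _ => hF.noLast x,
      Set.nonempty_Ioo.2 hab, ?_, ?_⟩, ?_⟩
    · intro x hx x' hx' y y' hyy hy hy'
      by_contra! hno
      have hyE : E' y y' := fun t => ⟨fun ht => by
        rcases le_or_gt t x with h | h
        · exact absurd (hF.mono _ _ h ht) hy
        rcases le_or_gt x' t with h' | h'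
        · exact hF.mono _ _ h' hy'
        exact hno t ⟨hx.1.trans h, h'.trans hx'.2⟩ ht, hF.lower t hyy.le⟩
      have hcl : {z | E' z y} ∈ {C ∈ E'.classes | C.Infinite} := by
        refine ⟨E'.mem_classes y, (Set.Ioo_infinite hyy).mono fun t ht => ?_⟩
        exact E'.symm (hEc' y t y' ht.1.le ht.2.le hyE)
      have hU : ∀ t, t ∈ U {z | E' z y} ↔ y ∈ F t := fun t =>
        ⟨fun h => h (E'.refl y), fun h z hz => ((show E' z y from hz) t).2 h⟩
      rcases hS _ (Or.inr ⟨_, hcl, rfl⟩) with h | h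
      · exact hy ((hU x).1 (h hx))
      · exact h x' hx' ((hU x').2 (hF.lower _ hyy.le hy'))
    · intro x hx
      obtain ⟨c, h, h'⟩ := exists_between hx.2
      exact ⟨c, ⟨hx.1.trans h, h'⟩, h⟩
    · intro x hx
      obtain ⟨c, h, h'⟩ := exists_between hx.1
      exact ⟨c, ⟨h, h'.trans hx.2⟩, h'⟩
    · refine ⟨H ⊓ (MulAction.stabilizer G a ⊓ MulAction.stabilizer G b),
        OligGroup.inf hH (OligGroup.inf (Tame.stab a) (Tame.stab b)), fun g hg x hx => ⟨?_, ?_⟩⟩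
      · have ha := MulAction.mem_stabilizer_iff.1 hg.2.1
        have hb := MulAction.mem_stabilizer_iff.1 hg.2.2
        rw [← ha, ← hb]
        exact ⟨(smul_lt_iff g).2 hx.1, (smul_lt_iff g).2 hx.2⟩
      · exact hF.smul_mem g hg.1 x

/-- Choosing one argument for each of the infinitely many values gives an infinite set on which `F`
is injective; two of its points not separated by the finitely many convex sets cannot bound an
interval of constancy. -/
lemma MonoMap.exists_leaf (hH : Op H) (hF : MonoMap H F) (hinf : (Set.range F).Infinite) :
    ∃ I, DLeaf G I F := by
  obtain ⟨C, hC, hc, h⟩ := hF.exists_finite hH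
  obtain ⟨X, hX⟩ := Set.SurjOn.exists_bijOn_subset (f := F) (s := Set.univ) (t := Set.range F)
    (by rintro _ ⟨x, rfl⟩; exact ⟨x, trivial, rfl⟩)
  have hXinf : X.Infinite := fun hfin => hinf (hX.2.image_eq ▸ hfin.image F)
  obtain ⟨x, hx, x', hx', hlt, hS⟩ := exists_pair_same_side hC hc hXinf
  have hS' : ∀ S ∈ C, Set.Ioo x x' ⊆ S ∨ ∀ t ∈ Set.Ioo x x', t ∉ S := fun S hSC => by
    rcases hS S hSC with hS | hS
    · exact Or.inl fun t ht => (hc S hSC).out hS.1 hS.2 ⟨ht.1.le, ht.2.le⟩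
    · exact Or.inr fun t ht => hS t ht.1.le ht.2.le
  rcases h x x' hlt hS' with ⟨S, hSC, hsub, hconst⟩ | h
  · exfalso
    have := Tame.denselyOrdered G P
    rcases hS S hSC with hS | hS
    · exact hlt.ne (hX.2.injOn hx hx' (hconst x hS.1 x' hS.2))
    · obtain ⟨t, ht⟩ := exists_between hlt
      exact hS t ht.1.le ht.2.le (hsub ht)
  · exact ⟨_, h⟩

/-- Left continuity is automatic: a value without greatest element that jumps nowhere is the union
of the smaller ones. -/
lemma IsNormal.leftContinuous {f : P → Set Q} (hf : IsNormal G f) {x : P} {y : Q} (hy : y ∈ f x) :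
    ∃ t < x, y ∈ f t := by
  obtain ⟨y', hy', hlt⟩ := hf.noLast x y hy
  obtain ⟨x₀, hx₀⟩ := hf.exists_notMem y
  obtain ⟨t, ht, ht'⟩ := hf.nojump hlt hx₀
  exact ⟨t, lt_of_not_ge fun h => ht' (hf.mono _ _ h hy'), ht⟩

/-- A left continuous invariant monotone map is either constant to the left of a point, or agrees
there with an equivariant map. -/
lemma MonoMap.left_constant_or (hH : Op H) (hF : MonoMap H F) (p : P)
    (hp : ∀ y ∈ F p, ∃ t < p, y ∈ F t) :
    (∃ q < p, ∀ t, q < t → t ≤ p → F t = F p) ∨ ∃ f : P → Set Q, IsNormal G f ∧ f p = F p := by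
  have := Tame.noMinOrder G P
  have := Tame.denselyOrdered G P
  obtain ⟨C, hC, hc, h⟩ := hF.exists_finite hH
  obtain ⟨q, hq, hS⟩ := exists_left_interval hC hc p
  rcases h q p hq hS with ⟨S, -, hsub, hconst⟩ | h
  · refine Or.inl ⟨q, hq, fun t hqt htp => ?_⟩
    rcases htp.eq_or_lt with rfl | htp
    · rfl
    refine (hF.mono _ _ htp.le).antisymm fun y hy => ?_
    obtain ⟨s, hs, hys⟩ := hp y hy
    rw [hconst t (hsub ⟨hqt, htp⟩) (max s t) (hsub ⟨hqt.trans_le (le_max_right _ _),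
      max_lt hs htp⟩)]
    exact hF.mono _ _ (le_max_left _ _) hys
  · obtain ⟨f, hf, hfe⟩ := h.exists_normal
    refine Or.inr ⟨f, hf, ?_⟩
    -- Both maps are left continuous at `p` and agree just to its left.
    obtain ⟨c, hc⟩ := exists_between hq
    ext y
    constructor
    · intro hy
      obtain ⟨s, hs, hys⟩ := hf.leftContinuous hy
      have hm : max s c ∈ Set.Ioo q p := ⟨hc.1.trans_le (le_max_right _ _), max_lt hs hc.2⟩
      refine hF.mono _ _ hm.2.le ?_
      rw [← hfe _ hm]
      exact hf.mono _ _ (le_max_left _ _) hys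
    · intro hy
      obtain ⟨s, hs, hys⟩ := hp y hy
      have hm : max s c ∈ Set.Ioo q p := ⟨hc.1.trans_le (le_max_right _ _), max_lt hs hc.2⟩
      refine hf.mono _ _ hm.2.le ?_
      rw [hfe _ hm]
      exact hF.mono _ _ (le_max_left _ _) hys

omit [LinearOrder Q] [MulAction G Q] [Tame G Q] in
/-- An invariant family of finite sets, the elements of which persist to the left, has a finite
union. -/
lemma finite_iUnion_of_left_open {α : Type*} (hH : Op H) (F : P → Set α) (hfin : ∀ p, (F p).Finite)
    (hcard : ∀ h ∈ H, ∀ p, (F (h • p)).ncard = (F p).ncard)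
    (heq : ∀ h ∈ H, ∀ p p', F p = F p' → F (h • p) = F (h • p'))
    (hleft : ∀ p, ∀ v ∈ F p, ∃ q < p, ∀ t, q < t → t ≤ p → v ∈ F t) : (⋃ p, F p).Finite := by
  have := Tame.denselyOrdered G P
  have := Tame.noMinOrder G P
  -- Related points are those between which `F` is constant.
  let E : Setoid P :=
    { r := fun x y => ∀ s, min x y ≤ s → s ≤ max x y → F s = F x
      iseqv := by
        refine ⟨fun x s h1 h2 => ?_, fun {x y} h s h1 h2 => ?_, fun {x y z} h h' s h1 h2 => ?_⟩
        · rw [min_self] at h1; rw [max_self] at h2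
          rw [le_antisymm h2 h1]
        · rw [min_comm] at h1; rw [max_comm] at h2
          rw [h s h1 h2, h y (min_le_right _ _) (le_max_right _ _)]
        · have hyx : F y = F x := h y (min_le_right _ _) (le_max_right _ _)
          by_cases hc : min x y ≤ s ∧ s ≤ max x y
          · exact h s hc.1 hc.2
          · rw [← hyx]
            refine h' s ?_ ?_ <;> grind }
  have hE : ∀ x y, E x y ↔ ∀ s, min x y ≤ s → s ≤ max x y → F s = F x := fun _ _ => Iff.rfl
  have hEF : ∀ x y, E x y → F x = F y := fun x y h =>
    (h y (min_le_right _ _) (le_max_right _ _)).symm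
  have hEc : ∀ a b c, a ≤ b → b ≤ c → E a c → E a b := fun a b c hab hbc h s h1 h2 => by
    rw [min_eq_left hab] at h1
    rw [max_eq_right hab] at h2
    exact h s (by rwa [min_eq_left (hab.trans hbc)])
      (by rw [max_eq_right (hab.trans hbc)]; exact h2.trans hbc)
  have hrank := Tame.rankOne H hH E (by
    intro a ha x y h s h1 h2
    have := heq a ha (a⁻¹ • s) x (h _ ?_ ?_)
    · rwa [smul_inv_smul] at this
    · rw [min_le_iff] at h1 ⊢
      rwa [← smul_le_iff a, ← smul_le_iff a (a := y), smul_inv_smul]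
    · rw [le_max_iff] at h2 ⊢
      rwa [← smul_le_iff a, ← smul_le_iff a (b := y), smul_inv_smul]) hEc
  have hconn : ∀ S ∈ {C ∈ E.classes | C.Infinite}, S.OrdConnected := by
    rintro S ⟨⟨z, rfl⟩, -⟩
    refine ⟨fun x hx y hy t ht => ?_⟩
    have hxy : E x y := E.trans hx (E.symm hy)
    exact E.trans (E.symm (hEc x t y ht.1 ht.2 hxy)) hx
  -- Otherwise some interval meets no infinite class. At a point of it where `F` has the most
  -- elements, all of them persist to the left, and maximality forces `F` to be constant there, so
  -- this point lies in an infinite class after all.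
  have hU : {p | ∀ S ∈ {C ∈ E.classes | C.Infinite}, p ∉ S}.Finite := by
    by_contra hinf
    obtain ⟨u, hu, u', hu', hlt, hS⟩ := exists_pair_same_side hrank hconn hinf
    obtain ⟨N, hN⟩ := exists_bound_of_finite_range _ (finite_range_of_invariant hH
      (fun p => (F p).ncard) hcard)
    have hne : ((fun p => (F p).ncard) '' Set.Ioo u u').Nonempty :=
      (Set.nonempty_Ioo.2 hlt).image _
    have hbdd : BddAbove ((fun p => (F p).ncard) '' Set.Ioo u u') :=
      ⟨N, by rintro _ ⟨p, -, rfl⟩; exact hN p⟩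
    obtain ⟨p, hp, hpmax⟩ := Nat.sSup_mem hne hbdd
    have hpmax' : ∀ t ∈ Set.Ioo u u', (F t).ncard ≤ (F p).ncard := fun t ht => by
      rw [show (F p).ncard = _ from hpmax]; exact le_csSup hbdd ⟨t, ht, rfl⟩
    have hP : Nonempty P := ⟨p⟩
    choose! q hq hqF using hleft p
    obtain ⟨q', hq', hq'F⟩ : ∃ q' < p, ∀ v ∈ F p, q v ≤ q' := by
      rcases (F p).eq_empty_or_nonempty with h | h
      · obtain ⟨q', hq'⟩ := exists_lt p
        exact ⟨q', hq', by simp [h]⟩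
      · obtain ⟨v, hv, hmax⟩ := Set.exists_max_image _ q (hfin p) h
        exact ⟨q v, hq v hv, hmax⟩
    have hconst : ∀ t, max u q' < t → t ≤ p → F t = F p := by
      intro t h1 h2
      rw [max_lt_iff] at h1
      refine (Set.eq_of_subset_of_ncard_le (fun v hv => ?_) (hpmax' t ⟨h1.1, h2.trans_lt hp.2⟩)
        (hfin t)).symm
      exact hqF v hv t ((hq'F v hv).trans_lt h1.2) h2
    have hcl : {t | E t p} ∈ {C ∈ E.classes | C.Infinite} := by
      refine ⟨E.mem_classes p, (Set.Ioo_infinite (max_lt hp.1 hq')).mono fun t ht s h1 h2 => ?_⟩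
      rw [min_eq_left ht.2.le] at h1
      rw [max_eq_right ht.2.le] at h2
      rw [hconst s (ht.1.trans_le h1) h2, hconst t ht.1 ht.2.le]
    rcases hS _ hcl with h | h
    · exact hu _ hcl h.1
    · exact h p hp.1.le hp.2.le (E.refl p)
  have hrange : (Set.range F).Finite := by
    refine ((hU.image F).union (hrank.image fun C => ⋃ p ∈ C, F p)).subset ?_
    rintro _ ⟨p, rfl⟩
    by_cases hp : p ∈ {p | ∀ S ∈ {C ∈ E.classes | C.Infinite}, p ∉ S}
    · exact Or.inl ⟨p, hp, rfl⟩
    · simp only [Set.mem_ofPred_eq, not_forall, not_not] at hp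
      obtain ⟨S, hS, hpS⟩ := hp
      refine Or.inr ⟨S, hS, subset_antisymm (Set.iUnion₂_subset fun t ht => ?_)
        fun v hv => Set.mem_iUnion₂.2 ⟨p, hpS, hv⟩⟩
      obtain ⟨⟨z, rfl⟩, -⟩ := hS
      exact (hEF t p (E.trans ht (E.symm hpS))).le
  have := hrange.sUnion (by rintro _ ⟨p, rfl⟩; exact hfin p)
  rwa [Set.sUnion_range] at this

end

open OligGroup OrderDual

/-! ### Monotone relations between several orders -/

section

variable {G : Type*} [Group G] [OligGroup G] {ι : Type*} [Fintype ι] [DecidableEq ι]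
  {P : ι → Type*} [∀ m, LinearOrder (P m)] [∀ m, MulAction G (P m)] [∀ m, Tame G (P m)]

variable (G) in
/-- An invariant relation that is downward closed and open in each of its variables. -/
structure OpenRel (R : (∀ m, P m) → Prop) : Prop where
  smul : ∀ (g : G) p, R p → R fun m => g • p m
  down : ∀ p m q, q ≤ p m → R p → R (Function.update p m q)
  open_ : ∀ p m, R p → ∃ q, p m < q ∧ R (Function.update p m q)

/-- The values of the variable `l` admitted by `R` for given values of the other variables. -/
def cutAt (R : (∀ m, P m) → Prop) (l : ι) (p : ∀ m, P m) : Set (P l) :=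
  {q | R (Function.update p l q)}

variable (G) in
/-- The set `v` is the image of a coordinate of `p` under an equivariant map. -/
def IsTwinValue (l : ι) (p : ∀ m, P m) (v : Set (P l)) : Prop :=
  ∃ m, m ≠ l ∧ ∃ f : (P m)ᵒᵈ → Set (P l), IsNormal G f ∧ f (toDual (p m)) = v

/-- The translate of a set. -/
def trSet {X : Type*} [MulAction G X] (g : G) (v : Set X) : Set X := {y | g⁻¹ • y ∈ v}

lemma trSet_injective {X : Type*} [MulAction G X] (g : G) :
    Function.Injective (trSet g : Set X → Set X) := fun v w h => by
  ext y
  have := Set.ext_iff.1 h (g • y)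
  simpa [trSet] using this

lemma update_smul (g : G) (p : ∀ m, P m) (m : ι) (q : P m) :
    (fun k => g • Function.update p m q k) = Function.update (fun k => g • p k) m (g • q) := by
  ext k
  by_cases h : k = m
  · subst h; simp
  · simp [h]

omit [OligGroup G] [Fintype ι] [∀ m, Tame G (P m)] in
lemma IsTwinValue.smul {l : ι} {p : ∀ m, P m} {v : Set (P l)} (h : IsTwinValue G l p v) (g : G) :
    IsTwinValue G l (fun m => g • p m) (trSet g v) := by
  obtain ⟨m, hm, f, hf, rfl⟩ := h
  refine ⟨m, hm, f, hf, ?_⟩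
  ext y
  have h := hf.smul_mem g (toDual (p m)) (g⁻¹ • y)
  rw [smul_inv_smul] at h
  exact h

variable (G) in
/-- The values of `cutAt R l` that are not twin values, where the variables in `J` vary. -/
def freeValues (R : (∀ m, P m) → Prop) (l : ι) (J : Finset ι) (p₀ : ∀ m, P m) : Set (Set (P l)) :=
  {v | ∃ p : ∀ m, P m, (∀ m, m ∉ J → m ≠ l → p m = p₀ m) ∧ cutAt R l p = v ∧ ¬ IsTwinValue G l p v}

variable {R : (∀ m, P m) → Prop}

lemma OpenRel.smul_iff (hR : OpenRel G R) (g : G) (p : ∀ m, P m) : R (fun m => g • p m) ↔ R p :=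
  ⟨fun h => by simpa using hR.smul g⁻¹ _ h, hR.smul g p⟩

lemma OpenRel.smul_mem_cutAt (hR : OpenRel G R) (g : G) (l : ι) (p : ∀ m, P m) (q : P l) :
    g • q ∈ cutAt R l (fun m => g • p m) ↔ q ∈ cutAt R l p := by
  unfold cutAt
  rw [Set.mem_ofPred_eq, Set.mem_ofPred_eq, ← update_smul, hR.smul_iff]

lemma OpenRel.cutAt_smul (hR : OpenRel G R) (g : G) (l : ι) (p : ∀ m, P m) :
    cutAt R l (fun m => g • p m) = trSet g (cutAt R l p) := by
  ext y
  rw [← smul_inv_smul g y, hR.smul_mem_cutAt, trSet, Set.mem_ofPred_eq, smul_inv_smul]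

lemma OpenRel.lower (hR : OpenRel G R) (l : ι) (p : ∀ m, P m) : IsLowerSet (cutAt R l p) := by
  intro a b hba ha
  have := hR.down (Function.update p l a) l b (by simpa using hba) ha
  simpa [cutAt] using this

lemma OpenRel.noLast (hR : OpenRel G R) (l : ι) (p : ∀ m, P m) :
    ∀ y ∈ cutAt R l p, ∃ y' ∈ cutAt R l p, y < y' := by
  intro y hy
  obtain ⟨q, h1, h2⟩ := hR.open_ _ l hy
  exact ⟨q, by simpa [cutAt] using h2, by simpa using h1⟩

lemma cutAt_update_self (l : ι) (p : ∀ m, P m) (q : P l) :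
    cutAt R l (Function.update p l q) = cutAt R l p := by
  simp [cutAt]

lemma OpenRel.freeValues_smul (hR : OpenRel G R) (g : G) (l : ι) (J : Finset ι) (p₀ : ∀ m, P m) :
    freeValues G R l J (fun m => g • p₀ m) = trSet g '' freeValues G R l J p₀ := by
  have key : ∀ (g : G) (p₀ : ∀ m, P m), ∀ v ∈ freeValues G R l J p₀,
      trSet g v ∈ freeValues G R l J (fun m => g • p₀ m) := by
    rintro g p₀ v ⟨p, h1, rfl, h2⟩
    refine ⟨fun m => g • p m, fun m hm hl => by
      show g • p m = g • p₀ m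
      rw [h1 m hm hl], hR.cutAt_smul g l p, fun h => h2 ?_⟩
    have := h.smul g⁻¹
    simpa [trSet] using this
  refine subset_antisymm (fun v hv => ?_) ?_
  · refine ⟨trSet g⁻¹ v, ?_, by simp [trSet]⟩
    have := key g⁻¹ _ v hv
    simpa using this
  · rintro _ ⟨v, hv, rfl⟩
    exact key g p₀ v hv

lemma op_iInf_stabilizer (p : ∀ m, P m) (s : Finset ι) :
    ∃ K : Subgroup G, Op K ∧ ∀ g ∈ K, ∀ m ∈ s, g • p m = p m := by
  induction s using Finset.induction_on with
  | empty => exact ⟨⊤, OligGroup.top, by simp⟩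
  | insert m s _ ih =>
    obtain ⟨K, hK, h⟩ := ih
    refine ⟨K ⊓ MulAction.stabilizer G (p m), OligGroup.inf hK (Tame.stab _), fun g hg k hk => ?_⟩
    rcases Finset.mem_insert.1 hk with rfl | hk
    · exact MulAction.mem_stabilizer_iff.1 hg.2
    · exact h g hg.1 k hk

lemma OpenRel.monoMap (hR : OpenRel G R) {l m : ι} (hml : m ≠ l) (p : ∀ m, P m) :
    ∃ K : Subgroup G, Op K ∧
      MonoMap K (fun t : (P m)ᵒᵈ => cutAt R l (Function.update p m (ofDual t))) := by
  obtain ⟨K, hK, h⟩ := op_iInf_stabilizer (G := G) p Finset.univ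
  refine ⟨K, hK, fun x y hxy q hq => ?_, fun x => hR.lower l _, fun x => hR.noLast l _,
    fun g hg x y => ?_⟩
  · have := hR.down _ m (ofDual y) (by simpa [hml] using hxy) hq
    rw [Function.update_comm hml.symm, Function.update_idem] at this
    exact this
  · have : Function.update p m (ofDual (g • x)) =
        fun k => g • Function.update p m (ofDual x) k := by
      rw [update_smul]
      congr 1
      funext k
      exact (h g hg k (Finset.mem_univ k)).symm
    simp only [this]
    exact hR.smul_mem_cutAt g l _ y

/-- Moving variable `m` upwards is moving left in the dual order. There the cut is either locally
constant or given by an equivariant map of `p m`, and the second option is excluded by assumption.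
-/
lemma OpenRel.left_open (hR : OpenRel G R) {l m : ι} (hml : m ≠ l) (p : ∀ m, P m)
    (hp : ¬ IsTwinValue G l p (cutAt R l p)) :
    ∃ q : (P m)ᵒᵈ, q < toDual (p m) ∧ ∀ t, q < t → t ≤ toDual (p m) →
      cutAt R l (Function.update p m (ofDual t)) = cutAt R l p ∧
      ¬ IsTwinValue G l (Function.update p m (ofDual t)) (cutAt R l p) := by
  obtain ⟨K, hK, hF⟩ := hR.monoMap hml p
  have hcov : ∀ y ∈ cutAt R l (Function.update p m (ofDual (toDual (p m)))),
      ∃ q < toDual (p m), y ∈ cutAt R l (Function.update p m (ofDual q)) := by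
    intro y hy
    simp only [ofDual_toDual, Function.update_eq_self] at hy
    obtain ⟨q, h1, h2⟩ := hR.open_ _ m hy
    rw [Function.update_of_ne hml] at h1
    refine ⟨toDual q, h1, ?_⟩
    rw [Function.update_comm hml.symm] at h2
    exact h2
  rcases hF.left_constant_or hK (toDual (p m)) hcov with ⟨q, hq, hc⟩ | ⟨f, hf, hfe⟩
  · have hc' : ∀ t, q < t → t ≤ toDual (p m) →
        cutAt R l (Function.update p m (ofDual t)) = cutAt R l p := fun t h1 h2 => by
      have := hc t h1 h2
      simpa using this
    -- The cut could still become a twin value through the moved coordinate. The equivariant map is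
    -- unique and strictly increasing, so this happens for at most one position of the coordinate,
    -- which is avoided by shrinking the interval.
    have key : ∃ q' : (P m)ᵒᵈ, q ≤ q' ∧ q' < toDual (p m) ∧ ∀ t, q' < t → t ≤ toDual (p m) →
        ¬ ∃ f : (P m)ᵒᵈ → Set (P l), IsNormal G f ∧ f t = cutAt R l p := by
      by_cases hex : ∃ t, q < t ∧ t < toDual (p m) ∧
          ∃ f : (P m)ᵒᵈ → Set (P l), IsNormal G f ∧ f t = cutAt R l p
      · obtain ⟨t₀, h1, h2, f₀, hf₀, h3⟩ := hex
        refine ⟨t₀, h1.le, h2, ?_⟩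
        rintro t h4 - ⟨f, hf, h5⟩
        rw [hf.unique hf₀] at h5
        exact (hf₀.strict h4).ne (h3.trans h5.symm)
      · refine ⟨q, le_rfl, hq, ?_⟩
        rintro t h1 h2 ⟨f, hf, h3⟩
        rcases h2.eq_or_lt with rfl | h2
        · exact hp ⟨m, hml, f, hf, h3⟩
        · exact hex ⟨t, h1, h2, f, hf, h3⟩
    obtain ⟨q', hqq, hq', h⟩ := key
    refine ⟨q', hq', fun t h1 h2 => ⟨hc' t (hqq.trans_lt h1) h2, ?_⟩⟩
    rintro ⟨k, hk, f, hf, h3⟩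
    by_cases hkm : k = m
    · subst hkm
      rw [Function.update_self] at h3
      exact h t h1 h2 ⟨f, hf, h3⟩
    · rw [Function.update_of_ne hkm] at h3
      exact hp ⟨k, hk, f, hf, h3⟩
  · refine absurd ⟨m, hml, f, hf, ?_⟩ hp
    rw [hfe]
    simp

/-- Variables are released one at a time. When `m` is released, the finite sets of free values for
each position of `m` persist to the left by `OpenRel.left_open`, so their union stays finite. -/
lemma OpenRel.finite_freeValues (hR : OpenRel G R) (l : ι) (J : Finset ι) :
    ∀ p₀ : ∀ m, P m, (freeValues G R l J p₀).Finite := by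
  induction J using Finset.induction_on with
  | empty =>
    intro p₀
    refine (Set.finite_singleton (cutAt R l p₀)).subset ?_
    rintro _ ⟨p, h1, rfl, -⟩
    have : p = Function.update p₀ l (p l) := by
      ext m
      by_cases h : m = l
      · subst h; simp
      · rw [Function.update_of_ne h]; exact h1 m (by simp) h
    rw [this, cutAt_update_self]
    rfl
  | insert m J hmJ ih =>
    intro p₀
    by_cases hml : m = l
    · refine (ih p₀).subset ?_
      rintro v ⟨p, h1, h2⟩
      exact ⟨p, fun k hk hkl => h1 k (by simp [hk, hml, hkl]) hkl, h2⟩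
    obtain ⟨K, hK, h⟩ := op_iInf_stabilizer (G := G) p₀ Finset.univ
    have hsm : ∀ g ∈ K, ∀ q : (P m)ᵒᵈ, freeValues G R l J (Function.update p₀ m (ofDual (g • q))) =
        trSet g '' freeValues G R l J (Function.update p₀ m (ofDual q)) := by
      intro g hg q
      rw [← hR.freeValues_smul, update_smul]
      congr 2
      funext k
      exact (h g hg k (Finset.mem_univ k)).symm
    refine (finite_iUnion_of_left_open (P := (P m)ᵒᵈ) hK
      (fun q => freeValues G R l J (Function.update p₀ m (ofDual q))) (fun q => ih _) ?_ ?_ ?_).subset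
      ?_
    · intro g hg q
      rw [hsm g hg, Set.ncard_image_of_injective _ (trSet_injective g)]
    · intro g hg q q' hq
      rw [hsm g hg, hsm g hg, hq]
    · rintro q v ⟨p, h1, rfl, h2⟩
      have hpm : p m = ofDual q := by rw [h1 m hmJ hml, Function.update_self]
      obtain ⟨q', hq', h3⟩ := hR.left_open hml p h2
      rw [hpm, toDual_ofDual] at hq' h3
      refine ⟨q', hq', fun t ht ht' => ⟨Function.update p m (ofDual t), fun k hk hkl => ?_, h3 t ht ht'⟩⟩
      by_cases hkm : k = m
      · subst hkm; simp
      · rw [Function.update_of_ne hkm, Function.update_of_ne hkm, h1 k hk hkl,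
          Function.update_of_ne hkm]
    · rintro v ⟨p, h1, h2⟩
      refine Set.mem_iUnion.2 ⟨toDual (p m), p, fun k hk hkl => ?_, h2⟩
      by_cases hkm : k = m
      · subst hkm; simp
      · rw [Function.update_of_ne hkm]
        exact h1 k (by simp [hk, hkm]) hkl

/-- The cuts defined by an open invariant relation are trivial or given by equivariant maps. -/
theorem OpenRel.cutAt_eq (hR : OpenRel G R) (l : ι) (p : ∀ m, P m) :
    cutAt R l p = ∅ ∨ cutAt R l p = Set.univ ∨ IsTwinValue G l p (cutAt R l p) := by
  by_contra! hcon
  obtain ⟨hne, huniv, htwin⟩ := hcon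
  -- With all variables released, the nonempty free values form a finite chain permuted by `G`. The
  -- least of them is an invariant nonempty set, hence everything, and so is every other member.
  let S : Set (Set (P l)) := {v ∈ freeValues G R l Finset.univ p | v.Nonempty}
  have hfree : ∀ p' : ∀ m, P m, freeValues G R l Finset.univ p' = freeValues G R l Finset.univ p :=
    fun p' => by simp [freeValues]
  have hSfin : S.Finite := (hR.finite_freeValues l Finset.univ p).subset (Set.sep_subset _ _)
  have hpS : cutAt R l p ∈ S := ⟨⟨p, by simp, rfl, htwin⟩, hne⟩
  have hmem : ⋂₀ S ∈ S := by
    refine sInter_mem_of_chain hSfin ⟨_, hpS⟩ ?_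
    rintro _ ⟨⟨p₁, -, rfl, -⟩, -⟩ _ ⟨⟨p₂, -, rfl, -⟩, -⟩
    exact (hR.lower l p₁).total (hR.lower l p₂)
  have hSs : ∀ g : G, ∀ v ∈ S, trSet g v ∈ S := by
    rintro g v ⟨hv, y, hy⟩
    refine ⟨?_, g • y, by simpa [trSet] using hy⟩
    rw [← hfree fun m => g • p m, hR.freeValues_smul]
    exact ⟨v, hv, rfl⟩
  have huni : ⋂₀ S = Set.univ := by
    refine eq_univ_of_invariant G (fun g x hx => ?_) hmem.2
    have := Set.sInter_subset_of_mem (hSs g⁻¹ _ hmem) hx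
    simpa [trSet] using this
  refine huniv (Set.eq_univ_of_forall fun x => ?_)
  exact Set.sInter_subset_of_mem hpS (huni ▸ Set.mem_univ x)

end

/-! ### Back-and-forth -/

/-- Back-and-forth between countable sets, for a system of partial matchings `r s`. -/
theorem exists_equiv_of_backAndForth {M N S : Type*} [Countable M] [Countable N]
    (r : S → Set (M × N))
    (forth : ∀ s a, ∃ s', r s ⊆ r s' ∧ ∃ b, (a, b) ∈ r s')
    (back : ∀ s b, ∃ s', r s ⊆ r s' ∧ ∃ a, (a, b) ∈ r s')
    (heq : ∀ s, ∀ p ∈ r s, ∀ q ∈ r s, p.1 = q.1 ↔ p.2 = q.2) (s₀ : S) :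
    ∃ e : M ≃ N, (∀ p ∈ r s₀, e p.1 = p.2) ∧ ∀ a a', ∃ s, (a, e a) ∈ r s ∧ (a', e a') ∈ r s := by
  classical
  have : Encodable M := Encodable.ofCountable M
  have : Encodable N := Encodable.ofCountable N
  have step : ∀ s (c : Option (M ⊕ N)), ∃ s', r s ⊆ r s' ∧
      (∀ a, c = some (Sum.inl a) → ∃ b, (a, b) ∈ r s') ∧
      (∀ b, c = some (Sum.inr b) → ∃ a, (a, b) ∈ r s') := by
    rintro s (_ | a | b)
    · exact ⟨s, subset_rfl, by simp, by simp⟩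
    · obtain ⟨s', h1, h2⟩ := forth s a
      exact ⟨s', h1, by rintro _ ⟨⟩; exact h2, by simp⟩
    · obtain ⟨s', h1, h2⟩ := back s b
      exact ⟨s', h1, by simp, by rintro _ ⟨⟩; exact h2⟩
  choose nxt h1 h2 h3 using step
  -- Stage `k` treats the element of `M` or `N` with code `k`, and does nothing if `k` is not a
  -- code.
  let L : ℕ → S := Nat.rec s₀ fun k s => nxt s (Encodable.decode k)
  have hmono : Monotone fun k => r (L k) := monotone_nat_of_le_succ fun k => h1 (L k) _
  have hl : ∀ a, ∃ k b, (a, b) ∈ r (L k) := fun a =>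
    ⟨Encodable.encode (Sum.inl a : M ⊕ N) + 1, h2 (L (Encodable.encode (Sum.inl a : M ⊕ N))) _ a (Encodable.encodek _)⟩
  have hr : ∀ b, ∃ k a, (a, b) ∈ r (L k) := fun b =>
    ⟨Encodable.encode (Sum.inr b : M ⊕ N) + 1, h3 (L (Encodable.encode (Sum.inr b : M ⊕ N))) _ b (Encodable.encodek _)⟩
  choose k f hf using hl
  choose k' f' hf' using hr
  have hboth : ∀ i j p q, p ∈ r (L i) → q ∈ r (L j) →
      p ∈ r (L (max i j)) ∧ q ∈ r (L (max i j)) := fun i j p q hp hq =>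
    ⟨hmono (le_max_left i j) hp, hmono (le_max_right i j) hq⟩
  have key : ∀ i j p q, p ∈ r (L i) → q ∈ r (L j) → (p.1 = q.1 ↔ p.2 = q.2) := fun i j p q hp hq =>
    heq _ p (hboth i j p q hp hq).1 q (hboth i j p q hp hq).2
  refine ⟨⟨f, f', fun a => ?_, fun b => ?_⟩, fun p hp => ?_, fun a a' => ?_⟩
  · exact (key _ _ _ _ (hf' (f a)) (hf a)).2 rfl
  · exact (key _ _ _ _ (hf (f' b)) (hf' b)).1 rfl
  · exact (key _ 0 _ _ (hf p.1) hp).1 rfl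
  · exact ⟨_, hboth _ _ _ _ (hf a) (hf a')⟩

/-! ### Types and definable sets -/

section

variable {L : FirstOrder.Language} {M : Type*} [L.Structure M] {α : Type*}

lemma OmegaCategorical.finite_tp (h : OmegaCategorical L M) (α : Type*) [Finite α] :
    (Set.range fun a : α → M => tp L a).Finite := by
  obtain ⟨k, ⟨e⟩⟩ := Finite.exists_equiv_fin α
  refine ((h k).image fun t => (FirstOrder.Language.Formula.relabel e) ⁻¹' t).subset ?_
  rintro _ ⟨a, rfl⟩
  refine ⟨_, ⟨a ∘ e.symm, rfl⟩, ?_⟩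
  ext φ
  simp [tp, FirstOrder.Language.Formula.realize_relabel, Function.comp_assoc]

lemma mem_iff_of_tp_eq {a b : α → M} (h : tp L a = tp L b) {S : Set (α → M)}
    (hS : (∅ : Set M).Definable L S) : a ∈ S ↔ b ∈ S := by
  obtain ⟨φ, rfl⟩ := Set.empty_definable_iff.1 hS
  exact Set.ext_iff.1 h φ

/-- With finitely many types, one formula separating `a` from each other type suffices; their
conjunction isolates the type of `a`. -/
lemma OmegaCategorical.definable_tp (h : OmegaCategorical L M) [Finite α] (a : α → M) :
    (∅ : Set M).Definable L {b | tp L b = tp L a} := by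
  have := (h.finite_tp α).to_subtype
  have hsep : ∀ t : Set.range fun a : α → M => tp L a, ∃ ψ : L.Formula α, ψ.Realize a ∧
      (t.1 ≠ tp L a → ∀ b : α → M, tp L b = t.1 → ¬ ψ.Realize b) := by
    rintro ⟨_, b, rfl⟩
    by_cases hne : tp L b = tp L a
    · exact ⟨⊤, by simp, fun h => (h hne).elim⟩
    obtain ⟨ψ, h1, h2⟩ : ∃ ψ : L.Formula α, ψ.Realize a ∧ ¬ ψ.Realize b := by
      by_contra! hcon
      refine hne (subset_antisymm (fun φ hφ => ?_) hcon)
      by_contra hφ'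
      exact hcon φ.not hφ' hφ
    exact ⟨ψ, h1, fun _ c hc hψ => h2 ((Set.ext_iff.1 hc ψ).1 hψ)⟩
  choose ψ h1 h2 using hsep
  have : {b : α → M | tp L b = tp L a} = ⋂ t, {b | (ψ t).Realize b} := by
    ext b
    refine ⟨fun hb => Set.mem_iInter.2 fun t => (Set.ext_iff.1 hb (ψ t)).2 (h1 t), fun hb => ?_⟩
    by_contra hne
    exact h2 ⟨_, b, rfl⟩ hne b rfl (Set.mem_iInter.1 hb _)
  rw [this]
  exact Set.definable_iInter_of_finite fun t => Set.empty_definable_iff.2 ⟨ψ t, rfl⟩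

/-- The tuples extendable to a realization of an isolated type form a definable set, so membership
passes from `a` to `b`. -/
lemma OmegaCategorical.exists_tp_cons (h : OmegaCategorical L M) {k : ℕ} {a b : Fin k → M}
    (hab : tp L a = tp L b) (c : M) :
    ∃ d, tp L (Fin.cons c a : Fin (k + 1) → M) = tp L (Fin.cons d b : Fin (k + 1) → M) := by
  have hd := (h.definable_tp (Fin.cons c a : Fin (k + 1) → M)).image_comp Fin.succ
  obtain ⟨x, hx, rfl⟩ := (mem_iff_of_tp_eq hab hd).1 ⟨Fin.cons c a, rfl, by ext; simp⟩
  refine ⟨x 0, ?_⟩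
  rw [← hx]
  congr 1
  exact (Fin.cons_self_tail x).symm

end

/-! ### Automorphisms -/

/-- The automorphism group. -/
def aut (n : ℕ) (M : Type*) [(lang n).Structure M] : Subgroup (Equiv.Perm M) where
  carrier := {e | ∀ (i : Fin n) a b, leAt M i (e a) (e b) ↔ leAt M i a b}
  mul_mem' {e f} he hf i a b := (he i _ _).trans (hf i a b)
  one_mem' i a b := Iff.rfl
  inv_mem' {e} he i a b := by
    have := he i (e⁻¹ a) (e⁻¹ b)
    simpa using this.symm

section

variable {n : ℕ} {M : Type*} [(lang n).Structure M]

lemma relMap_eq {N : Type*} [(lang n).Structure N] {k : ℕ} (r : (lang n).Relations k) (e : M ≃ N)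
    (h : ∀ (i : Fin n) a b, leAt N i (e a) (e b) ↔ leAt M i a b) (x : Fin k → M) :
    FirstOrder.Language.Structure.RelMap r (e ∘ x) ↔ FirstOrder.Language.Structure.RelMap r x := by
  obtain ⟨i⟩ := r
  have := h i (x 0) (x 1)
  have h1 : ![e (x 0), e (x 1)] = e ∘ x := by ext j; fin_cases j <;> rfl
  have h2 : ![x 0, x 1] = x := by ext j; fin_cases j <;> rfl
  unfold leAt at this
  rwa [h1, h2] at this

/-- A bijection compatible with all orders is an isomorphism. -/
def isoOfLe {N : Type*} [(lang n).Structure N] (e : M ≃ N)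
    (h : ∀ (i : Fin n) a b, leAt N i (e a) (e b) ↔ leAt M i a b) : M ≃[lang n] N where
  toEquiv := e
  map_fun' f := (f : Empty).elim
  map_rel' r x := relMap_eq r e h x

lemma realize_smul {α : Type*} (g : aut n M) (φ : (lang n).Formula α) (x : α → M) :
    φ.Realize (fun i => g • x i) ↔ φ.Realize x :=
  FirstOrder.Language.StrongHomClass.realize_formula (isoOfLe g.1 g.2) φ

lemma definable_leAt (i : Fin n) :
    (∅ : Set M).Definable (lang n) {x : Fin 2 → M | leAt M i (x 0) (x 1)} := by
  refine Set.empty_definable_iff.2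
    ⟨(leSymbol i).formula₂ (FirstOrder.Language.Term.var 0) (FirstOrder.Language.Term.var 1), ?_⟩
  ext x
  simp [leAt, FirstOrder.Language.Formula.realize_rel₂]

lemma exists_smul_eq_fin [Countable M] (hM : OmegaCategorical (lang n) M) {k : ℕ} {a b : Fin k → M}
    (hab : tp (lang n) a = tp (lang n) b) : ∃ g : aut n M, ∀ i, g • a i = b i := by
  let S := Σ k, {p : (Fin k → M) × (Fin k → M) // tp (lang n) p.1 = tp (lang n) p.2}
  let r : S → Set (M × M) := fun s => Set.range fun i => (s.2.1.1 i, s.2.1.2 i)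
  have hrel : ∀ s, ∀ p ∈ r s, ∀ q ∈ r s, ∀ D : Set (Fin 2 → M), (∅ : Set M).Definable (lang n) D →
      (![p.1, q.1] ∈ D ↔ ![p.2, q.2] ∈ D) := by
    rintro ⟨k, ⟨⟨a, b⟩, hab⟩⟩ _ ⟨i, rfl⟩ _ ⟨j, rfl⟩ D hD
    have := mem_iff_of_tp_eq hab (hD.preimage_comp ![i, j])
    have h1 : ∀ a : Fin k → M, a ∘ ![i, j] = ![a i, a j] := fun a => by
      ext t; fin_cases t <;> rfl
    rw [Set.mem_preimage, Set.mem_preimage, h1, h1] at this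
    exact this
  have forth : ∀ s c, ∃ s', r s ⊆ r s' ∧ ∃ d, (c, d) ∈ r s' := by
    rintro ⟨k, ⟨⟨a, b⟩, hab⟩⟩ c
    obtain ⟨d, hd⟩ := hM.exists_tp_cons hab c
    refine ⟨⟨k + 1, ⟨(Fin.cons c a, Fin.cons d b), hd⟩⟩, ?_, d, 0, rfl⟩
    rintro _ ⟨i, rfl⟩
    exact ⟨i.succ, rfl⟩
  have back : ∀ s d, ∃ s', r s ⊆ r s' ∧ ∃ c, (c, d) ∈ r s' := by
    rintro ⟨k, ⟨⟨a, b⟩, hab⟩⟩ d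
    obtain ⟨c, hc⟩ := hM.exists_tp_cons hab.symm d
    refine ⟨⟨k + 1, ⟨(Fin.cons c a, Fin.cons d b), hc.symm⟩⟩, ?_, c, 0, rfl⟩
    rintro _ ⟨i, rfl⟩
    exact ⟨i.succ, rfl⟩
  have heq : ∀ s, ∀ p ∈ r s, ∀ q ∈ r s, p.1 = q.1 ↔ p.2 = q.2 := by
    intro s p hp q hq
    have := hrel s p hp q hq {x | x 0 = x 1} (Set.empty_definable_iff.2
      ⟨(FirstOrder.Language.Term.var 0).equal (FirstOrder.Language.Term.var 1), by
        ext x; simp⟩)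
    simpa using this
  obtain ⟨e, h1, h2⟩ := exists_equiv_of_backAndForth r forth back heq ⟨k, ⟨(a, b), hab⟩⟩
  refine ⟨⟨e, fun (i : Fin n) x y => ?_⟩, fun i => h1 (a i, b i) ⟨i, rfl⟩⟩
  obtain ⟨s, hx, hy⟩ := h2 x y
  have := hrel s _ hx _ hy _ (definable_leAt i)
  simpa using this.symm

lemma exists_smul_eq [Countable M] (hM : OmegaCategorical (lang n) M) {α : Type*} [Finite α]
    {a b : α → M} (hab : tp (lang n) a = tp (lang n) b) : ∃ g : aut n M, ∀ i, g • a i = b i := by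
  obtain ⟨k, ⟨e⟩⟩ := Finite.exists_equiv_fin α
  obtain ⟨g, hg⟩ := exists_smul_eq_fin hM (a := a ∘ e.symm) (b := b ∘ e.symm) (by
    ext φ
    have := Set.ext_iff.1 hab (φ.relabel e.symm)
    simpa [tp, FirstOrder.Language.Formula.realize_relabel] using this)
  exact ⟨g, fun i => by simpa using hg (e i)⟩

/-- The automorphisms fixing `B` pointwise. -/
def fixing (n : ℕ) {M : Type*} [(lang n).Structure M] (B : Set M) : Subgroup (aut n M) :=
  fixingSubgroup (aut n M) B

lemma mem_fixing {B : Set M} {g : aut n M} : g ∈ fixing n B ↔ ∀ b ∈ B, g • b = b :=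
  mem_fixingSubgroup_iff _

/-- Tuples of equal type over the finite set `B` are conjugate under the automorphisms fixing `B`,
so an invariant set is a union of finitely many such types, each of them isolated. -/
lemma definable_of_invariant [Countable M] (hM : OmegaCategorical (lang n) M) {α : Type*} [Finite α]
    {B : Set M} (hB : B.Finite) {S : Set (α → M)}
    (hS : ∀ g ∈ fixing n B, ∀ x ∈ S, (fun i => g • x i) ∈ S) : B.Definable (lang n) S := by
  have := hB.to_subtype
  let el : (α → M) → (B ⊕ α → M) := fun x => Sum.elim (↑) x
  have hfin : ((fun x => tp (lang n) (el x)) '' S).Finite :=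
    (hM.finite_tp (B ⊕ α)).subset (by rintro _ ⟨x, -, rfl⟩; exact ⟨el x, rfl⟩)
  have := hfin.to_subtype
  have hd : (∅ : Set M).Definable (lang n)
      (⋃ t : (fun x => tp (lang n) (el x)) '' S, {y | tp (lang n) y = t.1}) := by
    refine Set.definable_iUnion_of_finite ?_
    rintro ⟨_, x, hx, rfl⟩
    exact hM.definable_tp (el x)
  obtain ⟨φ, hφ⟩ := Set.empty_definable_iff.1 hd
  refine Set.definable_iff_exists_formula_sum.2 ⟨φ, ?_⟩
  ext x
  have hx := Set.ext_iff.1 hφ (el x)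
  refine Iff.trans ?_ hx
  simp only [Set.mem_iUnion, Subtype.exists, Set.mem_image, Set.mem_ofPred_eq]
  constructor
  · exact fun hx => ⟨_, ⟨x, hx, rfl⟩, rfl⟩
  · rintro ⟨_, ⟨x', hx', rfl⟩, h⟩
    obtain ⟨g, hg⟩ := exists_smul_eq hM h.symm
    have : (fun i => g • x' i) = x := funext fun i => hg (Sum.inr i)
    rw [← this]
    exact hS g (mem_fixing.2 fun b hb => hg (Sum.inl ⟨b, hb⟩)) x' hx'

lemma smul_mem_of_definable {α : Type*} {B : Set M} {S : Set (α → M)}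
    (hS : B.Definable (lang n) S) {g : aut n M} (hg : g ∈ fixing n B) (x : α → M) :
    (fun i => g • x i) ∈ S ↔ x ∈ S := by
  obtain ⟨φ, rfl⟩ := Set.definable_iff_exists_formula_sum.1 hS
  have := realize_smul g φ (Sum.elim (↑) x)
  have h2 : (fun i => g • (Sum.elim (↑) x : B ⊕ α → M) i) = Sum.elim (↑) fun i => g • x i := by
    ext (b | i)
    · exact mem_fixing.1 hg b b.2
    · rfl
  rw [h2] at this
  exact this

lemma definable₁_of_invariant [Countable M] (hM : OmegaCategorical (lang n) M)
    {B : Set M} (hB : B.Finite) {S : Set M} (hS : ∀ g ∈ fixing n B, ∀ x ∈ S, g • x ∈ S) :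
    B.Definable₁ (lang n) S :=
  definable_of_invariant hM hB fun g hg x hx => hS g hg (x 0) hx

lemma definable₂_of_invariant [Countable M] (hM : OmegaCategorical (lang n) M)
    {B : Set M} (hB : B.Finite) {S : Set (M × M)}
    (hS : ∀ g ∈ fixing n B, ∀ x ∈ S, (g • x.1, g • x.2) ∈ S) :
    B.Definable₂ (lang n) S :=
  definable_of_invariant hM hB fun g hg x hx => hS g hg (x 0, x 1) hx

lemma smul_mem_of_definable₁ {B S : Set M} (hS : B.Definable₁ (lang n) S) {g : aut n M}
    (hg : g ∈ fixing n B) (x : M) : g • x ∈ S ↔ x ∈ S :=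
  smul_mem_of_definable (α := Fin 1) hS hg fun _ => x

lemma smul_mem_of_definable₂ {B : Set M} {S : Set (M × M)} (hS : B.Definable₂ (lang n) S)
    {g : aut n M} (hg : g ∈ fixing n B) (x y : M) : (g • x, g • y) ∈ S ↔ (x, y) ∈ S := by
  have := smul_mem_of_definable (α := Fin 2) hS hg ![x, y]
  simpa using this

lemma exists_finite_definable₁ {B S : Set M} (hS : B.Definable₁ (lang n) S) :
    ∃ C ⊆ B, C.Finite ∧ C.Definable₁ (lang n) S := by
  obtain ⟨A, h1, h2⟩ := Set.definable_iff_finitely_definable.1 hS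
  exact ⟨A, h1, A.finite_toSet, h2⟩

lemma exists_finite_definable₂ {B : Set M} {S : Set (M × M)} (hS : B.Definable₂ (lang n) S) :
    ∃ C ⊆ B, C.Finite ∧ C.Definable₂ (lang n) S := by
  obtain ⟨A, h1, h2⟩ := Set.definable_iff_finitely_definable.1 hS
  exact ⟨A, h1, A.finite_toSet, h2⟩

end

/-! ### The automorphism group as an oligomorphic group -/

section

variable {n : ℕ} {M : Type*} [(lang n).Structure M]

/-- The double coset of `g` is determined by the type of the joint tuple of `B` and `g • C`: an
automorphism matching two such tuples is the left factor, and what remains fixes `C`. -/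
lemma exists_finite_reps (hM : OmegaCategorical (lang n) M) [Countable M] {B C : Set M}
    (hB : B.Finite) (hC : C.Finite) : ∃ S : Set (aut n M), S.Finite ∧
      ∀ g, ∃ s ∈ S, ∃ h ∈ fixing n B, ∃ k ∈ fixing n C, g = h * s * k := by
  have := hB.to_subtype
  have := hC.to_subtype
  let t : aut n M → Set ((lang n).Formula (B ⊕ C)) := fun g =>
    tp (lang n) (Sum.elim (fun b : B => (b : M)) fun c : C => g • (c : M))
  have hfin : (Set.range t).Finite :=
    (hM.finite_tp (B ⊕ C)).subset (by rintro _ ⟨g, rfl⟩; exact ⟨_, rfl⟩)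
  obtain ⟨S, hS⟩ := Set.SurjOn.exists_bijOn_subset (f := t) (s := Set.univ) (t := Set.range t)
    (by rintro _ ⟨x, rfl⟩; exact ⟨x, trivial, rfl⟩)
  refine ⟨S, hS.2.finite_iff_finite.2 hfin, fun g => ?_⟩
  obtain ⟨s, hs, hst⟩ := hS.2.surjOn ⟨g, rfl⟩
  obtain ⟨h, hh⟩ := exists_smul_eq hM hst
  refine ⟨s, hs, h, mem_fixing.2 fun b hb => hh (Sum.inl ⟨b, hb⟩), s⁻¹ * h⁻¹ * g,
    mem_fixing.2 fun c hc => ?_, by group⟩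
  have := hh (Sum.inr ⟨c, hc⟩)
  simp only [Sum.elim_inr] at this
  rw [mul_smul, mul_smul, ← this, inv_smul_smul, inv_smul_smul]

/-- The open subgroups are those of the topology of pointwise convergence. -/
instance autOlig [hM : Fact (IsRankOneMultiOrder n M)] : OligGroup (aut n M) where
  Op H := ∃ B : Set M, B.Finite ∧ fixing n B ≤ H
  top := ⟨∅, Set.finite_empty, le_top⟩
  inf := by
    rintro H K ⟨B, hB, h1⟩ ⟨C, hC, h2⟩
    refine ⟨B ∪ C, hB.union hC, fun g hg => ⟨h1 ?_, h2 ?_⟩⟩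
    · exact mem_fixing.2 fun b hb => mem_fixing.1 hg b (Or.inl hb)
    · exact mem_fixing.2 fun b hb => mem_fixing.1 hg b (Or.inr hb)
  conj := by
    rintro H g ⟨B, hB, h1⟩
    refine ⟨fixing n ((fun b => g • b) '' B), ⟨_, hB.image _, le_rfl⟩, fun k hk => h1 ?_⟩
    refine mem_fixing.2 fun b hb => ?_
    rw [mul_smul, mul_smul, mem_fixing.1 hk _ ⟨b, hb, rfl⟩, inv_smul_smul]
  fin := by
    rintro H K ⟨B, hB, h1⟩ ⟨C, hC, h2⟩
    have := hM.out.countable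
    obtain ⟨S, hS, h⟩ := exists_finite_reps hM.out.omegaCategorical hB hC
    refine ⟨S, hS, fun g => ?_⟩
    obtain ⟨s, hs, a, ha, b, hb, hg⟩ := h g
    exact ⟨s, hs, a, h1 ha, b, h2 hb, hg⟩

/-- A copy of `M`, carrying the order `r`. -/
@[nolint unusedArguments]
def Copy (n : ℕ) (M : Type*) [(lang n).Structure M] (_ : M → M → Prop) : Type _ := M

/-- Linear orders that are invariant under automorphisms and of topological rank 1. -/
class InvOrder (n : ℕ) {M : Type*} [(lang n).Structure M] (r : M → M → Prop) : Prop where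
  linear : IsLinearOrder M r
  smul : ∀ (g : aut n M) a b, r a b → r (g • a) (g • b)
  rankOne : TopologicalRankOne (lang n) r

instance (r : M → M → Prop) : MulAction (aut n M) (Copy n M r) :=
  inferInstanceAs (MulAction (aut n M) M)

open Classical in
/-- The linear order `r` on the copy of `M`. -/
noncomputable instance Copy.order (r : M → M → Prop) [h : InvOrder n r] :
    LinearOrder (Copy n M r) where
  le := r
  lt := lt r
  le_refl := h.linear.refl
  le_trans := h.linear.trans
  le_antisymm := h.linear.antisymm
  le_total := h.linear.total
  lt_iff_le_not_ge a b := ⟨fun hab => ⟨hab.1, fun hba => hab.2 (h.linear.antisymm _ _ hab.1 hba)⟩,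
    fun hab => ⟨hab.1, fun he => hab.2 (he ▸ h.linear.refl _)⟩⟩
  toDecidableLE := Classical.decRel _

end

/-! ### Operations on equivariant maps -/

section

variable {G P Q S : Type*} [Group G] [OligGroup G] [LinearOrder P] [LinearOrder Q] [LinearOrder S]
  [MulAction G P] [MulAction G Q] [MulAction G S] [Tame G P] [Tame G Q] [Tame G S]

lemma isNormal_Iio : IsNormal G fun x : P => Set.Iio x := by
  have := Tame.noMinOrder G P
  have := Tame.noMaxOrder G P
  have := Tame.denselyOrdered G P
  exact
    { mono := fun x y h z hz => lt_of_lt_of_le hz h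
      lower := fun x => isLowerSet_Iio x
      nonempty := fun x => exists_lt x
      ne_univ := fun x h => lt_irrefl x (h ▸ Set.mem_univ x : x ∈ Set.Iio x)
      smul_mem := fun g x y => smul_lt_iff g
      noLast := fun x y hy => (exists_between hy).imp fun z hz => ⟨hz.2, hz.1⟩ }

/-- The relation `y ∈ f x` is read in the other variable and negated to restore the direction of
monotonicity. -/
lemma Twin.symm (h : Twin G P Q) : Twin G Q P := by
  obtain ⟨f, hf⟩ := h
  refine ⟨fun y => {x | y ∉ f x}, fun y y' hy x hx hx' => hx (hf.lower x hy hx'),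
    fun y x x' hx h1 h2 => h1 (hf.mono x' x hx h2), hf.exists_notMem, fun y h => ?_,
    fun g y x => not_congr (hf.smul_mem g x y)⟩
  obtain ⟨x, hx⟩ := hf.exists_mem y
  exact (Set.ext_iff.1 h x).2 trivial hx

lemma Twin.trans (h : Twin G P Q) (h' : Twin G Q S) : Twin G P S := by
  obtain ⟨f, hf⟩ := h
  obtain ⟨f', hf'⟩ := h'
  refine ⟨fun x => {z | ∃ y ∈ f x, z ∈ f' y}, ?_, ?_, fun x => ?_, fun x h => ?_, fun g x z => ?_⟩
  · rintro x x' hx z ⟨y, hy, hz⟩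
    exact ⟨y, hf.mono _ _ hx hy, hz⟩
  · rintro x z z' hz ⟨y, hy, hz'⟩
    exact ⟨y, hy, hf'.lower y hz hz'⟩
  · obtain ⟨y, hy⟩ := hf.nonempty x
    obtain ⟨z, hz⟩ := hf'.nonempty y
    exact ⟨z, y, hy, hz⟩
  · obtain ⟨y, hy⟩ := (Set.ne_univ_iff_exists_notMem _).1 (hf.ne_univ x)
    refine hf'.ne_univ y (Set.eq_univ_of_forall fun z => ?_)
    obtain ⟨y', hy', hz⟩ := (Set.ext_iff.1 h z).2 trivial
    refine hf'.mono y' y (le_of_lt (lt_of_not_ge fun hle => hy (hf.lower x hle hy'))) hz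
  · constructor
    · rintro ⟨y, hy, hz⟩
      refine ⟨g⁻¹ • y, ?_, ?_⟩
      · rwa [← hf.smul_mem g, smul_inv_smul]
      · rwa [← hf'.smul_mem g, smul_inv_smul]
    · rintro ⟨y, hy, hz⟩
      exact ⟨g • y, (hf.smul_mem g _ _).2 hy, (hf'.smul_mem g _ _).2 hz⟩

/-- There is no pair of equivariant maps to the lower sets, one increasing and one decreasing. -/
lemma IsTwinMap.not_decreasing {f h : P → Set Q} (hf : IsTwinMap G f)
    (mono : ∀ x y, x ≤ y → h y ⊆ h x) (lower : ∀ x, IsLowerSet (h x))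
    (nonempty : ∀ x, (h x).Nonempty) (ne_univ : ∀ x, h x ≠ Set.univ)
    (smul_mem : ∀ (g : G) x y, g • y ∈ h (g • x) ↔ y ∈ h x) : False := by
  obtain ⟨x₀⟩ : Nonempty P := (Tame.infinite G (P := P)).nonempty
  have hsub : ∀ (g : G) x, f x ⊆ h x → f (g • x) ⊆ h (g • x) := fun g x hx y hy => by
    rw [← smul_inv_smul g y, smul_mem]
    apply hx
    rwa [← hf.smul_mem g, smul_inv_smul]
  -- By transitivity the two maps compare the same way at all points, and opposite monotonicity
  -- spreads this to all pairs of points. But the values of `f` exhaust `Q` and have empty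
  -- intersection, which no value of `h` can bound.
  by_cases hex : ∃ x, f x ⊆ h x
  · have hall : {x | f x ⊆ h x} = Set.univ := MultiOrder.eq_univ_of_invariant G hsub hex
    have hall' : ∀ x x', f x ⊆ h x' := fun x x' =>
      (hf.mono _ _ (le_max_left x x')).trans
        ((Set.ext_iff.1 hall (max x x')).2 trivial |>.trans (mono _ _ (le_max_right x x')))
    refine ne_univ x₀ (Set.eq_univ_of_forall fun y => ?_)
    obtain ⟨x, hx⟩ := hf.exists_mem y
    exact hall' x x₀ hx
  · push Not at hex
    have hall' : ∀ x x', h x ⊆ f x' := fun x x' =>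
      (mono _ _ (min_le_left x x')).trans <|
        (((hf.lower _).total (lower _)).resolve_left (hex (min x x'))).trans
          (hf.mono _ _ (min_le_right x x'))
    obtain ⟨y, hy⟩ := nonempty x₀
    obtain ⟨x, hx⟩ := hf.exists_notMem y
    exact hx (hall' x₀ x hy)

end

/-! ### Invariant orders -/

section

variable {n : ℕ} {M : Type*} [(lang n).Structure M] {r s t : M → M → Prop}

instance InvOrder.rev [h : InvOrder n r] : InvOrder n (rev r) where
  linear :=
    { refl := h.linear.refl
      trans := fun a b c hab hbc => h.linear.trans _ _ _ hbc hab
      antisymm := fun a b hab hba => h.linear.antisymm _ _ hba hab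
      total := fun a b => h.linear.total b a }
  smul g a b := h.smul g b a
  rankOne := by
    rintro ⟨E, h1, h2, h3⟩
    exact h.rankOne ⟨E, h1, fun a b c hab hbc hac =>
      E.trans' hac (h2 c b a hbc hab (E.symm' hac)), h3⟩

/-- The order `r` or its reverse. -/
def sgn : Bool → (M → M → Prop) → M → M → Prop
  | true, r => r
  | false, r => rev r

instance (σ : Bool) [h : InvOrder n r] : InvOrder n (sgn σ r) := by
  cases σ
  · exact InvOrder.rev (h := h)
  · exact h

variable [hM : Fact (IsRankOneMultiOrder n M)]

instance InvOrder.leAt (i : Fin n) : InvOrder n (leAt M i) where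
  linear := hM.out.linear i
  smul g a b h := (g.2 i a b).2 h
  rankOne := hM.out.rankOne i

lemma exists_smul_eq_of_mem (x y : M) : ∃ g : aut n M, g • x = y := by
  have := hM.out.countable
  obtain ⟨g, hg⟩ := exists_smul_eq hM.out.omegaCategorical (hM.out.transitive x y)
  exact ⟨g, hg 0⟩

lemma op_stabilizer (x : M) : Op (MulAction.stabilizer (aut n M) x) :=
  ⟨{x}, Set.finite_singleton x, fun _ hg => mem_fixing.1 hg x rfl⟩

instance Copy.tame [h : InvOrder n r] : Tame (aut n M) (Copy n M r) where
  smul_le g a b hab := h.smul g a b hab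
  trans x y := exists_smul_eq_of_mem (M := M) x y
  stab x := op_stabilizer (M := M) x
  infinite := hM.out.infinite
  rankOne := by
    rintro H ⟨B, hB, hBH⟩ E h1 h2
    have := hM.out.countable
    by_contra hinf
    refine h.rankOne ⟨E, ?_, h2, hinf⟩
    refine Set.Definable.mono (A := B) ?_ (Set.subset_univ B)
    exact definable₂_of_invariant hM.out.omegaCategorical hB fun g hg x hx => h1 g (hBH hg) _ _ hx

/-- There is an equivariant map from the order `r` to the completion of the order `s`. -/
abbrev Tw (n : ℕ) {M : Type*} [(lang n).Structure M] (r s : M → M → Prop)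
    [InvOrder n r] [InvOrder n s] : Prop :=
  Twin (aut n M) (Copy n M r) (Copy n M s)

variable [InvOrder n r] [InvOrder n s] [InvOrder n t]

/-- Complementation turns initial segments of `s` into initial segments of the reverse order. The
complement may have a last element, which is why twin maps do not forbid it. -/
lemma Tw.compl (h : Tw n (rev r) s) : Tw n r (rev s) := by
  obtain ⟨f, hf⟩ := h
  refine ⟨fun x => (f x)ᶜ, fun x y hxy => Set.compl_subset_compl.2 (hf.mono y x hxy),
    fun x y y' hy h1 h2 => h1 (hf.lower x hy h2), fun x => ?_, fun x h => ?_,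
    fun g x y => not_congr (hf.smul_mem g x y)⟩
  · exact (Set.ne_univ_iff_exists_notMem _).1 (hf.ne_univ x)
  · obtain ⟨y, hy⟩ := hf.nonempty x
    exact (Set.ext_iff.1 h y).2 trivial hy

lemma tw_rev_left : Tw n (rev r) s ↔ Tw n r (rev s) :=
  ⟨Tw.compl, fun h => (Tw.compl (r := s) (s := r) h.symm).symm⟩

lemma tw_rev_rev : Tw n (rev r) (rev s) ↔ Tw n r s := tw_rev_left (r := r) (s := rev s)

lemma Tw.not_rev (h : Tw n r s) : ¬ Tw n (rev r) s := by
  rintro ⟨f', hf'⟩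
  obtain ⟨f, hf⟩ := h
  let f₁ : Copy n M r → Set (Copy n M s) := f'
  exact hf.not_decreasing (h := f₁) (fun x y hxy => hf'.mono y x hxy) (fun x => hf'.lower x)
    (fun x => hf'.nonempty x) (fun x => hf'.ne_univ x) (fun g x y => hf'.smul_mem g x y)

end

/-! ### Definable maps and equivariant maps -/

section

variable {n : ℕ} {M : Type*} [(lang n).Structure M] {r s : M → M → Prop}
  [hM : Fact (IsRankOneMultiOrder n M)] [InvOrder n r] [InvOrder n s]

lemma smul_mem_fixing_empty (g : aut n M) : g ∈ fixing n (∅ : Set M) := mem_fixing.2 (by simp)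

/-- The map to the definable completion given by an equivariant map. -/
def IsNormal.toMap {f : Copy n M r → Set (Copy n M s)} (hf : IsNormal (aut n M) f) :
    whole M → Completion (lang n) (whole M) s := fun x =>
  ⟨f x.1, Set.subset_univ _, fun _ ha _ _ hba => hf.lower x.1 hba ha, hf.nonempty x.1,
    hf.ne_univ x.1, hf.noLast x.1, by
      have := hM.out.countable
      -- The value at `x` is invariant under the stabilizer of `x`, hence definable with `x` as the
      -- only parameter.
      refine Set.Definable.mono (A := {x.1}) ?_ (Set.subset_univ _)
      refine definable₁_of_invariant hM.out.omegaCategorical (Set.finite_singleton x.1) ?_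
      intro g hg y hy
      have h1 : g • x.1 = x.1 := mem_fixing.1 hg _ rfl
      have h2 := (hf.smul_mem g x.1 y).2 hy
      exact (Set.ext_iff.1 (congrArg f h1) _).1 h2⟩

lemma IsNormal.toMap_definable {f : Copy n M r → Set (Copy n M s)} (hf : IsNormal (aut n M) f) :
    IsDefinableMap ∅ hf.toMap := by
  have := hM.out.countable
  refine definable₂_of_invariant hM.out.omegaCategorical Set.finite_empty ?_
  rintro g - ⟨x, y⟩ ⟨_, hy⟩
  exact ⟨trivial, (hf.smul_mem g x y).2 hy⟩

lemma IsNormal.toMap_increasing {f : Copy n M r → Set (Copy n M s)} (hf : IsNormal (aut n M) f) :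
    Increasing r hf.toMap := fun a b hab => hf.strict (x := a.1) (y := b.1) hab

/-- A map to the definable completion, as a map between copies of the structure. -/
def ofMap (g : whole M → Completion (lang n) (whole M) s) : Copy n M r → Set (Copy n M s) :=
  fun x => (g ⟨x, trivial⟩).1

lemma isNormal_ofMap {g : whole M → Completion (lang n) (whole M) s} (hd : IsDefinableMap ∅ g)
    (hg : Nondecreasing r g) :
    IsNormal (aut n M) (ofMap g : Copy n M r → Set (Copy n M s)) where
  mono x y hxy := hg ⟨x, trivial⟩ ⟨y, trivial⟩ hxy
  lower x a b hba ha := (g ⟨x, trivial⟩).2.initial a ha b trivial hba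
  nonempty x := (g ⟨x, trivial⟩).2.nonempty
  ne_univ x := (g ⟨x, trivial⟩).2.ne_all
  smul_mem a x y := by
    have := smul_mem_of_definable₂ hd (smul_mem_fixing_empty a) x y
    exact ⟨fun h => (this.1 ⟨trivial, h⟩).2, fun h => (this.2 ⟨trivial, h⟩).2⟩
  noLast x := (g ⟨x, trivial⟩).2.no_last

lemma IsNormal.toMap_unique {f : Copy n M r → Set (Copy n M s)} (hf : IsNormal (aut n M) f)
    (g : whole M → Completion (lang n) (whole M) s) (hd : IsDefinableMap ∅ g)
    (hg : Nondecreasing r g) : g = hf.toMap := by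
  have h := (isNormal_ofMap hd hg).unique hf
  funext x
  exact Subtype.ext (congrFun h x.1)

variable (n r s) in
lemma intertwined_iff :
    Intertwined (lang n) ∅ (whole M) r (whole M) s ↔ Tw n r s := by
  constructor
  · rintro ⟨g, hd, hg⟩
    exact ⟨_, (isNormal_ofMap hd hg).toIsTwinMap⟩
  · rintro ⟨f, hf⟩
    obtain ⟨f', hf'⟩ := hf.exists_normal
    exact ⟨hf'.toMap, hf'.toMap_definable, fun a b hab => hf'.mono a.1 b.1 hab⟩

/-! ### Independence -/

/-- Parameters and smaller sets create no new intertwining. The definitions of `X`, `Y` and the map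
use a finite part of `B`; the map extends to an invariant monotone map on all of `M` with infinitely
many values, so it contains a leaf, and leaves extend to equivariant maps. -/
lemma exists_tw_of_intertwined {B X Y : Set M} (hX : X.Nonempty)
    (hBX : B.Definable₁ (lang n) X) (hBY : B.Definable₁ (lang n) Y)
    (hlast : ∀ a ∈ Y, ∃ b ∈ Y, lt s a b)
    (hdense : ∀ D : Set M, D ⊆ Y → B.Definable₁ (lang n) D → D.Nonempty →
      ∀ a ∈ Y, ∀ b ∈ Y, lt s a b → ∃ d ∈ D, lt s a d ∧ lt s d b)
    (h : Intertwined (lang n) B X r Y s) : Tw n r s := by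
  obtain ⟨f, hfd, hf⟩ := h
  have := hM.out.countable
  obtain ⟨B₁, h1, hB₁, hX'⟩ := exists_finite_definable₁ hBX
  obtain ⟨B₂, h2, hB₂, hY'⟩ := exists_finite_definable₁ hBY
  obtain ⟨B₃, h3, hB₃, hf'⟩ := exists_finite_definable₂ hfd
  let C : Set M := B₁ ∪ B₂ ∪ B₃
  have hC : C.Finite := (hB₁.union hB₂).union hB₃
  have hCB : C ⊆ B := Set.union_subset (Set.union_subset h1 h2) h3
  have hXC : ∀ g ∈ fixing n C, ∀ x, g • x ∈ X ↔ x ∈ X := fun g hg x =>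
    smul_mem_of_definable₁ (hX'.mono (Set.subset_union_left.trans Set.subset_union_left)) hg x
  have hYC : ∀ g ∈ fixing n C, ∀ x, g • x ∈ Y ↔ x ∈ Y := fun g hg x =>
    smul_mem_of_definable₁ (hY'.mono (Set.subset_union_right.trans Set.subset_union_left)) hg x
  let R : Set (M × M) := {p | ∃ h : p.1 ∈ X, p.2 ∈ (f ⟨p.1, h⟩ : Set M)}
  have hRC : ∀ g ∈ fixing n C, ∀ x y, (g • x, g • y) ∈ R ↔ (x, y) ∈ R := fun g hg x y =>
    smul_mem_of_definable₂ (hf'.mono Set.subset_union_right) hg x y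
  -- The extension to `M`: the lower set generated by the values at points of `X` up to `m`.
  let F : Copy n M r → Set (Copy n M s) := fun m =>
    {y : M | ∃ x ∈ X, r x m ∧ ∃ z, (x, z) ∈ R ∧ s y z}
  have hr : IsLinearOrder M r := InvOrder.linear n
  have hs : IsLinearOrder M s := InvOrder.linear n
  have hF : MonoMap (fixing n C) F :=
    { mono := by
        rintro m m' hm y ⟨x, hx, hxm, z, hz⟩
        exact ⟨x, hx, hr.trans _ _ _ hxm hm, z, hz⟩
      lower := by
        rintro m y y' hy ⟨x, hx, hxm, z, hz, hyz⟩
        exact ⟨x, hx, hxm, z, hz, hs.trans _ _ _ hy hyz⟩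
      noLast := by
        rintro m y ⟨x, hx, hxm, z, ⟨hx', hz⟩, hyz⟩
        obtain ⟨w, hw, hzw⟩ := (f ⟨x, hx'⟩).2.no_last z hz
        refine ⟨w, ⟨x, hx, hxm, w, ⟨hx', hw⟩, hs.refl w⟩, hs.trans _ _ _ hyz hzw.1, ?_⟩
        rintro rfl
        exact hzw.2 (hs.antisymm _ _ hzw.1 hyz)
      smul_mem := by
        have key : ∀ g ∈ fixing n C, ∀ m y, y ∈ F m → g • y ∈ F (g • m) := by
          rintro g hg m y ⟨x, hx, hxm, z, hz, hyz⟩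
          exact ⟨g • x, (hXC g hg x).2 hx, InvOrder.smul g _ _ hxm, g • z, (hRC g hg x z).2 hz,
            InvOrder.smul g _ _ hyz⟩
        refine fun g hg m y => ⟨fun h => ?_, key g hg m y⟩
        have := key g⁻¹ (inv_mem hg) _ _ h
        rwa [inv_smul_smul, inv_smul_smul] at this }
  -- With finitely many values there would be a least cut. It is a nonempty `B`-definable subset of
  -- `Y` with nothing above a point `y` of `Y` outside it, so it is not dense in `Y`.
  have hinf : (Set.range F).Infinite := by
    intro hfin
    have hval : ∀ x : X, (f x : Set M) = F x.1 ∩ Y := by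
      rintro ⟨x, hx⟩
      ext y
      constructor
      · exact fun hy => ⟨⟨x, hx, hr.refl x, y, ⟨hx, hy⟩, hs.refl y⟩, (f ⟨x, hx⟩).2.subset hy⟩
      · rintro ⟨⟨x', hx', hxx, z, ⟨hx'', hz⟩, hyz⟩, hy⟩
        exact hf ⟨x', hx'⟩ ⟨x, hx⟩ hxx ((f ⟨x', hx'⟩).2.initial z hz y hy hyz)
    let V : Set (Set M) := Set.range fun x : X => (f x : Set M)
    have hVfin : V.Finite := by
      refine (hfin.image fun v : Set M => v ∩ Y).subset ?_
      rintro _ ⟨x, rfl⟩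
      exact ⟨F x.1, ⟨x.1, rfl⟩, (hval x).symm⟩
    have hmem : ⋂₀ V ∈ V := by
      obtain ⟨x, hx⟩ := hX
      refine sInter_mem_of_chain hVfin ⟨_, ⟨x, hx⟩, rfl⟩ ?_
      rintro _ ⟨a, rfl⟩ _ ⟨b, rfl⟩
      rcases hr.total a b with h | h
      · exact Or.inl (hf a b h)
      · exact Or.inr (hf b a h)
    have hdef : B.Definable₁ (lang n) (⋂₀ V) := by
      refine Set.Definable.mono (A := C) ?_ hCB
      refine definable₁_of_invariant hM.out.omegaCategorical hC fun g hg y hy => ?_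
      rintro _ ⟨⟨x, hx⟩, rfl⟩
      have hgx : g⁻¹ • x ∈ X := (hXC g⁻¹ (inv_mem hg) x).2 hx
      have hy' : (g⁻¹ • x, y) ∈ R := ⟨hgx, hy _ ⟨⟨g⁻¹ • x, hgx⟩, rfl⟩⟩
      have := (hRC g hg _ _).2 hy'
      rw [smul_inv_smul] at this
      exact this.2
    obtain ⟨x, hx⟩ := hmem
    have hcut := (f x).2
    rw [show (f x : Set M) = ⋂₀ V from hx] at hcut
    obtain ⟨y, hy, hyn⟩ : ∃ y ∈ Y, y ∉ ⋂₀ V := by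
      by_contra! hall
      exact hcut.ne_all (subset_antisymm hcut.subset hall)
    obtain ⟨b, hb, hyb⟩ := hlast y hy
    obtain ⟨d, hd, hyd, -⟩ := hdense _ hcut.subset hdef hcut.nonempty y hy b hb hyb
    exact hyn (hcut.initial d hd y hy hyd.1)
  obtain ⟨I, hI⟩ := hF.exists_leaf (⟨C, hC, le_rfl⟩ : Op (fixing n C)) hinf
  exact hI.twin

variable (n r) in
lemma weaklyTransitive_whole : WeaklyTransitive (lang n) ∅ (whole M) r := by
  have := Tame.noMinOrder (aut n M) (Copy n M r)
  have := Tame.noMaxOrder (aut n M) (Copy n M r)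
  have := Tame.denselyOrdered (aut n M) (Copy n M r)
  refine ⟨fun a _ b _ hab => ?_, fun a _ => ?_, fun a _ => ?_, fun D _ hD hne a _ b _ hab => ?_⟩
  · obtain ⟨c, hc⟩ := exists_between (α := Copy n M r) (a₁ := a) (a₂ := b) hab
    exact ⟨c, trivial, hc⟩
  · obtain ⟨c, hc⟩ := exists_lt (α := Copy n M r) a
    exact ⟨c, trivial, hc⟩
  · obtain ⟨c, hc⟩ := exists_gt (α := Copy n M r) a
    exact ⟨c, trivial, hc⟩
  · let D' : Set (Copy n M r) := D
    have huniv : D' = Set.univ := eq_univ_of_invariant (S := D') (aut n M)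
      (fun g x hx => (smul_mem_of_definable₁ hD (smul_mem_fixing_empty g) x).2 hx) hne
    obtain ⟨c, hc⟩ := exists_between (α := Copy n M r) (a₁ := a) (a₂ := b) hab
    exact ⟨c, (Set.ext_iff.1 huniv c).2 trivial, hc⟩

variable (n r s) in
-- An equivariant map violates independence with `B = ∅` and `X = Y = M`, since `M` is weakly
-- transitive over `∅` for each order. The converse is the reduction of local intertwinings to
-- equivariant maps.
lemma independent_iff :
    Independent (lang n) (whole M) r (whole M) s ↔ ¬ Tw n r s ∧ ¬ Tw n r (rev s) := by
  constructor
  · intro h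
    have hdef : (∅ : Set M).Definable₁ (lang n) Set.univ := Set.definable_univ
    have hinf : (Set.univ : Set M).Infinite := Set.infinite_univ_iff.2 hM.out.infinite
    have hw := weaklyTransitive_whole n (M := M)
    exact ⟨fun ht => h ⟨∅, Set.univ, Set.univ, subset_rfl, subset_rfl, hinf, hinf, hdef, hdef,
        hw r, hw s, Or.inl ((intertwined_iff n r s).2 ht)⟩,
      fun ht => h ⟨∅, Set.univ, Set.univ, subset_rfl, subset_rfl, hinf, hinf, hdef, hdef,
        hw r, hw s, Or.inr ((intertwined_iff n r (rev s)).2 ht)⟩⟩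
  · rintro ⟨h1, h2⟩ ⟨B, X, Y, -, -, hX, -, hBX, hBY, -, hY, h | h⟩
    · exact h1 (exists_tw_of_intertwined hX.nonempty hBX hBY hY.2.2.1 hY.2.2.2 h)
    · have hne : ∀ a b, lt (rev s) a b ↔ lt s b a := fun a b =>
        ⟨fun h => ⟨h.1, h.2.symm⟩, fun h => ⟨h.1, h.2.symm⟩⟩
      refine h2 (exists_tw_of_intertwined hX.nonempty hBX hBY ?_ ?_ h)
      · intro a ha
        obtain ⟨b, hb, hab⟩ := hY.2.1 a ha
        exact ⟨b, hb, (hne _ _).2 hab⟩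
      · intro D hD hdef hDne a ha b hb hab
        obtain ⟨d, hd, h1, h2⟩ := hY.2.2.2 D hD hdef hDne b hb a ha ((hne _ _).1 hab)
        exact ⟨d, hd, (hne _ _).2 h2, (hne _ _).2 h1⟩

end

/-! ### The five cases -/

section

variable {n : ℕ} {M : Type*} [(lang n).Structure M] {r s : M → M → Prop}
  [hM : Fact (IsRankOneMultiOrder n M)] [InvOrder n r] [InvOrder n s]

/-- The uniqueness clause costs nothing, since normal equivariant maps are unique. -/
lemma exists_unique_map_iff (p : M → Set M → Prop) :
    (∃ f : whole M → Completion (lang n) (whole M) s, (IsDefinableMap ∅ f ∧ Increasing r f ∧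
      ∀ g : whole M → Completion (lang n) (whole M) s,
        IsDefinableMap ∅ g → Nondecreasing r g → g = f) ∧ ∀ x : whole M, p x (f x)) ↔
    ∃ f : Copy n M r → Set (Copy n M s), IsNormal (aut n M) f ∧ ∀ x : M, p x (f x) := by
  constructor
  · rintro ⟨f, ⟨h1, h2, -⟩, h3⟩
    refine ⟨ofMap f, isNormal_ofMap h1 fun a b hab => ?_, fun x => h3 ⟨x, trivial⟩⟩
    by_cases h : a = b
    · rw [h]
    · exact (h2 a b ⟨hab, fun he => h (Subtype.ext he)⟩).le
  · rintro ⟨f, hf, h⟩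
    exact ⟨hf.toMap, ⟨hf.toMap_definable, hf.toMap_increasing, hf.toMap_unique⟩, fun x => h x⟩

variable (M) in
/-- The equivariant map from `≤_i` or its reverse to `≤_j` has values below the argument. -/
def TwinBelow (σ : Bool) (i j : Fin n) : Prop :=
  ∃ f : Copy n M (sgn σ (leAt M i)) → Set (Copy n M (leAt M j)),
    IsNormal (aut n M) f ∧ ∀ x : M, f x ⊂ pointCut M j x

variable (M) in
/-- The equivariant map from `≤_i` or its reverse to `≤_j` has values above the argument. -/
def TwinAbove (σ : Bool) (i j : Fin n) : Prop :=
  ∃ f : Copy n M (sgn σ (leAt M i)) → Set (Copy n M (leAt M j)),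
    IsNormal (aut n M) f ∧ ∀ x : M, pointCut M j x ⊂ f x

lemma TwinBelow.tw {σ : Bool} {i j : Fin n} (h : TwinBelow M σ i j) :
    Tw n (sgn σ (leAt M i)) (leAt M j) := by
  obtain ⟨f, hf, -⟩ := h
  exact ⟨f, hf.toIsTwinMap⟩

lemma TwinAbove.tw {σ : Bool} {i j : Fin n} (h : TwinAbove M σ i j) :
    Tw n (sgn σ (leAt M i)) (leAt M j) := by
  obtain ⟨f, hf, -⟩ := h
  exact ⟨f, hf.toIsTwinMap⟩

lemma TwinBelow.not_above {σ : Bool} {i j : Fin n} (h : TwinBelow M σ i j) :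
    ¬ TwinAbove M σ i j := by
  rintro ⟨f, hf, h1⟩
  obtain ⟨f', hf', h2⟩ := h
  obtain ⟨x⟩ : Nonempty M := hM.out.infinite.nonempty
  rw [hf.unique hf'] at h1
  exact ((h2 x).trans (h1 x)).ne rfl

lemma eq_of_forall_imp (h : IsLinearOrder M r) (h' : IsLinearOrder M s) (hrs : ∀ a b, r a b → s a b) : r = s := by
  funext a b
  refine propext ⟨hrs a b, fun hab => ?_⟩
  rcases h.total a b with h1 | h1
  · exact h1
  · rw [h'.antisymm _ _ hab (hrs _ _ h1)]
    exact h.refl b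

lemma sgn_leAt_ne {i j : Fin n} (hij : i ≠ j) (σ : Bool) : sgn σ (leAt M i) ≠ leAt M j := by
  cases σ
  · intro h
    refine hM.out.ne_rev i j hij ?_
    rw [← h]
    rfl
  · exact hM.out.ne i j hij

lemma smul_Iio (g : aut n M) (x y : Copy n M r) : g • y ∈ Set.Iio (g • x) ↔ y ∈ Set.Iio x :=
  smul_lt_iff (a := y) (b := x) g

/-- By transitivity the comparison of `f x` with the cut of `x` has the same outcome for all `x`.
Equality would make `f` the identity embedding and force the two orders to agree. -/
lemma twinBelow_or_above {i j : Fin n} (hij : i ≠ j) {σ : Bool}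
    (h : Tw n (sgn σ (leAt M i)) (leAt M j)) : TwinBelow M σ i j ∨ TwinAbove M σ i j := by
  obtain ⟨f₀, hf₀⟩ := h
  obtain ⟨f, hf⟩ := hf₀.exists_normal
  let c : M → Set (Copy n M (leAt M j)) := fun x => Set.Iio x
  have hc : ∀ x, IsLowerSet (c x) := fun x => isLowerSet_Iio _
  have hsub : ∀ (g : aut n M) (x : M), f (g • x) ⊆ c (g • x) ↔ f x ⊆ c x := by
    intro g x
    have key : ∀ (g : aut n M) (x : M), f x ⊆ c x → f (g • x) ⊆ c (g • x) := by
      intro g x hx y hy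
      have h1 : g • g⁻¹ • y = y := smul_inv_smul g y
      rw [← h1] at hy ⊢
      exact (smul_Iio g (r := leAt M j) x (g⁻¹ • y)).2 (hx ((hf.smul_mem g x _).1 hy))
    refine ⟨fun h => ?_, key g x⟩
    have := key g⁻¹ _ h
    rwa [inv_smul_smul] at this
  have hne : ∀ x : M, f x ≠ c x := by
    intro x₀ h0
    have hall : ∀ x : M, f x = c x := by
      intro x
      obtain ⟨g, rfl⟩ := exists_smul_eq_of_mem (n := n) x₀ x
      ext y
      have h1 : g • g⁻¹ • y = y := smul_inv_smul g y
      rw [← h1]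
      refine (hf.smul_mem g x₀ _).trans ?_
      rw [h0]
      exact (smul_Iio g (r := leAt M j) x₀ (g⁻¹ • y)).symm
    refine sgn_leAt_ne (M := M) hij σ (eq_of_forall_imp (InvOrder.linear n)
      (InvOrder.linear n) fun a b hab => ?_)
    by_contra hcon
    have hba : b ∈ c a := lt_of_not_ge (α := Copy n M (leAt M j)) hcon
    rw [← hall] at hba
    have := hf.mono a b hab hba
    rw [hall] at this
    exact lt_irrefl (α := Copy n M (leAt M j)) b this
  obtain ⟨x₀⟩ : Nonempty M := hM.out.infinite.nonempty
  by_cases h0 : f x₀ ⊆ c x₀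
  · refine Or.inl ⟨f, hf, fun x => Set.ssubset_iff_subset_ne.2 ⟨?_, hne x⟩⟩
    obtain ⟨g, rfl⟩ := exists_smul_eq_of_mem (n := n) x₀ x
    exact (hsub g x₀).2 h0
  · refine Or.inr ⟨f, hf, fun x => Set.ssubset_iff_subset_ne.2 ⟨?_, (hne x).symm⟩⟩
    refine ((hf.lower x).total (hc x)).resolve_left ?_
    obtain ⟨g, rfl⟩ := exists_smul_eq_of_mem (n := n) x₀ x
    exact fun h => h0 ((hsub g x₀).1 h)

variable (M) in
lemma holds_independent (i j : Fin n) : PairCase.Holds M i j .independent ↔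
    ∀ σ, ¬ Tw n (sgn σ (leAt M i)) (leAt M j) := by
  rw [Bool.forall_bool, and_comm]
  exact (independent_iff n _ _).trans (and_congr_right fun _ => not_congr tw_rev_left.symm)

variable (M) in
lemma holds_increasingBelow (i j : Fin n) :
    PairCase.Holds M i j .increasingBelow ↔ TwinBelow M true i j := by
  have := exists_unique_map_iff (n := n) (r := leAt M i) (s := leAt M j)
    (fun x v => v ⊂ pointCut M j x)
  refine ⟨fun h => this.1 h.2, fun h => ⟨(intertwined_iff n _ _).2 h.tw, this.2 h⟩⟩

variable (M) in
lemma holds_increasingAbove (i j : Fin n) :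
    PairCase.Holds M i j .increasingAbove ↔ TwinAbove M true i j := by
  have := exists_unique_map_iff (n := n) (r := leAt M i) (s := leAt M j)
    (fun x v => pointCut M j x ⊂ v)
  refine ⟨fun h => this.1 h.2, fun h => ⟨(intertwined_iff n _ _).2 h.tw, this.2 h⟩⟩

variable (M) in
lemma holds_decreasingBelow (i j : Fin n) :
    PairCase.Holds M i j .decreasingBelow ↔ TwinBelow M false i j := by
  have := exists_unique_map_iff (n := n) (r := rev (leAt M i)) (s := leAt M j)
    (fun x v => v ⊂ pointCut M j x)
  refine ⟨fun h => this.1 h.2, fun h => ⟨(intertwined_iff n _ _).2 (tw_rev_left.1 h.tw), this.2 h⟩⟩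

variable (M) in
lemma holds_decreasingAbove (i j : Fin n) :
    PairCase.Holds M i j .decreasingAbove ↔ TwinAbove M false i j := by
  have := exists_unique_map_iff (n := n) (r := rev (leAt M i)) (s := leAt M j)
    (fun x v => pointCut M j x ⊂ v)
  refine ⟨fun h => this.1 h.2, fun h => ⟨(intertwined_iff n _ _).2 (tw_rev_left.1 h.tw), this.2 h⟩⟩

lemma not_tw_both (i j : Fin n) (h : Tw n (sgn true (leAt M i)) (leAt M j)) :
    ¬ Tw n (sgn false (leAt M i)) (leAt M j) := Tw.not_rev (r := leAt M i) h

variable (M) in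
theorem existsUnique_holds {i j : Fin n} (hij : i ≠ j) :
    ∃! c : PairCase, PairCase.Holds M i j c := by
  have huniq : ∀ c c', PairCase.Holds M i j c → PairCase.Holds M i j c' → c = c' := by
    intro c c' h h'
    have e1 := not_tw_both (M := M) i j
    have e2 := fun σ => TwinBelow.not_above (M := M) (σ := σ) (i := i) (j := j)
    have e3 := fun σ => TwinBelow.tw (M := M) (σ := σ) (i := i) (j := j)
    have e4 := fun σ => TwinAbove.tw (M := M) (σ := σ) (i := i) (j := j)
    cases c <;> cases c' <;> first | rfl | (
      simp only [holds_independent, holds_increasingBelow, holds_increasingAbove,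
        holds_decreasingBelow, holds_decreasingAbove] at h h'
      first
      | exact absurd (e3 _ h') (h _)
      | exact absurd (e4 _ h') (h _)
      | exact absurd (e3 _ h) (h' _)
      | exact absurd (e4 _ h) (h' _)
      | exact absurd h' (e2 _ h)
      | exact absurd h (e2 _ h')
      | exact absurd (e3 _ h') (e1 (e3 _ h))
      | exact absurd (e4 _ h') (e1 (e3 _ h))
      | exact absurd (e3 _ h') (e1 (e4 _ h))
      | exact absurd (e4 _ h') (e1 (e4 _ h))
      | exact absurd (e3 _ h) (e1 (e3 _ h'))
      | exact absurd (e4 _ h) (e1 (e3 _ h'))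
      | exact absurd (e3 _ h) (e1 (e4 _ h'))
      | exact absurd (e4 _ h) (e1 (e4 _ h')))
  have hex : ∃ c, PairCase.Holds M i j c := by
    by_cases h : ∀ σ, ¬ Tw n (sgn σ (leAt M i)) (leAt M j)
    · exact ⟨_, (holds_independent M i j).2 h⟩
    · push Not at h
      obtain ⟨σ, h⟩ := h
      rcases twinBelow_or_above hij h with h | h <;> cases σ
      · exact ⟨_, (holds_decreasingBelow M i j).2 h⟩
      · exact ⟨_, (holds_increasingBelow M i j).2 h⟩
      · exact ⟨_, (holds_decreasingAbove M i j).2 h⟩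
      · exact ⟨_, (holds_increasingAbove M i j).2 h⟩
  obtain ⟨c, hc⟩ := hex
  exact ⟨c, hc, fun c' hc' => huniq c' c hc' hc⟩

end

/-! ### Systems of maps into chains -/

/-- Each element of `M` is sent by each `V i` to a chain that depends only on the class of `i`; the
images are dense in the chain and disjoint, and all boxes compatible with the relation between the
maps contain an element of `M`. -/
structure ChainSystem {ι κ M : Type*} (cls : ι → κ) (tri : ι → ι → Prop) (V : ι → M → Set M) :
    Prop where
  chain : ∀ {i j}, cls i = cls j → ∀ x y, V i x ⊆ V j y ∨ V j y ⊆ V i x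
  inj : ∀ {i j}, cls i = cls j → ∀ x y, V i x = V j y → i = j ∧ x = y
  dense : ∀ {i j}, cls i = cls j → ∀ k, cls k = cls i → ∀ x y, V i x ⊂ V j y →
    ∃ z, V i x ⊂ V k z ∧ V k z ⊂ V j y
  exists_lt : ∀ {i j}, cls i = cls j → ∀ y, ∃ z, V i z ⊂ V j y
  exists_gt : ∀ {i j}, cls i = cls j → ∀ y, ∃ z, V j y ⊂ V i z
  tri_cls : ∀ {i j}, tri i j → cls i = cls j
  tri_total : ∀ {i j}, cls i = cls j → i ≠ j → tri i j ∨ tri j i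
  ssubset_of_tri : ∀ {i j}, tri i j → ∀ x, V i x ⊂ V j x
  box : ∀ c d : ι → M, (∀ i, V i (c i) ⊂ V i (d i)) →
    (∀ i j, tri i j → V i (d i) ⊂ V j (c j)) → ∃ y, ∀ i, V i (c i) ⊂ V i y ∧ V i y ⊂ V i (d i)

section

variable {ι κ M : Type*} {cls : ι → κ} {tri : ι → ι → Prop} {V : ι → M → Set M}

/-- Finite sets of members of a chain, one below the other, are separated by an element. -/
lemma exists_between_of_chain {k : ι} {A B : Set (Set M)} (hA : A.Finite) (hB : B.Finite)
    (hne : Nonempty M)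
    (chainA : ∀ a ∈ A, ∀ b ∈ A, a ⊆ b ∨ b ⊆ a) (chainB : ∀ a ∈ B, ∀ b ∈ B, a ⊆ b ∨ b ⊆ a)
    (dense : ∀ a ∈ A, ∀ b ∈ B, ∃ z, a ⊂ V k z ∧ V k z ⊂ b)
    (hgt : ∀ a ∈ A, ∃ z, a ⊂ V k z) (hlt : ∀ b ∈ B, ∃ z, V k z ⊂ b) :
    ∃ z, (∀ a ∈ A, a ⊂ V k z) ∧ ∀ b ∈ B, V k z ⊂ b := by
  have hmax : A.Nonempty → ∃ a ∈ A, ∀ a' ∈ A, a' ⊆ a := fun h => by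
    obtain ⟨a, ha⟩ := hA.exists_maximal h
    exact ⟨a, ha.1, fun a' ha' => (chainA a' ha' a ha.1).elim id fun h => ha.2 ha' h⟩
  have hmin : B.Nonempty → ∃ b ∈ B, ∀ b' ∈ B, b ⊆ b' := fun h => by
    obtain ⟨b, hb⟩ := hB.exists_minimal h
    exact ⟨b, hb.1, fun b' hb' => (chainB b hb.1 b' hb').elim id fun h => hb.2 hb' h⟩
  rcases A.eq_empty_or_nonempty with rfl | hAn <;> rcases B.eq_empty_or_nonempty with rfl | hBn
  · obtain ⟨z⟩ := hne
    exact ⟨z, by simp, by simp⟩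
  · obtain ⟨b, hb, hb'⟩ := hmin hBn
    obtain ⟨z, hz⟩ := hlt b hb
    exact ⟨z, by simp, fun b' h => hz.trans_subset (hb' b' h)⟩
  · obtain ⟨a, ha, ha'⟩ := hmax hAn
    obtain ⟨z, hz⟩ := hgt a ha
    exact ⟨z, fun a' h => (ha' a' h).trans_ssubset hz, by simp⟩
  · obtain ⟨a, ha, ha'⟩ := hmax hAn
    obtain ⟨b, hb, hb'⟩ := hmin hBn
    obtain ⟨z, hz, hz'⟩ := dense a ha b hb
    exact ⟨z, fun a' h => (ha' a' h).trans_ssubset hz, fun b' h => hz'.trans_subset (hb' b' h)⟩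

/-- The values of the maps in the class of `k`. -/
def valuesOf (cls : ι → κ) (V : ι → M → Set M) (k : ι) : Set (Set M) :=
  {v | ∃ i x, cls i = cls k ∧ V i x = v}

/-- The part of `ChainSystem` that does not speak about boxes. -/
structure PreChainSystem {ι κ M : Type*} (cls : ι → κ) (V : ι → M → Set M) : Prop where
  chain : ∀ {i j}, cls i = cls j → ∀ x y, V i x ⊆ V j y ∨ V j y ⊆ V i x
  dense : ∀ {i j}, cls i = cls j → ∀ k, cls k = cls i → ∀ x y, V i x ⊂ V j y →
    ∃ z, V i x ⊂ V k z ∧ V k z ⊂ V j y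
  exists_lt : ∀ {i j}, cls i = cls j → ∀ y, ∃ z, V i z ⊂ V j y
  exists_gt : ∀ {i j}, cls i = cls j → ∀ y, ∃ z, V j y ⊂ V i z

lemma ChainSystem.pre (h : ChainSystem cls tri V) : PreChainSystem cls V :=
  ⟨h.chain, h.dense, h.exists_lt, h.exists_gt⟩

lemma PreChainSystem.exists_between (h : PreChainSystem cls V) [Nonempty M] {k : ι}
    {A B : Set (Set M)} (hA : A.Finite) (hB : B.Finite) (hAV : A ⊆ valuesOf cls V k)
    (hBV : B ⊆ valuesOf cls V k) (hAB : ∀ a ∈ A, ∀ b ∈ B, a ⊂ b) :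
    ∃ z, (∀ a ∈ A, a ⊂ V k z) ∧ ∀ b ∈ B, V k z ⊂ b := by
  have hch : ∀ a ∈ valuesOf cls V k, ∀ b ∈ valuesOf cls V k, a ⊆ b ∨ b ⊆ a := by
    rintro _ ⟨i, x, hi, rfl⟩ _ ⟨j, y, hj, rfl⟩
    exact h.chain (hi.trans hj.symm) x y
  refine exists_between_of_chain hA hB inferInstance (fun a ha b hb => hch a (hAV ha) b (hAV hb))
    (fun a ha b hb => hch a (hBV ha) b (hBV hb)) (fun a ha b hb => ?_) (fun a ha => ?_)
    (fun b hb => ?_)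
  · have hlt := hAB a ha b hb
    obtain ⟨i, x, hi, rfl⟩ := hAV ha
    obtain ⟨j, y, hj, rfl⟩ := hBV hb
    exact h.dense (hi.trans hj.symm) k hi.symm x y hlt
  · obtain ⟨i, x, hi, rfl⟩ := hAV ha
    exact h.exists_gt hi.symm x
  · obtain ⟨i, x, hi, rfl⟩ := hBV hb
    exact h.exists_lt hi.symm x

variable [Fintype ι]

lemma ChainSystem.tri_iff (h : ChainSystem cls tri V) {i j : ι} (x : M) :
    tri i j ↔ cls i = cls j ∧ V i x ⊂ V j x := by
  refine ⟨fun ht => ⟨h.tri_cls ht, h.ssubset_of_tri ht x⟩, fun ⟨hc, hs⟩ => ?_⟩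
  by_cases hij : i = j
  · subst hij; exact (hs.ne rfl).elim
  · exact (h.tri_total hc hij).resolve_right fun ht => (hs.trans (h.ssubset_of_tri ht x)).ne rfl

open Classical in
/-- The number of predecessors. -/
noncomputable def rank (tri : ι → ι → Prop) (i : ι) : ℕ := (Finset.univ.filter fun k => tri k i).card

lemma rank_lt (htr : ∀ i j k, tri i j → tri j k → tri i k) (hir : ∀ i, ¬ tri i i) {i j : ι}
    (hij : tri i j) : rank tri i < rank tri j := by
  classical
  refine Finset.card_lt_card ?_
  rw [Finset.ssubset_iff_of_subset]
  · exact ⟨i, by simpa using hij, by simpa using hir i⟩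
  · intro k hk
    simp only [Finset.mem_filter, Finset.mem_univ, true_and] at hk ⊢
    exact htr k i j hk hij

lemma ChainSystem.tri_trans [Nonempty M] (h : ChainSystem cls tri V) (i j k : ι) (hij : tri i j)
    (hjk : tri j k) : tri i k := by
  obtain ⟨x⟩ := ‹Nonempty M›
  exact (h.tri_iff x).2 ⟨(h.tri_cls hij).trans (h.tri_cls hjk),
    (h.ssubset_of_tri hij x).trans (h.ssubset_of_tri hjk x)⟩

lemma ChainSystem.tri_irrefl [Nonempty M] (h : ChainSystem cls tri V) (i : ι) : ¬ tri i i :=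
  fun hi => by
    obtain ⟨x⟩ := ‹Nonempty M›
    exact (h.ssubset_of_tri hi x).ne rfl

/-- Interpolation: elements with prescribed position in all chains exist as soon as the
prescriptions are consistent. -/
lemma ChainSystem.exists_interpolation [Nonempty M] (h : ChainSystem cls tri V)
    (A B : ι → Set (Set M)) (hA : ∀ i, (A i).Finite) (hB : ∀ i, (B i).Finite)
    (hAV : ∀ i, A i ⊆ valuesOf cls V i) (hBV : ∀ i, B i ⊆ valuesOf cls V i)
    (hAB : ∀ i, ∀ a ∈ A i, ∀ b ∈ B i, a ⊂ b)
    (hAB' : ∀ i j, tri i j → ∀ a ∈ A i, ∀ b ∈ B j, a ⊂ b) :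
    ∃ y, ∀ i, (∀ a ∈ A i, a ⊂ V i y) ∧ ∀ b ∈ B i, V i y ⊂ b := by
  classical
  have hrank := fun {i j} => rank_lt (tri := tri) (h.tri_trans) (h.tri_irrefl) (i := i) (j := j)
  have hcd : ∀ s : Finset ι, ∃ c d : ι → M, (∀ i ∈ s, (∀ a ∈ A i, a ⊂ V i (c i)) ∧
      V i (c i) ⊂ V i (d i) ∧ (∀ b ∈ B i, V i (d i) ⊂ b) ∧
      (∀ j, tri i j → ∀ b ∈ B j, V i (d i) ⊂ b)) ∧
      ∀ i ∈ s, ∀ j ∈ s, tri i j → V i (d i) ⊂ V j (c j) := by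
    intro s
    -- The sides of the box are chosen in the order of increasing rank, so that no index already
    -- treated lies above the new one.
    induction s using Finset.induction_on_max_value (rank tri) with
    | empty =>
      obtain ⟨x⟩ := ‹Nonempty M›
      exact ⟨fun _ => x, fun _ => x, by simp, by simp⟩
    | insert i s his hmax ih =>
      obtain ⟨c, d, h1, h2⟩ := ih
      -- The new interval must lie above the intervals chosen for smaller indices, and below all
      -- upper bounds prescribed for larger ones so that these can still be satisfied.
      let A' : Set (Set M) := A i ∪ (fun k => V k (d k)) '' {k | k ∈ s ∧ tri k i}
      let B' : Set (Set M) := B i ∪ ⋃ j ∈ {j | tri i j}, B j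
      have hA' : A'.Finite := (hA i).union (Set.Finite.image _ (Set.toFinite _))
      have hB' : B'.Finite := (hB i).union ((Set.toFinite _).biUnion fun j _ => hB j)
      have hAV' : A' ⊆ valuesOf cls V i := by
        rintro a (ha | ⟨k, hk, rfl⟩)
        · exact hAV i ha
        · exact ⟨k, d k, h.tri_cls hk.2, rfl⟩
      have hBV' : B' ⊆ valuesOf cls V i := by
        rintro b (hb | hb)
        · exact hBV i hb
        · obtain ⟨j, hj, hb⟩ := Set.mem_iUnion₂.1 hb
          obtain ⟨k, x, hk, rfl⟩ := hBV j hb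
          exact ⟨k, x, hk.trans (h.tri_cls hj).symm, rfl⟩
      obtain ⟨z, hz, hz'⟩ := h.pre.exists_between hA' hB' hAV' hBV' (by
        rintro a (ha | ⟨k, hk, rfl⟩) b (hb | hb)
        · exact hAB i a ha b hb
        · obtain ⟨j, hj, hb⟩ := Set.mem_iUnion₂.1 hb
          exact hAB' i j hj a ha b hb
        · exact (h1 k hk.1).2.2.2 i hk.2 b hb
        · obtain ⟨j, hj, hb⟩ := Set.mem_iUnion₂.1 hb
          exact (h1 k hk.1).2.2.2 j (h.tri_trans k i j hk.2 hj) b hb)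
      obtain ⟨w, hw, hw'⟩ := h.pre.exists_between (A := {V i z}) (Set.finite_singleton _) hB'
        (by rintro _ rfl; exact ⟨i, z, rfl, rfl⟩) hBV' (by rintro _ rfl b hb; exact hz' b hb)
      have hne : ∀ k ∈ s, k ≠ i := fun k hk h => his (h ▸ hk)
      refine ⟨Function.update c i z, Function.update d i w, fun k hk => ?_, fun k hk j hj hkj => ?_⟩
      · rcases Finset.mem_insert.1 hk with rfl | hk
        · simp only [Function.update_self]
          exact ⟨fun a ha => hz a (Or.inl ha), hw _ rfl, fun b hb => hw' b (Or.inl hb),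
            fun j hj b hb => hw' b (Or.inr (Set.mem_iUnion₂.2 ⟨j, hj, hb⟩))⟩
        · simp only [Function.update_of_ne (hne k hk)]
          exact h1 k hk
      · rcases Finset.mem_insert.1 hk with rfl | hks
        · rcases Finset.mem_insert.1 hj with rfl | hj
          · exact (h.tri_irrefl _ hkj).elim
          · exact absurd (hrank hkj) (hmax j hj).not_gt
        · rw [Function.update_of_ne (hne k hks)]
          rcases Finset.mem_insert.1 hj with rfl | hj
          · rw [Function.update_self]
            exact hz _ (Or.inr ⟨k, ⟨hks, hkj⟩, rfl⟩)
          · rw [Function.update_of_ne (hne j hj)]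
            exact h2 k hks j hj hkj
  obtain ⟨c, d, h1, h2⟩ := hcd Finset.univ
  obtain ⟨y, hy⟩ := h.box c d (fun i => (h1 i (Finset.mem_univ i)).2.1)
    fun i j => h2 i (Finset.mem_univ i) j (Finset.mem_univ j)
  exact ⟨y, fun i => ⟨fun a ha => ((h1 i (Finset.mem_univ i)).1 a ha).trans (hy i).1,
    fun b hb => (hy i).2.trans ((h1 i (Finset.mem_univ i)).2.2.1 b hb)⟩⟩

/-! ### Back-and-forth between systems -/

/-- The finite relation `F` between `M` and `N` respects the positions in the chains. -/
def Respects {N : Type*} (cls : ι → κ) (V : ι → M → Set M) (W : ι → N → Set N)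
    (F : Set (M × N)) : Prop :=
  ∀ p ∈ F, ∀ q ∈ F, ∀ i j, cls i = cls j → (V i p.1 ⊂ V j q.1 ↔ W i p.2 ⊂ W j q.2)

lemma Respects.fst_eq [Nonempty ι] {N : Type*} {W : ι → N → Set N}
    (hV : ChainSystem cls tri V) {F : Set (M × N)} (hF : Respects cls V W F) {p q : M × N} (hp : p ∈ F) (hq : q ∈ F) (h : p.2 = q.2) :
    p.1 = q.1 := by
  obtain ⟨i⟩ := ‹Nonempty ι›
  by_contra hne
  have hVne : V i p.1 ≠ V i q.1 := fun he => hne (hV.inj rfl _ _ he).2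
  rcases hV.chain (i := i) rfl p.1 q.1 with hs | hs
  · have := (hF p hp q hq i i rfl).1 (Set.ssubset_iff_subset_ne.2 ⟨hs, hVne⟩)
    rw [h] at this
    exact this.ne rfl
  · have := (hF q hq p hp i i rfl).1 (Set.ssubset_iff_subset_ne.2 ⟨hs, hVne.symm⟩)
    rw [h] at this
    exact this.ne rfl

lemma Respects.symm {N : Type*} {W : ι → N → Set N} {F : Set (M × N)}
    (hF : Respects cls V W F) : Respects cls W V (Prod.swap ⁻¹' F) :=
  fun _ hp _ hq i j hij => (hF _ hp _ hq i j hij).symm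

lemma Respects.exists_insert [Nonempty ι] [Nonempty M] {N : Type*} [Nonempty N]
    {W : ι → N → Set N}
    (hV : ChainSystem cls tri V) (hW : ChainSystem cls tri W) {F : Set (M × N)} (hfin : F.Finite)
    (hF : Respects cls V W F) (x : M) : ∃ y, Respects cls V W (insert (x, y) F) := by
  by_cases hx : ∃ p ∈ F, p.1 = x
  · obtain ⟨p, hp, rfl⟩ := hx
    refine ⟨p.2, ?_⟩
    rwa [Set.insert_eq_of_mem hp]
  push Not at hx
  -- The position of `x` relative to the finitely many known points is transported to `N`. The
  -- bounds are consistent because `F` respects positions and the two systems have the same relation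
  -- `tri`.
  let A : ι → Set (Set N) := fun i =>
    (fun t : ι × (M × N) => W t.1 t.2.2) '' {t | t.2 ∈ F ∧ cls t.1 = cls i ∧ V t.1 t.2.1 ⊂ V i x}
  let B : ι → Set (Set N) := fun i =>
    (fun t : ι × (M × N) => W t.1 t.2.2) '' {t | t.2 ∈ F ∧ cls t.1 = cls i ∧ V i x ⊂ V t.1 t.2.1}
  have hbase : (Set.univ ×ˢ F : Set (ι × (M × N))).Finite := Set.finite_univ.prod hfin
  have hA : ∀ i, (A i).Finite := fun i =>
    (hbase.subset fun t ht => ⟨trivial, ht.1⟩).image _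
  have hB : ∀ i, (B i).Finite := fun i =>
    (hbase.subset fun t ht => ⟨trivial, ht.1⟩).image _
  obtain ⟨y, hy⟩ := hW.exists_interpolation A B hA hB
    (by rintro i _ ⟨t, ht, rfl⟩; exact ⟨t.1, t.2.2, ht.2.1, rfl⟩)
    (by rintro i _ ⟨t, ht, rfl⟩; exact ⟨t.1, t.2.2, ht.2.1, rfl⟩)
    (by
      rintro i _ ⟨t, ht, rfl⟩ _ ⟨u, hu, rfl⟩
      exact (hF _ ht.1 _ hu.1 t.1 u.1 (ht.2.1.trans hu.2.1.symm)).1 (ht.2.2.trans hu.2.2))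
    (by
      rintro i j hij _ ⟨t, ht, rfl⟩ _ ⟨u, hu, rfl⟩
      exact (hF _ ht.1 _ hu.1 t.1 u.1 (ht.2.1.trans ((hV.tri_cls hij).trans hu.2.1.symm))).1
        ((ht.2.2.trans (hV.ssubset_of_tri hij x)).trans hu.2.2))
  have key : ∀ p ∈ F, ∀ i j, cls i = cls j →
      ((V i p.1 ⊂ V j x → W i p.2 ⊂ W j y) ∧ (V j x ⊂ V i p.1 → W j y ⊂ W i p.2) ∧
        (V i p.1 ⊂ V j x ∨ V j x ⊂ V i p.1)) := by
    intro p hp i j hij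
    refine ⟨fun h => (hy j).1 _ ⟨(i, p), ⟨hp, hij, h⟩, rfl⟩,
      fun h => (hy j).2 _ ⟨(i, p), ⟨hp, hij, h⟩, rfl⟩, ?_⟩
    have hne : V i p.1 ≠ V j x := fun he => hx p hp (hV.inj hij _ _ he).2
    exact (hV.chain hij p.1 x).imp (fun h => Set.ssubset_iff_subset_ne.2 ⟨h, hne⟩)
      fun h => Set.ssubset_iff_subset_ne.2 ⟨h, hne.symm⟩
  refine ⟨y, ?_⟩
  rintro p hp q hq i j hij
  rcases Set.mem_insert_iff.1 hp with rfl | hp <;> rcases Set.mem_insert_iff.1 hq with rfl | hq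
  · have h1 := hV.tri_iff (i := i) (j := j) x
    have h2 := hW.tri_iff (i := i) (j := j) y
    rw [h1] at h2
    simpa [hij] using h2
  · obtain ⟨h1, h2, h3⟩ := key q hq j i hij.symm
    exact ⟨h2, fun h => h3.resolve_left fun h' => (h.trans (h1 h')).ne rfl⟩
  · obtain ⟨h1, h2, h3⟩ := key p hp i j hij
    exact ⟨h1, fun h => h3.resolve_right fun h' => (h.trans (h2 h')).ne rfl⟩
  · exact hF p hp q hq i j hij

/-- Countable systems with the same pattern are isomorphic. -/
theorem ChainSystem.exists_equiv [Nonempty ι] [Nonempty M] {N : Type*} [Nonempty N] [Countable M]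
    [Countable N] {W : ι → N → Set N} (hV : ChainSystem cls tri V) (hW : ChainSystem cls tri W) :
    ∃ e : M ≃ N, ∀ i x y, V i x ⊂ V i y ↔ W i (e x) ⊂ W i (e y) := by
  let S := {F : Set (M × N) // F.Finite ∧ Respects cls V W F}
  let r : S → Set (M × N) := fun s => s.1
  have forth : ∀ s a, ∃ s', r s ⊆ r s' ∧ ∃ b, (a, b) ∈ r s' := by
    rintro ⟨F, hF, h⟩ a
    obtain ⟨b, hb⟩ := h.exists_insert hV hW hF a
    exact ⟨⟨_, hF.insert _, hb⟩, Set.subset_insert _ _, b, Set.mem_insert _ _⟩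
  have back : ∀ s b, ∃ s', r s ⊆ r s' ∧ ∃ a, (a, b) ∈ r s' := by
    rintro ⟨F, hF, h⟩ b
    obtain ⟨a, ha⟩ := h.symm.exists_insert hW hV (hF.preimage Prod.swap_injective.injOn) b
    refine ⟨⟨insert (a, b) F, hF.insert _, ?_⟩, Set.subset_insert _ _, a, Set.mem_insert _ _⟩
    have := ha.symm
    convert this using 1
    ext ⟨p, q⟩
    simp [Prod.ext_iff, and_comm]
  have heq : ∀ s, ∀ p ∈ r s, ∀ q ∈ r s, p.1 = q.1 ↔ p.2 = q.2 := by
    rintro ⟨F, hF, h⟩ p hp q hq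
    exact ⟨fun he => h.symm.fst_eq (p := p.swap) (q := q.swap) hW hp hq he,
      h.fst_eq hV hp hq⟩
  obtain ⟨e, -, he⟩ := exists_equiv_of_backAndForth r forth back heq
    ⟨∅, Set.finite_empty, fun p hp => hp.elim⟩
  refine ⟨e, fun i x y => ?_⟩
  obtain ⟨⟨F, hF, h⟩, hx, hy⟩ := he x y
  exact h _ hx _ hy i i rfl

end

/-! ### Two equivariant maps to the same order -/

section

variable {G P P' Q : Type*} [Group G] [OligGroup G] [LinearOrder P] [LinearOrder P']
  [LinearOrder Q] [MulAction G P] [MulAction G P'] [MulAction G Q] [Tame G P] [Tame G P']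
  [Tame G Q] {v : P → Set Q} {w : P' → Set Q}

lemma IsNormal.ssubset_iff (hv : IsNormal G v) {x y : P} : v x ⊂ v y ↔ x < y := by
  refine ⟨fun h => lt_of_not_ge fun hle => ?_, fun h => hv.strict h⟩
  exact h.not_subset (hv.mono _ _ hle)

lemma IsNormal.injective (hv : IsNormal G v) : Function.Injective v := fun x y h => by
  rcases lt_trichotomy x y with hlt | hlt | hlt
  · exact ((hv.strict hlt).ne h).elim
  · exact hlt
  · exact ((hv.strict hlt).ne h.symm).elim

lemma ssubset_of_notMem {a b : Set Q} (ha : IsLowerSet a) (hb : IsLowerSet b) {y : Q} (hy : y ∈ b)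
    (hya : y ∉ a) : a ⊂ b :=
  ⟨(ha.total hb).resolve_right fun h => hya (h hy), fun h => hya (h hy)⟩

lemma IsNormal.exists_between (hv : IsNormal G v) {a b : Set Q} (ha : IsLowerSet a)
    (hb : IsLowerSet b) (hlast : ∀ y ∈ b, ∃ y' ∈ b, y < y') (hab : a ⊂ b) :
    ∃ z, a ⊂ v z ∧ v z ⊂ b := by
  obtain ⟨y, hy, hya⟩ := Set.exists_of_ssubset hab
  obtain ⟨y', hy', hlt⟩ := hlast y hy
  obtain ⟨x, hx⟩ := hv.exists_notMem y
  obtain ⟨x', hx'⟩ := hv.exists_mem y'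
  obtain ⟨z, -, h1, h2⟩ := hv.dleaf.nojump x trivial x' trivial y y' hlt hx hx'
  exact ⟨z, ssubset_of_notMem ha (hv.lower z) h1 hya, ssubset_of_notMem (hv.lower z) hb hy' h2⟩

lemma IsNormal.exists_ssubset (hv : IsNormal G v) {b : Set Q} (hb : IsLowerSet b)
    (hne : b.Nonempty) : ∃ z, v z ⊂ b := by
  obtain ⟨y, hy⟩ := hne
  obtain ⟨x, hx⟩ := hv.exists_notMem y
  exact ⟨x, ssubset_of_notMem (hv.lower x) hb hy hx⟩

lemma IsNormal.exists_ssuperset (hv : IsNormal G v) {a : Set Q} (ha : IsLowerSet a)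
    (hne : a ≠ Set.univ) : ∃ z, a ⊂ v z := by
  obtain ⟨y, hy⟩ := (Set.ne_univ_iff_exists_notMem _).1 hne
  obtain ⟨x, hx⟩ := hv.exists_mem y
  exact ⟨x, ssubset_of_notMem ha (hv.lower x) hx hy⟩

lemma IsTwinMap.smul_subset (hv : IsTwinMap G v) (hw : IsTwinMap G w) {x : P} {y : P'} (g : G) :
    v (g • x) ⊆ w (g • y) ↔ v x ⊆ w y := by
  constructor
  · intro h z hz
    exact (hw.smul_mem g y z).1 (h ((hv.smul_mem g x z).2 hz))
  · intro h z hz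
    rw [← smul_inv_smul g z] at hz ⊢
    exact (hw.smul_mem g y _).2 (h ((hv.smul_mem g x _).1 hz))

lemma IsTwinMap.smul_ssubset (hv : IsTwinMap G v) (hw : IsTwinMap G w) {x : P} {y : P'} (g : G) :
    v (g • x) ⊂ w (g • y) ↔ v x ⊂ w y := by
  rw [ssubset_iff_subset_not_subset, ssubset_iff_subset_not_subset, hv.smul_subset hw,
    hw.smul_subset hv]

lemma IsTwinMap.smul_eq (hv : IsTwinMap G v) (hw : IsTwinMap G w) {x : P} {y : P'} (g : G) :
    v (g • x) = w (g • y) ↔ v x = w y := by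
  rw [Set.Subset.antisymm_iff, Set.Subset.antisymm_iff, hv.smul_subset hw, hw.smul_subset hv]

/-- Two maps into the same completion are composed as `w⁻¹ ∘ v`, giving a map from `P` into the
completion of `P'`. -/
lemma IsNormal.pull (hv : IsNormal G v) (hw : IsNormal G w) :
    IsNormal G fun x => {q | w q ⊂ v x} where
  mono x y hxy q hq := hq.trans_subset (hv.mono x y hxy)
  lower x q q' hq h := lt_of_le_of_lt (hw.mono _ _ hq) h
  nonempty x := hw.exists_ssubset (hv.lower x) (hv.nonempty x)
  ne_univ x h := by
    obtain ⟨q, hq⟩ := hw.exists_ssuperset (hv.lower x) (hv.ne_univ x)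
    have h1 : w q ⊂ v x := (Set.ext_iff.1 h q).2 trivial
    exact (hq.trans h1).ne rfl
  smul_mem g x q := hw.smul_ssubset hv.toIsTwinMap g
  noLast x q hq := by
    obtain ⟨z, h1, h2⟩ := hw.exists_between (hw.lower q) (hv.lower x) (hv.noLast x) hq
    exact ⟨z, h2, hw.ssubset_iff.1 h1⟩

/-- The same comparison of `v` and `w`, read from above for the reversed orders. -/
lemma IsNormal.pull_dual (hv : IsNormal G v) (hw : IsNormal G w) :
    IsNormal G fun x : Pᵒᵈ => ({q | v x.ofDual ⊂ w (OrderDual.ofDual q)} : Set P'ᵒᵈ) where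
  mono x y hxy q hq := lt_of_le_of_lt (hv.mono _ _ hxy) hq
  lower x q q' hq h := lt_of_lt_of_le h (hw.mono _ _ hq)
  nonempty x := hw.exists_ssuperset (hv.lower x) (hv.ne_univ x)
  ne_univ x h := by
    obtain ⟨q, hq⟩ := hw.exists_ssubset (hv.lower x) (hv.nonempty x)
    have h1 : v x ⊂ w q := (Set.ext_iff.1 h q).2 trivial
    exact (hq.trans h1).ne rfl
  smul_mem g x q := hv.smul_ssubset hw.toIsTwinMap g
  noLast x q hq := by
    obtain ⟨z, h1, h2⟩ := hw.exists_between (hv.lower x) (hw.lower q) (hw.noLast q) hq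
    exact ⟨z, h1, hw.ssubset_iff.1 h2⟩

end

/-! ### Paths between compatible tuples -/

/-- A property of tuples that is preserved by moving a single coordinate among the tuples
compatible with `prec` holds for all compatible tuples or for none. -/
lemma forall_of_moves {Λ β : Type*} [Fintype Λ] [DecidableEq Λ] {X : Λ → Type*}
    (W : ∀ l, X l → Set β) (prec : Λ → Λ → Prop) (key : Λ → ℕ)
    (hkey : ∀ a b, prec a b → key a < key b) (chain : ∀ l x y, W l x ⊆ W l y ∨ W l y ⊆ W l x)
    (O : (∀ l, X l) → Prop) (hO : ∀ p, O p ↔ ∀ a b, prec a b → W a (p a) ⊂ W b (p b))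
    (R : (∀ l, X l) → Prop)
    (hmove : ∀ p l q, O p → O (Function.update p l q) → R p → R (Function.update p l q))
    {p p' : ∀ l, X l} (hp : O p) (hp' : O p') (h : R p) : R p' := by
  classical
  have hirr : ∀ a, ¬ prec a a := fun a h => lt_irrefl _ (hkey a a h)
  -- If `p` lies below `p'`, the coordinates are raised one by one, starting with the greatest key:
  -- whatever must stay above the moving coordinate has already reached its final position.
  have hup : ∀ (k : ℕ) (p p' : ∀ l, X l), (Finset.univ.filter fun l => p l ≠ p' l).card ≤ k →
      (∀ l, W l (p l) ⊆ W l (p' l)) → O p → O p' → (R p ↔ R p') := by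
    intro k
    induction k with
    | zero =>
      intro p p' hk _ _ _
      have : p = p' := by
        funext l
        have := Finset.filter_eq_empty_iff.1 (Finset.card_eq_zero.1 (Nat.le_zero.1 hk))
          (Finset.mem_univ l)
        exact not_not.1 this
      rw [this]
    | succ k ih =>
      intro p p' hk hle hp hp'
      by_cases hD : (Finset.univ.filter fun l => p l ≠ p' l).Nonempty
      · obtain ⟨l, hl, hmax⟩ := Finset.exists_max_image _ key hD
        have hl' : p l ≠ p' l := (Finset.mem_filter.1 hl).2
        have hO₁ : O (Function.update p l (p' l)) := by
          refine (hO _).2 fun a b hab => ?_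
          by_cases ha : a = l
          · subst ha
            have hb : b ≠ a := fun h => hirr a (h ▸ hab)
            rw [Function.update_self, Function.update_of_ne hb]
            have : p b = p' b := by
              by_contra hne
              exact absurd (hkey _ _ hab)
                (hmax b (Finset.mem_filter.2 ⟨Finset.mem_univ b, hne⟩)).not_gt
            rw [this]
            exact (hO p').1 hp' a b hab
          · rw [Function.update_of_ne ha]
            by_cases hb : b = l
            · subst hb
              rw [Function.update_self]
              exact ((hO p).1 hp a b hab).trans_subset (hle b)
            · rw [Function.update_of_ne hb]
              exact (hO p).1 hp a b hab
        have h1 : R p ↔ R (Function.update p l (p' l)) := by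
          refine ⟨hmove p l _ hp hO₁, fun h => ?_⟩
          have := hmove (Function.update p l (p' l)) l (p l) hO₁
          rw [Function.update_idem, Function.update_eq_self] at this
          exact this hp h
        refine h1.trans (ih _ p' ?_ (fun m => ?_) hO₁ hp')
        · refine Nat.le_of_lt_succ (lt_of_lt_of_le (Finset.card_lt_card ?_) hk)
          rw [Finset.ssubset_iff_of_subset]
          · exact ⟨l, hl, by simp⟩
          · intro m hm
            have hm' := (Finset.mem_filter.1 hm).2
            refine Finset.mem_filter.2 ⟨Finset.mem_univ m, fun he => hm' ?_⟩
            by_cases hml : m = l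
            · subst hml; simp
            · rwa [Function.update_of_ne hml]
        · by_cases hml : m = l
          · subst hml; simp
          · rw [Function.update_of_ne hml]; exact hle m
      · exact ih p p' (by rw [Finset.not_nonempty_iff_eq_empty.1 hD]; simp) hle hp hp'
  -- Arbitrary `p` and `p'` are connected through their coordinatewise maximum, which is again
  -- compatible.
  let m : ∀ l, X l := fun l => if W l (p l) ⊆ W l (p' l) then p' l else p l
  have hm : ∀ l, W l (p l) ⊆ W l (m l) := fun l => by
    by_cases hl : W l (p l) ⊆ W l (p' l)
    · simp [m, hl]
    · simp [m, hl]
  have hm' : ∀ l, W l (p' l) ⊆ W l (m l) := fun l => by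
    by_cases hl : W l (p l) ⊆ W l (p' l)
    · simp [m, hl]
    · simpa [m, hl] using (chain l (p l) (p' l)).resolve_left hl
  have hmO : O m := by
    refine (hO m).2 fun a b hab => ?_
    by_cases ha : W a (p a) ⊆ W a (p' a)
    · have : m a = p' a := by simp [m, ha]
      rw [this]
      exact ((hO p').1 hp' a b hab).trans_subset (hm' b)
    · have : m a = p a := by simp [m, ha]
      rw [this]
      exact ((hO p).1 hp a b hab).trans_subset (hm b)
  exact (hup _ p' m le_rfl hm' hp' hmO).2 ((hup _ p m le_rfl hm hp hmO).1 h)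

section

variable {n : ℕ} {M : Type*} [(lang n).Structure M] {r r' s : M → M → Prop}
  [hM : Fact (IsRankOneMultiOrder n M)] [InvOrder n r] [InvOrder n r'] [InvOrder n s]

/-! ### Coincidence of values -/

/-- If two equivariant maps to the same order have a common value, then they coincide. -/
lemma eq_of_value_eq {v : Copy n M r → Set (Copy n M s)} {w : Copy n M r' → Set (Copy n M s)}
    (hv : IsNormal (aut n M) v) (hw : IsNormal (aut n M) w) {x₀ y₀ : M} (h : v x₀ = w y₀) :
    r = r' ∧ x₀ = y₀ := by
  have hsm : ∀ (g : aut n M) (x y : M), v x = w y → v (g • x) = w (g • y) := fun g x y h =>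
    (hv.smul_eq hw.toIsTwinMap g).2 h
  have hex : ∀ x : M, ∃ y : M, v x = w y := fun x => by
    obtain ⟨g, rfl⟩ := exists_smul_eq_of_mem (n := n) x₀ x
    exact ⟨g • y₀, hsm g _ _ h⟩
  -- Coincidence at one point spreads by transitivity and produces an equivariant map `φ` of `M` to
  -- itself. If it moves `x₀`, its iterates are strictly monotone, giving infinitely many points
  -- fixed by the stabilizer of `x₀`; so `φ` is the identity.
  choose φ hφ using hex
  have hφsm : ∀ (g : aut n M) x, φ (g • x) = g • φ x := fun g x =>
    hw.injective ((hφ _).symm.trans (hsm g _ _ (hφ x)))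
  have hφ₀ : φ x₀ = y₀ := hw.injective ((hφ x₀).symm.trans h)
  have hiter : ∀ (k : ℕ) (g : aut n M) x, φ^[k] (g • x) = g • φ^[k] x := by
    intro k
    induction k with
    | zero => exact fun g x => rfl
    | succ k ih => exact fun g x => by rw [Function.iterate_succ_apply, hφsm, ih]; rfl
  have hninj : ¬ Function.Injective fun k => ({φ^[k] x₀} : Set (Copy n M r)) :=
    not_injective_of_invariant (op_stabilizer (n := n) x₀) _ (by
      rintro k g hg x rfl
      refine (hiter k g x₀).symm.trans ?_
      rw [MulAction.mem_stabilizer_iff.1 hg])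
  let K : ℕ → Copy n M r := fun k => φ^[k] x₀
  have hninj' : ¬ Function.Injective K := fun hi =>
    hninj fun a b hab => hi (Set.singleton_injective hab)
  have hstep : ∀ k, K (k + 1) = φ (K k) := fun k => Function.iterate_succ_apply' φ k x₀
  rcases lt_trichotomy (α := Copy n M r) (φ x₀) x₀ with hlt | heq | hlt
  · have hall : ∀ x : M, lt r (φ x) x := fun x => by
      obtain ⟨g, rfl⟩ := exists_smul_eq_of_mem (n := n) x₀ x
      rw [hφsm]
      exact (smul_lt_iff (P := Copy n M r) g).2 hlt
    exact (hninj' (strictAnti_nat_of_succ_lt (f := K) fun k => by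
      rw [hstep]; exact hall _).injective).elim
  · have hid : ∀ x : M, φ x = x := fun x => by
      obtain ⟨g, rfl⟩ := exists_smul_eq_of_mem (n := n) x₀ x
      rw [hφsm, heq]
    refine ⟨eq_of_forall_imp (InvOrder.linear n) (InvOrder.linear n) fun a b hab => ?_,
      heq.symm.trans hφ₀⟩
    by_contra hcon
    have hlt : lt r' b a := lt_of_not_ge (α := Copy n M r') hcon
    have h1 := hw.strict (x := b) (y := a) hlt
    have h2 := hv.mono a b hab
    have ha : v a = w a := by simpa [hid] using hφ a
    have hb : v b = w b := by simpa [hid] using hφ b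
    rw [ha, hb] at h2
    exact h1.not_subset h2
  · have hall : ∀ x : M, lt r x (φ x) := fun x => by
      obtain ⟨g, rfl⟩ := exists_smul_eq_of_mem (n := n) x₀ x
      rw [hφsm]
      exact (smul_lt_iff (P := Copy n M r) g).2 hlt
    exact (hninj' (strictMono_nat_of_lt_succ (f := K) fun k => by
      rw [hstep]; exact hall _).injective).elim

/-! ### Classes of intertwined orders -/

lemma tw_refl : Tw n r r := ⟨_, isNormal_Iio.toIsTwinMap⟩

lemma tw_sgn_not {σ : Bool} : Tw n (sgn (!σ) r) s ↔ Tw n (sgn σ r) (rev s) := by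
  cases σ
  · exact (tw_rev_rev (r := r) (s := s)).symm
  · exact tw_rev_left (r := r) (s := s)

lemma Tw.sgn_symm {σ : Bool} (h : Tw n (sgn σ r) s) : Tw n (sgn σ s) r := by
  cases σ
  · exact (tw_rev_left (r := s) (s := r)).2 (Twin.symm h)
  · exact Twin.symm h

lemma Tw.sgn_trans {t : M → M → Prop} [InvOrder n t] {σ τ : Bool} (h : Tw n (sgn σ r) s)
    (h' : Tw n (sgn τ s) t) : ∃ υ, Tw n (sgn υ r) t := by
  cases τ
  · exact ⟨!σ, tw_sgn_not.2 (h.trans ((tw_rev_left (r := s) (s := t)).1 h'))⟩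
  · exact ⟨σ, h.trans h'⟩

/-- `ρ` and `σ` choose a representative of each class of intertwined orders, and a direction. -/
structure IsOrientation (M : Type*) [(lang n).Structure M] [Fact (IsRankOneMultiOrder n M)]
    (ρ : Fin n → Fin n) (σ : Fin n → Bool) : Prop where
  tw : ∀ i, Tw n (sgn (σ i) (leAt M i)) (leAt M (ρ i))
  eq_of_tw : ∀ i j τ, Tw n (sgn τ (leAt M i)) (leAt M j) → ρ i = ρ j

variable (M) in
lemma exists_orientation : ∃ ρ σ, IsOrientation (n := n) M ρ σ := by
  let E : Setoid (Fin n) :=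
    { r := fun i j => ∃ τ, Tw n (sgn τ (leAt M i)) (leAt M j)
      iseqv :=
        { refl := fun i => ⟨true, tw_refl (r := leAt M i)⟩
          symm := fun ⟨τ, h⟩ => ⟨τ, h.sgn_symm⟩
          trans := fun ⟨_, h⟩ ⟨_, h'⟩ => h.sgn_trans h' } }
  let ρ : Fin n → Fin n := fun i => (Quotient.mk E i).out
  have hρ : ∀ i, ∃ τ, Tw n (sgn τ (leAt M i)) (leAt M (ρ i)) := fun i =>
    E.symm' (Quotient.exact (Quotient.out_eq (Quotient.mk E i)))
  choose σ hσ using hρ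
  exact ⟨ρ, σ, hσ, fun i j τ h => congrArg Quotient.out (Quotient.sound (s := E) ⟨τ, h⟩)⟩

variable {ρ : Fin n → Fin n} {σ : Fin n → Bool}

/-- The order `≤_i`, or its reverse, according to the orientation. -/
abbrev ord (M : Type*) [(lang n).Structure M] (σ : Fin n → Bool) (i : Fin n) : M → M → Prop :=
  sgn (σ i) (leAt M i)

/-- A map into sets, between copies of `M`. -/
def asMap (r s : M → M → Prop) (v : M → Set M) : Copy n M r → Set (Copy n M s) := v

lemma isNormal_congr {r₁ s₁ : M → M → Prop} [InvOrder n r₁] [InvOrder n s₁] {v : M → Set M}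
    (hv : IsNormal (aut n M) (asMap (n := n) r s v)) (hr : r = r₁) (hs : s = s₁) :
    IsNormal (aut n M) (asMap (n := n) r₁ s₁ v) := by
  subst hr hs
  exact hv

/-- The maps of an orientation. -/
structure IsOrientationMaps (M : Type*) [(lang n).Structure M] [Fact (IsRankOneMultiOrder n M)]
    (ρ : Fin n → Fin n) (σ : Fin n → Bool) (V : Fin n → M → Set M) : Prop extends
    IsOrientation M ρ σ where
  normal : ∀ i k, ρ i = k →
    IsNormal (aut n M) (asMap (n := n) (ord M σ i) (leAt M k) (V i))

lemma IsOrientation.exists_maps (h : IsOrientation M ρ σ) : ∃ V, IsOrientationMaps M ρ σ V := by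
  have hex : ∀ i, ∃ f : Copy n M (ord M σ i) → Set (Copy n M (leAt M (ρ i))),
      IsNormal (aut n M) f := fun i => by
    obtain ⟨f, hf⟩ := h.tw i
    exact hf.exists_normal
  choose f hf using hex
  exact ⟨f, h, by rintro i _ rfl; exact hf i⟩

namespace IsOrientationMaps

variable {V : Fin n → M → Set M} (h : IsOrientationMaps M ρ σ V)

include h

lemma ssubset_iff {i : Fin n} {x y : M} : V i x ⊂ V i y ↔ lt (ord M σ i) x y :=
  (h.normal i _ rfl).ssubset_iff

lemma chain {i j : Fin n} (hij : ρ i = ρ j) (x y : M) : V i x ⊆ V j y ∨ V j y ⊆ V i x :=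
  ((h.normal i _ hij).lower x).total ((h.normal j _ rfl).lower y)

lemma ord_injective {i j : Fin n} (hij : ord M σ i = ord M σ j) : i = j := by
  by_contra hne
  have h1 := hM.out.ne i j hne
  have h2 := hM.out.ne_rev i j hne
  have h3 := hM.out.ne_rev j i (Ne.symm hne)
  unfold ord at hij
  cases hi : σ i <;> cases hj : σ j <;> rw [hi, hj] at hij
  · refine h1 ?_
    funext a b
    exact congrFun (congrFun hij b) a
  · exact h3 hij.symm
  · exact h2 hij
  · exact h1 hij

lemma inj {i j : Fin n} (hij : ρ i = ρ j) (x y : M) (he : V i x = V j y) : i = j ∧ x = y := by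
  have := eq_of_value_eq (h.normal i _ hij) (h.normal j _ rfl) (x₀ := x) (y₀ := y) he
  exact ⟨h.ord_injective this.1, this.2⟩

lemma pre : PreChainSystem ρ V where
  chain := h.chain
  dense {i j} hij k hk x y hxy :=
    (h.normal k _ (hk.trans hij)).exists_between ((h.normal i _ hij).lower x)
      ((h.normal j _ rfl).lower y) ((h.normal j _ rfl).noLast y) hxy
  exists_lt {i j} hij y :=
    (h.normal i _ hij).exists_ssubset ((h.normal j _ rfl).lower y) ((h.normal j _ rfl).nonempty y)
  exists_gt {i j} hij y :=
    (h.normal i _ hij).exists_ssuperset ((h.normal j _ rfl).lower y)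
      ((h.normal j _ rfl).ne_univ y)

lemma forall_ssubset {i j : Fin n} (hij : ρ i = ρ j) {x₀ : M} (h₀ : V i x₀ ⊂ V j x₀) (x : M) :
    V i x ⊂ V j x := by
  obtain ⟨g, rfl⟩ := exists_smul_eq_of_mem (n := n) x₀ x
  exact ((h.normal i _ hij).smul_ssubset (h.normal j _ rfl).toIsTwinMap g).2 h₀

end IsOrientationMaps

/-- The relation between the maps of an orientation. -/
def triOf (ρ : Fin n → Fin n) (V : Fin n → M → Set M) (i j : Fin n) : Prop :=
  ρ i = ρ j ∧ ∀ x, V i x ⊂ V j x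

namespace IsOrientationMaps

variable {V : Fin n → M → Set M} (h : IsOrientationMaps M ρ σ V)

include h

lemma triOf_total {i j : Fin n} (hij : ρ i = ρ j) (hne : i ≠ j) : triOf ρ V i j ∨ triOf ρ V j i := by
  obtain ⟨x₀⟩ : Nonempty M := hM.out.infinite.nonempty
  have hVne : V i x₀ ≠ V j x₀ := fun he => hne (h.inj hij _ _ he).1
  rcases h.chain hij x₀ x₀ with hs | hs
  · exact Or.inl ⟨hij, h.forall_ssubset hij (Set.ssubset_iff_subset_ne.2 ⟨hs, hVne⟩)⟩
  · exact Or.inr ⟨hij.symm, h.forall_ssubset hij.symm (Set.ssubset_iff_subset_ne.2 ⟨hs, hVne.symm⟩)⟩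

omit h in
lemma triOf_asymm {i j : Fin n} (hij : triOf ρ V i j) : ¬ triOf ρ V j i := fun hji => by
  obtain ⟨x₀⟩ : Nonempty M := hM.out.infinite.nonempty
  exact ((hij.2 x₀).trans (hji.2 x₀)).ne rfl

lemma normal_pull {i j : Fin n} (hij : ρ i = ρ j) :
    IsNormal (aut n M) (asMap (n := n) (ord M σ i) (ord M σ j) fun x => {q | V j q ⊂ V i x}) :=
  (h.normal i _ hij).pull (h.normal j _ rfl)

lemma normal_pull_rev {i j : Fin n} (hij : ρ i = ρ j) :
    IsNormal (aut n M) (asMap (n := n) (rev (ord M σ i)) (rev (ord M σ j))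
      fun x => {q | V i x ⊂ V j q}) := by
  have := (h.normal i _ hij).pull_dual (h.normal j _ rfl)
  refine ⟨⟨this.mono, this.lower, this.nonempty, this.ne_univ, this.smul_mem⟩, fun x y hy => ?_⟩
  obtain ⟨z, hz, hlt⟩ := this.noLast x y hy
  exact ⟨z, hz, hlt.1, hlt.2.symm⟩

/-- The data determined by the case that holds for the pair `i`, `j`. -/
lemma triOf_iff {i j : Fin n} (hij : ρ i = ρ j) (hne : i ≠ j) :
    triOf ρ V i j ↔ if σ j then TwinBelow M (σ i) i j else TwinAbove M (!σ i) i j := by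
  by_cases hj : σ j
  · rw [if_pos hj]
    have hord : ord M σ j = leAt M j := by unfold ord; rw [hj]; rfl
    have hpt : ∀ x q : M, q ∈ pointCut M j x ↔ V j q ⊂ V j x := fun x q => by
      rw [h.ssubset_iff, hord]; rfl
    -- Pulling `V i` back along `V j` gives the equivariant map from `≤_i` or its reverse to `≤_j`,
    -- so comparing `V i x` with `V j x` is comparing that map with its argument.
    have hnorm := isNormal_congr (h.normal_pull hij) rfl hord
    constructor
    · refine fun ht => ⟨_, hnorm, fun x => ⟨fun q hq => (hpt x q).2 (lt_of_lt_of_le hq (ht.2 x).le),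
        fun hsub => ?_⟩⟩
      obtain ⟨z, h1, h2⟩ := h.pre.dense hij j hij.symm x x (ht.2 x)
      exact (lt_trans h1 (hsub ((hpt x z).2 h2))).ne rfl
    · refine fun hb => (h.triOf_total hij hne).resolve_right fun ht => hb.not_above ?_
      exact ⟨_, hnorm, fun x => ⟨fun q hq => lt_trans ((hpt x q).1 hq) (ht.2 x),
        fun hsub => lt_irrefl _ ((hpt x x).1 (hsub (ht.2 x)))⟩⟩
  · rw [if_neg hj]
    have hj' : σ j = false := by simpa using hj
    have hord : ord M σ j = rev (leAt M j) := by unfold ord; rw [hj']; rfl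
    have hpt : ∀ x q : M, q ∈ pointCut M j x ↔ V j x ⊂ V j q := fun x q => by
      rw [h.ssubset_iff, hord]
      exact ⟨fun h => ⟨h.1, h.2.symm⟩, fun h => ⟨h.1, h.2.symm⟩⟩
    have hrev : rev (ord M σ i) = sgn (!σ i) (leAt M i) := by
      unfold ord
      cases σ i <;> rfl
    -- If `≤_j` enters reversed, cuts of `≤_j` are taken from above, and "`V i` below `V j`" becomes
    -- "map above the argument".
    have hnorm' : IsNormal (aut n M) (asMap (n := n) (sgn (!σ i) (leAt M i)) (leAt M j)
        fun x => {q | V i x ⊂ V j q}) :=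
      isNormal_congr (h.normal_pull_rev hij) hrev (by rw [hord]; rfl)
    constructor
    · refine fun ht => ⟨_, hnorm', fun x => ⟨fun q hq => lt_trans (ht.2 x) ((hpt x q).1 hq),
        fun hsub => lt_irrefl _ ((hpt x x).1 (hsub (ht.2 x)))⟩⟩
    · refine fun ha => (h.triOf_total hij hne).resolve_right fun ht => TwinBelow.not_above ?_ ha
      refine ⟨_, hnorm', fun x => ⟨fun q hq => (hpt x q).2 (lt_of_le_of_lt (ht.2 x).le hq),
        fun hsub => ?_⟩⟩
      obtain ⟨z, h1, h2⟩ := h.pre.dense hij.symm j rfl x x (ht.2 x)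
      exact (lt_trans h2 (hsub ((hpt x z).2 h1))).ne rfl

end IsOrientationMaps

end

/-! ### Boxes -/

section

variable {n : ℕ} {M : Type*} [(lang n).Structure M] [hM : Fact (IsRankOneMultiOrder n M)]
  {ρ : Fin n → Fin n} {σ : Fin n → Bool} {V : Fin n → M → Set M}

/-- The orders in which the sides of boxes vary: lower sides for `true`, upper ones for `false`. -/
abbrev Side (M : Type*) [(lang n).Structure M] (σ : Fin n → Bool) (l : Fin n × Bool) : Type _ :=
  Copy n M (sgn l.2 (ord M σ l.1))

/-- The box with sides `p` contains an element. -/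
def BoxRel (M : Type*) [(lang n).Structure M] (σ : Fin n → Bool) (p : ∀ l, Side M σ l) : Prop :=
  ∃ y : M, ∀ l, lt (sgn l.2 (ord M σ l.1)) (p l) y

variable (M σ) in
lemma openRel_boxRel : OpenRel (aut n M) (BoxRel M σ) where
  smul g p := by
    rintro ⟨y, hy⟩
    exact ⟨g • y, fun l => (smul_lt_iff (P := Side M σ l) g).2 (hy l)⟩
  down p m q hq := by
    rintro ⟨y, hy⟩
    refine ⟨y, fun l => ?_⟩
    by_cases h : l = m
    · subst h
      rw [Function.update_self]
      exact lt_of_le_of_lt (α := Side M σ l) hq (hy l)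
    · rw [Function.update_of_ne h]
      exact hy l
  open_ p m := by
    rintro ⟨y, hy⟩
    have := Tame.denselyOrdered (aut n M) (Side M σ m)
    obtain ⟨q, h1, h2⟩ := exists_between (α := Side M σ m) (hy m)
    refine ⟨q, h1, y, fun l => ?_⟩
    by_cases h : l = m
    · subst h
      rw [Function.update_self]
      exact h2
    · rw [Function.update_of_ne h]
      exact hy l

namespace IsOrientationMaps

variable (h : IsOrientationMaps M ρ σ V)

include h

/-- The orientation makes all members of a class point the same way, so a map between two signed
members exists only for equal signs: otherwise an increasing and a decreasing map into the
representative would coexist. -/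
lemma eq_of_tw_ord {i j : Fin n} {a b : Bool}
    (ht : Tw n (sgn a (ord M σ i)) (sgn b (ord M σ j))) : ρ i = ρ j ∧ a = b := by
  have hsgn : ∃ τ, Tw n (sgn τ (leAt M i)) (leAt M j) := by
    have key : ∀ a c : Bool, ∃ τ, sgn a (sgn c (leAt M i)) = sgn τ (leAt M i) := by
      intro a c
      cases a <;> cases c
      · exact ⟨true, rfl⟩
      · exact ⟨false, rfl⟩
      · exact ⟨false, rfl⟩
      · exact ⟨true, rfl⟩
    have h1 : Tw n (leAt M i) (sgn a (ord M σ i)) ∨ Tw n (rev (leAt M i)) (sgn a (ord M σ i)) := by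
      unfold ord
      cases a <;> cases σ i
      · exact Or.inl (tw_refl (r := leAt M i))
      · exact Or.inr (tw_refl (r := rev (leAt M i)))
      · exact Or.inr (tw_refl (r := rev (leAt M i)))
      · exact Or.inl (tw_refl (r := leAt M i))
    have h2 : Tw n (sgn b (ord M σ j)) (leAt M j) ∨ Tw n (sgn b (ord M σ j)) (rev (leAt M j)) := by
      unfold ord
      cases b <;> cases σ j
      · exact Or.inl (tw_refl (r := leAt M j))
      · exact Or.inr (tw_refl (r := rev (leAt M j)))
      · exact Or.inr (tw_refl (r := rev (leAt M j)))
      · exact Or.inl (tw_refl (r := leAt M j))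
    rcases h1 with h1 | h1 <;> rcases h2 with h2 | h2
    · exact ⟨true, (h1.trans ht).trans h2⟩
    · exact ⟨false, (tw_rev_left (r := leAt M i) (s := leAt M j)).2 ((h1.trans ht).trans h2)⟩
    · exact ⟨false, (h1.trans ht).trans h2⟩
    · exact ⟨true, (tw_rev_rev (r := leAt M i) (s := leAt M j)).1 ((h1.trans ht).trans h2)⟩
  obtain ⟨τ, hτ⟩ := hsgn
  have hij := h.eq_of_tw i j τ hτ
  refine ⟨hij, ?_⟩
  have hi : Tw n (ord M σ i) (leAt M (ρ j)) := ⟨_, (h.normal i _ hij).toIsTwinMap⟩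
  have hj : Tw n (ord M σ j) (leAt M (ρ j)) := ⟨_, (h.normal j _ rfl).toIsTwinMap⟩
  cases a <;> cases b
  · rfl
  · exact (Tw.not_rev hi (Twin.trans ht hj)).elim
  · exact (Tw.not_rev hi ((tw_rev_left (r := ord M σ i) (s := leAt M (ρ j))).2
      (Twin.trans ht ((tw_rev_rev (r := ord M σ j) (s := leAt M (ρ j))).2 hj)))).elim
  · rfl

/-- The general theorem on open relations leaves one other side on which the cut depends. The signs
force it to be an opposite side in the same class, and uniqueness of equivariant maps identifies the
cut with the comparison of `V l.1` and `V j`. -/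
lemma cutAt_boxRel (l : Fin n × Bool) (p : ∀ l, Side M σ l) (x : M)
    (hx : x ∈ cutAt (BoxRel M σ) l p) : (∀ q : M, q ∈ cutAt (BoxRel M σ) l p) ∨
    ∃ j, ρ j = ρ l.1 ∧ ∀ q : M, q ∈ cutAt (BoxRel M σ) l p ↔
      if l.2 then V l.1 q ⊂ V j (p (j, false)) else V j (p (j, true)) ⊂ V l.1 q := by
  rcases (openRel_boxRel M σ).cutAt_eq l p with h0 | h0 | ⟨⟨j, a⟩, hne, f, hf, hfe⟩
  · rw [h0] at hx
    exact hx.elim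
  · rw [h0]
    exact Or.inl fun q => trivial
  · refine Or.inr ⟨j, ?_⟩
    obtain ⟨i, b⟩ := l
    let f' : M → Set M := f
    have hf' : IsNormal (aut n M)
        (asMap (n := n) (rev (sgn a (ord M σ j))) (sgn b (ord M σ i)) f') :=
      ⟨⟨hf.mono, hf.lower, hf.nonempty, hf.ne_univ, hf.smul_mem⟩, hf.noLast⟩
    have hrev : rev (sgn a (ord M σ j)) = sgn (!a) (ord M σ j) := by cases a <;> rfl
    have hf'' := isNormal_congr hf' hrev rfl
    obtain ⟨hji, hab⟩ := h.eq_of_tw_ord ⟨_, hf''.toIsTwinMap⟩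
    refine ⟨hji, fun q => ?_⟩
    rw [← hfe]
    cases b
    · obtain rfl : a = true := by simpa using hab
      have := hf'.unique (h.normal_pull_rev hji)
      exact Set.ext_iff.1 (congrFun this (p (j, true))) q
    · obtain rfl : a = false := by simpa using hab
      have := hf''.unique (h.normal_pull hji)
      exact Set.ext_iff.1 (congrFun this (p (j, false))) q

omit h in
/-- The order of the sides of boxes of the kind considered. -/
def prec (ρ : Fin n → Fin n) (V : Fin n → M → Set M) (a b : Fin n × Bool) : Prop :=
  triOf ρ V a.1 b.1 ∨ (a.1 = b.1 ∧ a.2 = true ∧ b.2 = false)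

omit h in
/-- The sides `p` are arranged in the prescribed way. -/
def Arranged (ρ : Fin n → Fin n) (V : Fin n → M → Set M) (p : ∀ l, Side M σ l) : Prop :=
  ∀ a b, prec ρ V a b → V a.1 (p a) ⊂ V b.1 (p b)

/-- Only one opposite side `j` can obstruct the moving side. Either the arrangement prescribes the
required inequality, and it still holds after the move; or it prescribes the reverse one, which
contradicts that the box was nonempty before the move. -/
lemma boxRel_update (p : ∀ l, Side M σ l) (l : Fin n × Bool) (q : Side M σ l)
    (hp : Arranged ρ V p) (hq : Arranged ρ V (Function.update p l q)) (hR : BoxRel M σ p) :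
    BoxRel M σ (Function.update p l q) := by
  have hx : p l ∈ cutAt (BoxRel M σ) l p := by
    show BoxRel M σ _
    rwa [Function.update_eq_self]
  show q ∈ cutAt (BoxRel M σ) l p
  rcases h.cutAt_boxRel l p (p l) hx with hall | ⟨j, hj, hall⟩
  · exact hall q
  · replace hx := (hall (p l)).1 hx
    refine (hall q).2 ?_
    obtain ⟨i, b⟩ := l
    cases b
    · simp only [Bool.false_eq_true, if_false] at hx ⊢
      by_cases hlt : prec ρ V (j, true) (i, false)
      · have := hq _ _ hlt
        rwa [Function.update_self, Function.update_of_ne (by simp)] at this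
      · have hne : i ≠ j := fun he => hlt (Or.inr ⟨he.symm, rfl, rfl⟩)
        have hij := (h.triOf_total hj hne.symm).resolve_left fun ht => hlt (Or.inl ht)
        exact ((hp (i, false) (j, true) (Or.inl hij)).trans hx).ne rfl |>.elim
    · simp only [if_true] at hx ⊢
      by_cases hlt : prec ρ V (i, true) (j, false)
      · have := hq _ _ hlt
        rwa [Function.update_self, Function.update_of_ne (by simp)] at this
      · have hne : i ≠ j := fun he => hlt (Or.inr ⟨he, rfl, rfl⟩)
        have hji := (h.triOf_total hj hne.symm).resolve_right fun ht => hlt (Or.inl ht)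
        exact ((hp (j, false) (i, true) (Or.inl hji)).trans hx).ne rfl |>.elim

omit h in
/-- The sides of the box given by its corners. -/
def sides (σ : Fin n → Bool) (c d : Fin n → M) : ∀ l, Side M σ l :=
  fun l => if l.2 then c l.1 else d l.1

omit h in
lemma arranged_sides {c d : Fin n → M} (h1 : ∀ i, V i (c i) ⊂ V i (d i))
    (h2 : ∀ i j, triOf ρ V i j → V i (d i) ⊂ V j (c j)) : Arranged ρ V (sides σ c d) := by
  have hc : ∀ l, V l.1 (c l.1) ⊆ V l.1 (sides σ c d l) := by
    rintro ⟨i, b⟩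
    cases b
    · exact (h1 i).le
    · exact subset_rfl
  have hd : ∀ l, V l.1 (sides σ c d l) ⊆ V l.1 (d l.1) := by
    rintro ⟨i, b⟩
    cases b
    · exact subset_rfl
    · exact (h1 i).le
  rintro ⟨i, a⟩ ⟨j, b⟩ (ht | ⟨he, ha, hb⟩)
  · exact ((hd (i, a)).trans_ssubset (h2 i j ht)).trans_subset (hc (j, b))
  · obtain rfl : i = j := he
    obtain rfl : a = true := ha
    obtain rfl : b = false := hb
    exact h1 i

lemma boxRel_sides_iff {c d : Fin n → M} : BoxRel M σ (sides σ c d) ↔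
    ∃ y, ∀ i, V i (c i) ⊂ V i y ∧ V i y ⊂ V i (d i) := by
  constructor
  · rintro ⟨y, hy⟩
    refine ⟨y, fun i => ⟨h.ssubset_iff.2 (hy (i, true)), h.ssubset_iff.2 ?_⟩⟩
    exact ⟨(hy (i, false)).1, (hy (i, false)).2.symm⟩
  · rintro ⟨y, hy⟩
    refine ⟨y, ?_⟩
    rintro ⟨i, b⟩
    cases b
    · have := h.ssubset_iff.1 (hy i).2
      exact ⟨this.1, this.2.symm⟩
    · exact h.ssubset_iff.1 (hy i).1

/-- An arbitrary element provides the initial nonempty box: the upper corners are chosen close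
enough to `y` to stay below the larger `V j y`, and then the lower corners above those upper
corners. -/
lemma exists_corners (y : M) : ∃ c d : Fin n → M,
    (∀ i, V i (c i) ⊂ V i y ∧ V i y ⊂ V i (d i)) ∧
    ∀ i j, triOf ρ V i j → V i (d i) ⊂ V j (c j) := by
  have : Nonempty M := ⟨y⟩
  have hd : ∀ i, ∃ z, V i y ⊂ V i z ∧ ∀ j, triOf ρ V i j → V i z ⊂ V j y := fun i => by
    obtain ⟨z, h1, h2⟩ := h.pre.exists_between (k := i) (A := {V i y})
      (B := (fun j => V j y) '' {j | triOf ρ V i j}) (Set.finite_singleton _)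
      ((Set.toFinite _).image _) (by rintro _ rfl; exact ⟨i, y, rfl, rfl⟩)
      (by rintro _ ⟨j, hj, rfl⟩; exact ⟨j, y, hj.1.symm, rfl⟩)
      (by rintro _ rfl _ ⟨j, hj, rfl⟩; exact hj.2 y)
    exact ⟨z, h1 _ rfl, fun j hj => h2 _ ⟨j, hj, rfl⟩⟩
  choose d hd1 hd2 using hd
  have hc : ∀ j, ∃ z, V j z ⊂ V j y ∧ ∀ i, triOf ρ V i j → V i (d i) ⊂ V j z := fun j => by
    obtain ⟨z, h1, h2⟩ := h.pre.exists_between (k := j)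
      (A := (fun i => V i (d i)) '' {i | triOf ρ V i j}) (B := {V j y})
      ((Set.toFinite _).image _) (Set.finite_singleton _)
      (by rintro _ ⟨i, hi, rfl⟩; exact ⟨i, d i, hi.1, rfl⟩)
      (by rintro _ rfl; exact ⟨j, y, rfl, rfl⟩)
      (by rintro _ ⟨i, hi, rfl⟩ _ rfl; exact hd2 i j hi)
    exact ⟨z, h2 _ rfl, fun i hi => h1 _ ⟨i, hi, rfl⟩⟩
  choose c hc1 hc2 using hc
  exact ⟨c, d, fun i => ⟨hc1 i, hd1 i⟩, fun i j hij => hc2 j i hij⟩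

omit h in
lemma triOf_trans (i j k : Fin n) (hij : triOf ρ V i j) (hjk : triOf ρ V j k) : triOf ρ V i k :=
  ⟨hij.1.trans hjk.1, fun x => (hij.2 x).trans (hjk.2 x)⟩

-- Doubling the rank leaves room to place the lower side of an index before its upper side.
omit h in
lemma key_lt {a b : Fin n × Bool} (hab : prec ρ V a b) :
    2 * rank (triOf ρ V) a.1 + (!a.2).toNat < 2 * rank (triOf ρ V) b.1 + (!b.2).toNat := by
  obtain ⟨i, a⟩ := a
  obtain ⟨j, b⟩ := b
  rcases hab with ht | ⟨he, ha, hb⟩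
  · have := rank_lt triOf_trans (fun i hi => triOf_asymm hi hi) ht
    have h1 := Bool.toNat_le (!a)
    simp only at this ⊢
    omega
  · obtain rfl : i = j := he
    obtain rfl : a = true := ha
    obtain rfl : b = false := hb
    simp

/-- Every arranged tuple of sides is reached from one around a given element by moving single sides
through arranged tuples, and such moves keep the box nonempty. -/
lemma box (c d : Fin n → M) (h1 : ∀ i, V i (c i) ⊂ V i (d i))
    (h2 : ∀ i j, triOf ρ V i j → V i (d i) ⊂ V j (c j)) :
    ∃ y, ∀ i, V i (c i) ⊂ V i y ∧ V i y ⊂ V i (d i) := by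
  obtain ⟨y₀⟩ : Nonempty M := hM.out.infinite.nonempty
  obtain ⟨c₀, d₀, h3, h4⟩ := h.exists_corners y₀
  refine h.boxRel_sides_iff.1 ?_
  exact forall_of_moves (fun l (x : Side M σ l) => V l.1 x) (prec ρ V)
    (fun a => 2 * rank (triOf ρ V) a.1 + (!a.2).toNat) (fun a b => key_lt)
    (fun l x y => h.chain rfl x y) (Arranged ρ V) (fun p => Iff.rfl) (BoxRel M σ)
    (fun p l q => h.boxRel_update p l q)
    (arranged_sides (fun i => (h3 i).1.trans (h3 i).2) h4) (arranged_sides h1 h2)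
    (h.boxRel_sides_iff.2 ⟨y₀, h3⟩)

lemma chainSystem : ChainSystem ρ (triOf ρ V) V where
  chain := h.chain
  inj := h.inj
  dense := h.pre.dense
  exists_lt := h.pre.exists_lt
  exists_gt := h.pre.exists_gt
  tri_cls ht := ht.1
  tri_total := h.triOf_total
  ssubset_of_tri ht := ht.2
  box := h.box

end IsOrientationMaps

end

/-! ### Uniqueness -/

section

variable {n : ℕ} {M N : Type*} [(lang n).Structure M] [(lang n).Structure N]
  [hM : Fact (IsRankOneMultiOrder n M)] [hN : Fact (IsRankOneMultiOrder n N)]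

/-- The same case holds for each pair of orders of `M` and `N`. -/
def SameCases (n : ℕ) (M N : Type*) [(lang n).Structure M] [(lang n).Structure N] : Prop :=
  ∀ i j : Fin n, i ≠ j → ∀ c : PairCase, PairCase.Holds M i j c ↔ PairCase.Holds N i j c

lemma SameCases.twinBelow (h : SameCases n M N) {i j : Fin n} (hij : i ≠ j) (σ : Bool) :
    TwinBelow M σ i j ↔ TwinBelow N σ i j := by
  cases σ
  · rw [← holds_decreasingBelow, ← holds_decreasingBelow]
    exact h i j hij _
  · rw [← holds_increasingBelow, ← holds_increasingBelow]
    exact h i j hij _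

lemma SameCases.twinAbove (h : SameCases n M N) {i j : Fin n} (hij : i ≠ j) (σ : Bool) :
    TwinAbove M σ i j ↔ TwinAbove N σ i j := by
  cases σ
  · rw [← holds_decreasingAbove, ← holds_decreasingAbove]
    exact h i j hij _
  · rw [← holds_increasingAbove, ← holds_increasingAbove]
    exact h i j hij _

lemma SameCases.tw (h : SameCases n M N) (i j : Fin n) (σ : Bool)
    (ht : Tw n (sgn σ (leAt M i)) (leAt M j)) : Tw n (sgn σ (leAt N i)) (leAt N j) := by
  by_cases hij : i = j
  · subst hij
    cases σ
    · exact (not_tw_both (M := M) i i (tw_refl (r := leAt M i)) ht).elim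
    · exact tw_refl (r := leAt N i)
  · rcases twinBelow_or_above hij ht with hb | ha
    · exact ((h.twinBelow hij σ).1 hb).tw
    · exact ((h.twinAbove hij σ).1 ha).tw

lemma SameCases.symm (h : SameCases n M N) : SameCases n N M := fun i j hij c => (h i j hij c).symm

theorem nonempty_iso (h : SameCases n M N) : Nonempty (M ≃[lang n] N) := by
  have : Countable M := hM.out.countable
  have : Countable N := hN.out.countable
  have : Infinite M := hM.out.infinite
  have : Infinite N := hN.out.infinite
  -- Without orders any bijection of countably infinite sets will do; the systems of maps need an
  -- index.
  rcases isEmpty_or_nonempty (Fin n) with hn | hn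
  · obtain ⟨e⟩ := nonempty_equiv_of_countable (α := M) (β := N)
    exact ⟨isoOfLe e fun i => (hn.false i).elim⟩
  obtain ⟨ρ, σ, hMo⟩ := exists_orientation (n := n) M
  -- Which orders are intertwined, and in which direction, is part of the cases, so the orientation
  -- of `M` also serves for `N`.
  have hNo : IsOrientation N ρ σ :=
    ⟨fun i => h.tw _ _ _ (hMo.tw i), fun i j τ ht => hMo.eq_of_tw i j τ (h.symm.tw _ _ _ ht)⟩
  obtain ⟨V, hV⟩ := hMo.exists_maps
  obtain ⟨W, hW⟩ := hNo.exists_maps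
  have htri : triOf ρ V = triOf ρ W := by
    funext i j
    refine propext ?_
    by_cases hij : ρ i = ρ j
    · by_cases hne : i = j
      · subst hne
        exact ⟨fun ht => (IsOrientationMaps.triOf_asymm ht ht).elim,
          fun ht => (IsOrientationMaps.triOf_asymm ht ht).elim⟩
      · rw [hV.triOf_iff hij hne, hW.triOf_iff hij hne, h.twinBelow hne, h.twinAbove hne]
    · exact ⟨fun ht => (hij ht.1).elim, fun ht => (hij ht.1).elim⟩
  have hVs := hV.chainSystem
  have hWs := hW.chainSystem
  rw [← htri] at hWs
  obtain ⟨e, he⟩ := hVs.exists_equiv hWs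
  refine ⟨isoOfLe e fun i a b => ?_⟩
  have hrefl : ∀ x : N, leAt N i x x := (InvOrder.linear (r := leAt N i) n).refl
  have hrefl' : ∀ x : M, leAt M i x x := (InvOrder.linear (r := leAt M i) n).refl
  by_cases hab : a = b
  · subst hab
    exact ⟨fun _ => hrefl' a, fun _ => hrefl _⟩
  have hne : e a ≠ e b := fun hc => hab (e.injective hc)
  have h1 := he i a b
  have h2 := he i b a
  rw [hV.ssubset_iff, hW.ssubset_iff] at h1 h2
  unfold ord at h1 h2
  cases hσ : σ i <;> rw [hσ] at h1 h2
  · exact ⟨fun hl => (h2.2 ⟨hl, hne.symm⟩).1, fun hl => (h2.1 ⟨hl, Ne.symm hab⟩).1⟩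
  · exact ⟨fun hl => (h1.2 ⟨hl, hne⟩).1, fun hl => (h1.1 ⟨hl, hab⟩).1⟩

end

end MultiOrder

/-! ### The classification theorem. -/

theorem mainTheorem8 (n : ℕ) :
    (∀ (M : Type*) [(MultiOrder.lang n).Structure M],
      MultiOrder.IsRankOneMultiOrder n M →
      ∀ i j : Fin n, i ≠ j →
        ∃! c : MultiOrder.PairCase, MultiOrder.PairCase.Holds M i j c) ∧
    (∀ (M : Type*) (N : Type*)
      [(MultiOrder.lang n).Structure M] [(MultiOrder.lang n).Structure N],
      MultiOrder.IsRankOneMultiOrder n M → MultiOrder.IsRankOneMultiOrder n N →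
      (∀ i j : Fin n, i ≠ j → ∀ c : MultiOrder.PairCase,
        (MultiOrder.PairCase.Holds M i j c ↔ MultiOrder.PairCase.Holds N i j c)) →
      Nonempty (M ≃[MultiOrder.lang n] N)) := by
  refine ⟨?_, ?_⟩
  · intro M _ hM i j hij
    have : Fact (MultiOrder.IsRankOneMultiOrder n M) := ⟨hM⟩
    exact MultiOrder.existsUnique_holds M hij
  · intro M N _ _ hM hN h
    have : Fact (MultiOrder.IsRankOneMultiOrder n M) := ⟨hM⟩
    have : Fact (MultiOrder.IsRankOneMultiOrder n N) := ⟨hN⟩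
    exact MultiOrder.nonempty_iso h
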